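/- Work with schemes over $\mathbb{C}$. Let $\mathbb{A}^2_*=\mathrm{Spec}(\mathbb{C}[x,y])\setminus\{(0,0)\}$, with the linear $\mathbb{G}_m$-action $\sigma$ given by $\lambda\cdot(x,y)=(\lambda x,\lambda y)$. A $\mathbb{G}_a$-bundle is a Zariski locally trivial principal $\mathbb{G}_a$-bundle $\rho:X\to\mathbb{A}^2_*$; it is trivial if it is isomorphic to $\mathbb{A}^2_*\times\mathbb{G}_a$. For an integer $d\ge 2$, a nontrivial $\mathbb{G}_a$-bundle $\rho:X\to\mathbb{A}^2_*$ is called $-d$-homogeneous (homogeneous of degree $-d$) if $\sigma$ lifts to a $\mathbb{G}_m$-action on $X$ for which there exist a covering of $\mathbb{A}^2_*$ by $\mathbb{G}_m$-stable affine open subsets $U_i$ and $\mathbb{G}_a$-equivariant trivializations $\rho^{-1}(U_i)\simeq U_i\times\mathbb{G}_a$ over $U_i$ that are $\mathbb{G}_m$-equivariant for the action $\lambda\cdot(u,t)=(\sigma(\lambda,u),\lambda^{-d}t)$ on $U_i\times\mathbb{G}_a$. A homogeneous bundle is considered as equipped with such a lift. (1) Let $X$ and $X'$ be the total spaces of two nontrivial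 homogeneous $\mathbb{G}_a$-bundles of degrees $-d$ and $-d'$, equipped with lifts as above. Then $X$ and $X'$ are $\mathbb{G}_m$-equivariantly isomorphic if and only if $d=d'$. (2) In particular, for every fixed $d\ge 2$, the total spaces of nontrivial $-d$-homogeneous $\mathbb{G}_a$-bundles are affine, and any two of them are isomorphic as abstract affine varieties. (3) For example, for integers $m,n,p,q\ge 1$ with $m+n=p+q$, the affine threefolds $X_{m,n}=\{x^mv-y^nu=1\}$ and $X_{p,q}=\{x^pv-y^qu=1\}$ in $\mathbb{A}^4=\mathrm{Spec}(\mathbb{C}[x,y,u,v])$ are isomorphic. -/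

import Mathlib

open CategoryTheory AlgebraicGeometry

noncomputable section

namespace PuncturedPlane

/-- Schemes over `ℂ`. -/
abbrev CScheme : Type 1 := Over (Spec (CommRingCat.of ℂ))

/-- An action of the additive group scheme `𝔾ₐ` on a complex scheme `X`, given on `T`-valued points:
`𝔾ₐ(T) = (Γ(T, 𝒪_T), +)` acts on `X(T)`, functorially in the complex scheme `T`. By the Yoneda lemma
this is the same as an action morphism `𝔾ₐ × X ⟶ X`. -/
structure GaAction (X : CScheme) where
  act : ∀ {T : CScheme}, Γ(T.left, ⊤) → (T ⟶ X) → (T ⟶ X)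
  zero_act : ∀ {T : CScheme} (p : T ⟶ X), act 0 p = p
  add_act : ∀ {T : CScheme} (a b : Γ(T.left, ⊤)) (p : T ⟶ X), act (a + b) p = act a (act b p)
  natural : ∀ {T T' : CScheme} (f : T' ⟶ T) (a : Γ(T.left, ⊤)) (p : T ⟶ X),
    f ≫ act a p = act (f.left.appTop a) (f ≫ p)

/-- An action of the multiplicative group scheme `𝔾ₘ` on a complex scheme `X`, given on `T`-valued
points: `𝔾ₘ(T) = Γ(T, 𝒪_T)ˣ` acts on `X(T)`, functorially in the complex scheme `T`. -/
structure GmAction (X : CScheme) where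
  act : ∀ {T : CScheme}, Γ(T.left, ⊤)ˣ → (T ⟶ X) → (T ⟶ X)
  one_act : ∀ {T : CScheme} (p : T ⟶ X), act 1 p = p
  mul_act : ∀ {T : CScheme} (a b : Γ(T.left, ⊤)ˣ) (p : T ⟶ X), act (a * b) p = act a (act b p)
  natural : ∀ {T T' : CScheme} (f : T' ⟶ T) (a : Γ(T.left, ⊤)ˣ) (p : T ⟶ X),
    f ≫ act a p = act (Units.map (f.left.appTop.hom : Γ(T.left, ⊤) →* Γ(T'.left, ⊤)) a) (f ≫ p)

/-- `X` and `X'` are isomorphic as complex schemes with `𝔾ₘ`-action. -/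
def GmIsomorphic {X X' : CScheme} (μ : GmAction X) (μ' : GmAction X') : Prop :=
  ∃ f : X ≅ X', ∀ {T : CScheme} (c : Γ(T.left, ⊤)ˣ) (p : T ⟶ X),
    μ.act c p ≫ f.hom = μ'.act c (p ≫ f.hom)

/-- The affine plane over `ℂ`. -/
abbrev plane : Scheme.{0} := 𝔸(Fin 2; Spec (CommRingCat.of ℂ))

/-- The complement of the origin in the affine plane: the union of the loci where the first, resp.
the second, coordinate is invertible. -/
def puncturedOpen : plane.Opens :=
  plane.basicOpen (AffineSpace.coord _ 0) ⊔ plane.basicOpen (AffineSpace.coord _ 1)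

/-- The punctured affine plane `𝔸²_*` as a complex scheme. -/
def puncturedPlane : CScheme :=
  Over.mk (puncturedOpen.ι ≫ (plane ↘ Spec (CommRingCat.of ℂ)))

/-- The open immersion of the punctured plane in the plane. -/
def incl : puncturedPlane.left ⟶ plane := puncturedOpen.ι

instance : IsOpenImmersion incl := inferInstanceAs (IsOpenImmersion puncturedOpen.ι)

lemma incl_over : incl ≫ (plane ↘ Spec (CommRingCat.of ℂ)) = puncturedPlane.hom := rfl

lemma range_incl : Set.range incl = (puncturedOpen : Set plane) := puncturedOpen.range_ι

/-- The coordinates `(x, y)` of a `T`-valued point of the punctured plane. -/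
def coords {T : CScheme} (p : T ⟶ puncturedPlane) (i : Fin 2) : Γ(T.left, ⊤) :=
  (p.left ≫ incl).appTop (AffineSpace.coord _ i)

lemma coords_comp {T T' : CScheme} (f : T' ⟶ T) (p : T ⟶ puncturedPlane) (i : Fin 2) :
    coords (f ≫ p) i = f.left.appTop (coords p i) := by
  rw [coords, coords, Over.comp_left, Category.assoc, Scheme.Hom.comp_appTop]
  rfl

lemma point_ext {T : CScheme} {p q : T ⟶ puncturedPlane} (h : ∀ i, coords p i = coords q i) :
    p = q := by
  ext1
  rw [← cancel_mono incl]
  refine AffineSpace.hom_ext ?_ h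
  rw [Category.assoc, Category.assoc, incl_over, Over.w, Over.w]

lemma preimage_puncturedOpen {T : Scheme.{0}} (f : T ⟶ plane) :
    f ⁻¹ᵁ puncturedOpen = T.basicOpen (f.appTop (AffineSpace.coord _ 0)) ⊔
      T.basicOpen (f.appTop (AffineSpace.coord _ 1)) := by
  rw [← Scheme.preimage_basicOpen_top, ← Scheme.preimage_basicOpen_top]
  rfl

lemma range_scaled {T : CScheme} (c : Γ(T.left, ⊤)ˣ) (p : T ⟶ puncturedPlane) :
    Set.range (AffineSpace.homOfVector T.hom (fun i => (c : Γ(T.left, ⊤)) * coords p i)) ⊆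
      Set.range incl := by
  rw [range_incl]
  rintro _ ⟨t, rfl⟩
  have h : t ∈ (p.left ≫ incl) ⁻¹ᵁ puncturedOpen := by
    change (p.left ≫ incl) t ∈ (puncturedOpen : Set plane)
    rw [← range_incl, Scheme.Hom.comp_apply]
    exact ⟨_, rfl⟩
  change t ∈ AffineSpace.homOfVector T.hom (fun i => (c : Γ(T.left, ⊤)) * coords p i) ⁻¹ᵁ
    puncturedOpen
  rw [preimage_puncturedOpen] at h ⊢
  rw [AffineSpace.homOfVector_appTop_coord, AffineSpace.homOfVector_appTop_coord,
    Scheme.basicOpen_mul, Scheme.basicOpen_mul, Scheme.basicOpen_of_isUnit _ c.isUnit,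
    top_inf_eq, top_inf_eq]
  exact h

/-- The point `(c x, c y)`. -/
def scaled {T : CScheme} (c : Γ(T.left, ⊤)ˣ) (p : T ⟶ puncturedPlane) : T ⟶ puncturedPlane :=
  Over.homMk (IsOpenImmersion.lift incl
    (AffineSpace.homOfVector T.hom (fun i => (c : Γ(T.left, ⊤)) * coords p i)) (range_scaled c p))
    (by rw [← incl_over, IsOpenImmersion.lift_fac_assoc, AffineSpace.homOfVector_over])

lemma coords_scaled {T : CScheme} (c : Γ(T.left, ⊤)ˣ) (p : T ⟶ puncturedPlane) (i : Fin 2) :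
    coords (scaled c p) i = c * coords p i := by
  simp only [coords, scaled, Over.homMk_left, IsOpenImmersion.lift_fac]
  exact AffineSpace.homOfVector_appTop_coord _ _ _

/-- The linear action `λ · (x, y) = (λ x, λ y)` of `𝔾ₘ` on the punctured plane. -/
def linearAction : GmAction puncturedPlane where
  act c p := scaled c p
  one_act p := point_ext fun i => by simp [coords_scaled]
  mul_act a b p := point_ext fun i => by simp [coords_scaled, mul_assoc]
  natural f a p := point_ext fun i => by simp [coords_scaled, coords_comp]

/-- An open subset of the punctured plane that is stable under the linear action of `𝔾ₘ`: if a
`T`-valued point factors through `U`, then so do all its multiples. -/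
def IsStable (U : puncturedPlane.left.Opens) : Prop :=
  ∀ {T : CScheme} (c : Γ(T.left, ⊤)ˣ) (p : T ⟶ puncturedPlane),
    Set.range p.left ⊆ U → Set.range (linearAction.act c p).left ⊆ U

/-- A `𝔾ₐ`-equivariant trivialization over `U` of a scheme `X` over the punctured plane with an
action of `𝔾ₐ`: an isomorphism `X|_U ≅ U × 𝔸¹` over `U` which turns the action of `𝔾ₐ` into the
translation of the second factor. -/
structure Trivialization {X : CScheme} (ρ : X ⟶ puncturedPlane) (α : GaAction X)
    (U : puncturedPlane.left.Opens) where
  iso : (ρ.left ⁻¹ᵁ U).toScheme ≅ 𝔸(Fin 1; U.toScheme)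
  iso_over : iso.hom ≫ (𝔸(Fin 1; U.toScheme) ↘ U.toScheme) = ρ.left ∣_ U
  equivariant : ∀ {T : CScheme} (a : Γ(T.left, ⊤)) (p : T ⟶ X)
    (q q' : T.left ⟶ (ρ.left ⁻¹ᵁ U).toScheme),
    q ≫ (ρ.left ⁻¹ᵁ U).ι = p.left → q' ≫ (ρ.left ⁻¹ᵁ U).ι = (α.act a p).left →
      (q' ≫ iso.hom).appTop (AffineSpace.coord _ 0) =
        (q ≫ iso.hom).appTop (AffineSpace.coord _ 0) + a

/-- A Zariski locally trivial principal `𝔾ₐ`-bundle over the punctured plane. -/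
structure GaBundle where
  /-- the total space -/
  X : CScheme
  ρ : X ⟶ puncturedPlane
  action : GaAction X
  invariant : ∀ {T : CScheme} (a : Γ(T.left, ⊤)) (p : T ⟶ X), action.act a p ≫ ρ = p ≫ ρ
  locallyTrivial : ∀ s : puncturedPlane.left, ∃ U : puncturedPlane.left.Opens,
    s ∈ U ∧ Nonempty (Trivialization ρ action U)

/-- A `𝔾ₐ`-bundle is trivial if it is isomorphic to `𝔸²_* × 𝔾ₐ`. -/
def GaBundle.IsTrivial (B : GaBundle) : Prop :=
  Nonempty (Trivialization B.ρ B.action ⊤)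

/-- The trivialization `τ : X|_U ≅ U × 𝔸¹` turns the action `μ` of `𝔾ₘ` on `X` into the action
`λ · (u, t) = (λ u, λ⁻ᵈ t)` on `U × 𝔸¹`, as far as the second factor is concerned. (On the first
factor this says that `μ` lifts the linear action.) -/
def Trivialization.HasWeight {X : CScheme} {ρ : X ⟶ puncturedPlane} {α : GaAction X}
    {U : puncturedPlane.left.Opens} (τ : Trivialization ρ α U) (μ : GmAction X) (d : ℕ) : Prop :=
  ∀ {T : CScheme} (c : Γ(T.left, ⊤)ˣ) (p : T ⟶ X) (q q' : T.left ⟶ (ρ.left ⁻¹ᵁ U).toScheme),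
    q ≫ (ρ.left ⁻¹ᵁ U).ι = p.left → q' ≫ (ρ.left ⁻¹ᵁ U).ι = (μ.act c p).left →
      (q' ≫ τ.iso.hom).appTop (AffineSpace.coord _ 0) =
        ((c ^ (-(d : ℤ)) : Γ(T.left, ⊤)ˣ) : Γ(T.left, ⊤)) *
          (q ≫ τ.iso.hom).appTop (AffineSpace.coord _ 0)

/-- The action `μ` of `𝔾ₘ` on the total space of `B` is a lift of the linear action on the
punctured plane that makes `B` homogeneous of degree `-d`: there are a covering of the punctured
plane by `𝔾ₘ`-stable affine open subsets and `𝔾ₐ`-equivariant trivializations over them which are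
`𝔾ₘ`-equivariant for the action `λ · (u, t) = (λ u, λ⁻ᵈ t)`. -/
structure GaBundle.IsHomogeneousLift (B : GaBundle) (μ : GmAction B.X) (d : ℕ) : Prop where
  lifts : ∀ {T : CScheme} (c : Γ(T.left, ⊤)ˣ) (p : T ⟶ B.X),
    μ.act c p ≫ B.ρ = linearAction.act c (p ≫ B.ρ)
  cover : ∀ s : puncturedPlane.left, ∃ U : puncturedPlane.left.Opens,
    s ∈ U ∧ IsStable U ∧ IsAffineOpen U ∧ ∃ τ : Trivialization B.ρ B.action U, τ.HasWeight μ d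

/-- `B` is a (nontrivial) `-d`-homogeneous `𝔾ₐ`-bundle when equipped with the lift `μ`. -/
structure GaBundle.IsHomogeneousWith (B : GaBundle) (μ : GmAction B.X) (d : ℕ) : Prop where
  nontrivial : ¬ B.IsTrivial
  two_le : 2 ≤ d
  isLift : B.IsHomogeneousLift μ d

/-- `B` is a (nontrivial) `-d`-homogeneous `𝔾ₐ`-bundle. -/
def GaBundle.IsHomogeneous (B : GaBundle) (d : ℕ) : Prop :=
  ∃ μ : GmAction B.X, B.IsHomogeneousWith μ d

open MvPolynomial in
/-- The threefold `X_{m,n} = {x ^ m v - y ^ n u = 1}` (for `m, n ≥ 1`), with coordinates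
`x, y, u, v = X 0, X 1, X 2, X 3`; there `x` and `y` have no common zero. -/
def Xmn (m n : ℕ) : CScheme :=
  Over.mk (Spec.map (CommRingCat.ofHom (algebraMap ℂ (MvPolynomial (Fin 4) ℂ ⧸
    Ideal.span {(X 0 ^ m * X 3 - X 1 ^ n * X 2 - 1 : MvPolynomial (Fin 4) ℂ)}))))

end PuncturedPlane

end

/-! Everything is read off from the ring `A` of functions on the total space. A nontrivial
homogeneous bundle of degree `-d` is a nonzero class in the degree `-d` part of H¹(𝔸²_*, 𝒪), which
has the basis x⁻ⁱy⁻ʲ with i, j ≥ 1 and i + j = d. For a linear form Y = y - κx, multiplication by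
Y^(d-1) sends the class to degree -1, where H¹ vanishes; this produces a function `V` of weight -1
that grows along the fibres with slope Y^(d-1) (`IsTorsorRing.exists_V`). For a suitable κ the
product of the class with Y^(d-2) is a nonzero multiple c of 1/(xy), and then xV = c on the locus Y
= 0.

Away from x = 0, with ζ = Y/x, the functions xV and YV agree modulo Y^(d-1) with β(ζ) and ζβ(ζ),
where β(0) = c ≠ 0. Hence xV ≡ φ(YV) modulo Y^(d-1) for some polynomial φ with φ(0) = c. Dividing
the difference by Y^(d-1) gives `u`, and absorbing the higher terms of φ into x gives x' with x'V -
Y^(d-1)u = c. After normalisation `A` is the coordinate ring of X_{1,d-1} with x', Y, u, V in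
degrees 1, 1, 1-d, -1 (`IsTorsorRing.exists_coordinates`, `IsTorsorRing.exists_algEquiv`). So the
graded ring depends only on d. As x and y generate the unit ideal of `A`, the total space is affine.
The threefold X_{m,n} is itself such a bundle of degree -(m+n), which gives the last claim.

Conversely, d is recovered from the grading through the canonical bundle. Triderivations of the
coordinate ring of X_{1,n} form a free module of rank one generated by the Jacobian bracket, so an
isomorphism X_{1,m} ≅ X_{1,n} multiplies brackets by a unit. If it is equivariant, the unit is
homogeneous of weight m - n, and homogeneous units have weight 0
(`ThreefoldRing.eq_of_equivariant`).

The passage from schemes to algebra (`GaBundle.IsHomogeneousWith.exists_isTorsorRing`) consists in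
finding homogeneous fibre coordinates on the loci x ≠ 0 and y ≠ 0 and in showing that their
difference is given by a binary form. -/

namespace PuncturedPlane

noncomputable section

/-! ### Binary forms and polynomials in one variable. -/

open Polynomial in
/-- The binary form `∑ pᵢ x ^ (N - i) y ^ i` of degree `N` with coefficients those of `p`. -/
def form {A : Type*} [CommRing A] [Algebra ℂ A] (N : ℕ) (p : ℂ[X]) (x y : A) : A :=
  ∑ i ∈ Finset.range (N + 1), algebraMap ℂ A (p.coeff i) * x ^ (N - i) * y ^ i

section Form
open Polynomial
variable {A A' : Type*} [CommRing A] [Algebra ℂ A] [CommRing A'] [Algebra ℂ A']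

lemma map_form (f : A →ₐ[ℂ] A') (N : ℕ) (p : ℂ[X]) (x y : A) :
    f (form N p x y) = form N p (f x) (f y) := by
  simp [form]

/-- Dehomogenisation. The degree bound matters, since `form` drops the coefficients above `N`. -/
lemma form_eq_pow_mul_aeval {K : Type*} [Field K] [Algebra ℂ K] {N : ℕ} {p : ℂ[X]}
    (hp : p.natDegree ≤ N) {x : K} (hx : x ≠ 0) (y : K) :
    form N p x y = x ^ N * aeval (y / x) p := by
  rw [aeval_eq_sum_range' (Nat.lt_succ_of_le hp), form, Finset.mul_sum]
  refine Finset.sum_congr rfl fun i hi => ?_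
  rw [Finset.mem_range] at hi
  obtain ⟨j, rfl⟩ := Nat.exists_eq_add_of_le (Nat.lt_succ_iff.mp hi)
  rw [Algebra.smul_def, Nat.add_sub_cancel_left, div_pow, pow_add]
  field_simp

lemma form_mem {S : Subalgebra ℂ A} {x y : A} (hx : x ∈ S) (hy : y ∈ S) (N : ℕ) (p : ℂ[X]) :
    form N p x y ∈ S :=
  sum_mem fun _ _ => mul_mem (mul_mem (algebraMap_mem _ _) (pow_mem hx _)) (pow_mem hy _)

lemma coeff_iterate_divX (q : ℂ[X]) (m i : ℕ) : (divX^[m] q).coeff i = q.coeff (m + i) := by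
  induction m generalizing i with
  | zero => simp
  | succ m ih => rw [Function.iterate_succ_apply', coeff_divX, ih]; congr 1; omega

/-- The exponents of a monomial of degree 2(k+1) - 1 cannot both be below k+1. This is the vanishing
of H¹ of the punctured plane in degree -1. -/
lemma form_split (k : ℕ) (q : ℂ[X]) (x y : A) :
    form (2 * (k + 1) - 1) q x y =
      x ^ (k + 1) * form k q x y + y ^ (k + 1) * form k (divX^[k + 1] q) x y := by
  simp only [form, coeff_iterate_divX, Finset.mul_sum]
  rw [show 2 * (k + 1) - 1 + 1 = (k + 1) + (k + 1) by omega, Finset.sum_range_add]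
  congr 1
  · refine Finset.sum_congr rfl fun i hi => ?_
    rw [Finset.mem_range] at hi
    rw [show 2 * (k + 1) - 1 - i = (k + 1) + (k - i) by omega, pow_add]
    ring
  · refine Finset.sum_congr rfl fun i hi => ?_
    rw [Finset.mem_range] at hi
    rw [show 2 * (k + 1) - 1 - (k + 1 + i) = k - i by omega, pow_add]
    ring

lemma natDegree_iterate_divX_le (q : ℂ[X]) (m N : ℕ) (h : q.natDegree ≤ m + N) :
    (divX^[m] q).natDegree ≤ N := by
  refine natDegree_le_iff_coeff_eq_zero.mpr fun i hi => ?_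
  rw [coeff_iterate_divX]
  exact coeff_eq_zero_of_natDegree_lt (by omega)

/-- The value at `κ` of the upper half of the coefficients of a multiple of `X - κ`. -/
lemma eval_iterate_divX (r : ℂ[X]) (κ : ℂ) (k : ℕ) (hr : r.natDegree ≤ 2 * k) :
    (divX^[k + 1] (r * (X - C κ))).eval κ = r.coeff k := by
  have hd : (divX^[k + 1] (r * (X - C κ))).natDegree ≤ k := by
    refine natDegree_iterate_divX_le _ _ _ (natDegree_mul_le.trans ?_)
    rw [natDegree_X_sub_C]
    omega
  rw [eval_eq_sum_range' (Nat.lt_succ_of_le hd)]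
  -- The sum telescopes: the coefficient k+1+i of r(X - κ) is r_{k+i} - κ r_{k+i+1}. At m = k+1 the
  -- remainder involves r_{2k+1} = 0.
  have h : ∀ m, ∑ i ∈ Finset.range m, (divX^[k + 1] (r * (X - C κ))).coeff i * κ ^ i =
      r.coeff k - r.coeff (k + m) * κ ^ m := by
    intro m
    induction m with
    | zero => simp
    | succ m ih =>
      rw [Finset.sum_range_succ, ih, coeff_iterate_divX, mul_sub, coeff_sub, coeff_mul_C,
        show k + 1 + m = k + m + 1 by ring, coeff_mul_X]
      rw [show k + (m + 1) = k + m + 1 by ring]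
      ring
  rw [h, coeff_eq_zero_of_natDegree_lt (n := k + (k + 1)) (by omega)]
  simp

/-- Some translate of a form that is nonzero in the middle degrees has a nonzero middle
coefficient. -/
lemma exists_coeff_mul_pow_ne_zero (Γ : ℂ[X]) (k e i : ℕ) (hi : i ≤ k) (hik : k ≤ e + i)
    (h : Γ.coeff i ≠ 0) : ∃ κ : ℂ, (Γ * (X - C κ) ^ e).coeff k ≠ 0 := by
  by_contra! hcon
  -- The middle coefficient as a polynomial in κ. Different j with k ≤ e + j contribute different
  -- powers of κ, so nothing cancels; the `if` guards the truncated subtraction for the other j.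
  let q : ℂ[X] := ∑ j ∈ Finset.range (k + 1),
    monomial (e - (k - j)) (if k ≤ e + j then (-1) ^ (e - (k - j)) * (e.choose (k - j) : ℂ) *
      Γ.coeff j else 0)
  have hq : q = 0 := by
    refine Polynomial.funext fun κ => ?_
    rw [eval_zero, ← hcon κ, coeff_mul,
      Finset.Nat.sum_antidiagonal_eq_sum_range_succ_mk, eval_finsetSum]
    refine Finset.sum_congr rfl fun j hj => ?_
    rw [eval_monomial, sub_eq_add_neg, ← C_neg, coeff_X_add_C_pow]
    split_ifs with hje
    · rw [neg_pow κ]; ring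
    · rw [Nat.choose_eq_zero_of_lt (by omega)]; simp
  have hqi : q.coeff (e - (k - i)) = (-1) ^ (e - (k - i)) * (e.choose (k - i) : ℂ) *
      Γ.coeff i := by
    rw [finsetSum_coeff, Finset.sum_eq_single i]
    · rw [coeff_monomial, if_pos rfl, if_pos hik]
    · intro j hj hji
      rw [Finset.mem_range] at hj
      rw [coeff_monomial]
      split_ifs with h1 h2
      · omega
      · rfl
      · rfl
    · intro hn
      exact absurd (Finset.mem_range.mpr (by omega)) hn
  rw [hq, coeff_zero] at hqi
  refine mul_ne_zero (mul_ne_zero (pow_ne_zero _ (by norm_num)) ?_) h hqi.symm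
  exact_mod_cast (Nat.choose_pos (by omega)).ne'

/-- Modulo `X ^ n`, every polynomial is a polynomial in `X * β` if `β` does not vanish at `0`. -/
lemma exists_comp_X_mul_sub (β h : ℂ[X]) (hβ : β.coeff 0 ≠ 0) (n : ℕ) :
    ∃ φ : ℂ[X], X ^ n ∣ h - φ.comp (X * β) := by
  induction n with
  | zero => exact ⟨0, by simp⟩
  | succ n ih =>
    obtain ⟨φ, r, hr⟩ := ih
    let e : ℂ := r.coeff 0 / β.coeff 0 ^ n
    have hX : X ∣ r - C e * β ^ n := by
      rw [X_dvd_iff, coeff_sub, coeff_C_mul, coeff_zero_eq_eval_zero (β ^ n), eval_pow,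
        ← coeff_zero_eq_eval_zero]
      simp [e, hβ]
    obtain ⟨s, hs⟩ := hX
    refine ⟨φ + C e * X ^ n, s, ?_⟩
    rw [add_comp, mul_comp, C_comp, pow_comp, X_comp, pow_succ, mul_assoc, ← hs, mul_sub, ← hr]
    ring

end Form

/-! ### Saturation of a subalgebra with respect to an element. -/

section Saturation
variable {R A : Type*} [CommRing R] [CommRing A] [Algebra R A]

/-- The elements of `A` that are multiplied into `S` by a power of `x`. -/
def saturation (S : Subalgebra R A) (x : A) (hx : x ∈ S) : Subalgebra R A where
  carrier := {a | ∃ K : ℕ, x ^ K * a ∈ S}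
  mul_mem' := by
    rintro a b ⟨K, hK⟩ ⟨L, hL⟩
    refine ⟨K + L, ?_⟩
    rw [show x ^ (K + L) * (a * b) = (x ^ K * a) * (x ^ L * b) by ring]
    exact mul_mem hK hL
  add_mem' := by
    rintro a b ⟨K, hK⟩ ⟨L, hL⟩
    refine ⟨K + L, ?_⟩
    rw [show x ^ (K + L) * (a + b) = x ^ L * (x ^ K * a) + x ^ K * (x ^ L * b) by ring]
    exact add_mem (mul_mem (pow_mem hx _) hK) (mul_mem (pow_mem hx _) hL)
  algebraMap_mem' r := ⟨0, by simp⟩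

lemma le_saturation (S : Subalgebra R A) (x : A) (hx : x ∈ S) : S ≤ saturation S x hx :=
  fun a ha => ⟨0, by simpa using ha⟩

lemma mem_saturation_of_mul_mem {S : Subalgebra R A} {x : A} {hx : x ∈ S} {a : A} (K : ℕ)
    (h : x ^ K * a ∈ saturation S x hx) : a ∈ saturation S x hx := by
  obtain ⟨L, hL⟩ := h
  exact ⟨L + K, by rwa [pow_add, mul_assoc]⟩

lemma aeval_mem_of_mem {S : Subalgebra R A} {a : A} (ha : a ∈ S) (p : Polynomial R) :
    Polynomial.aeval a p ∈ S :=
  Algebra.adjoin_le (Set.singleton_subset_iff.mpr ha) (Polynomial.aeval_mem_adjoin_singleton R a)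

end Saturation

/-! ### Rings of functions of torsors, and their generators. -/

open Polynomial in
/-- The ring of functions `A` on the total space of a nontrivial `𝔾ₐ`-torsor over the punctured
plane with coordinates `x` and `y`, in algebraic terms: `τ / x ^ k` and `ς / y ^ k` are fibre
coordinates over the loci `x ≠ 0` and `y ≠ 0`, and their difference is the Laurent polynomial
`Γ(x, y) / (x y) ^ k`, homogeneous of degree `-d`. -/
structure IsTorsorRing {A : Type*} [CommRing A] [Algebra ℂ A] (x y τ ς : A) (k d : ℕ) (Γ : ℂ[X]) :
    Prop where
  two_le : 2 ≤ d
  le : d ≤ k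
  regular : ∀ a, x * a = 0 → a = 0
  points : ∀ a b c : ℂ, a ≠ 0 → ∃ φ : A →ₐ[ℂ] ℂ, φ x = a ∧ φ y = b ∧ φ τ = c
  exists_mem_x : ∀ a, ∃ K : ℕ, x ^ K * a ∈ Algebra.adjoin ℂ {x, y, τ}
  exists_mem_y : ∀ a, ∃ K : ℕ, y ^ K * a ∈ Algebra.adjoin ℂ {x, y, ς}
  glue : ∀ (j : ℕ) (α β : A), y ^ j * α = x ^ j * β → ∃ a, α = x ^ j * a ∧ β = y ^ j * a
  natDegree_le : Γ.natDegree ≤ 2 * k - d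
  cocycle : x ^ k * ς - y ^ k * τ = form (2 * k - d) Γ x y
  nontrivial : ∃ i, k < i + d ∧ i < k ∧ Γ.coeff i ≠ 0

section Points
open MvPolynomial
variable {A : Type*} [CommRing A] [Algebra ℂ A] {x y τ : A}

/-- The points only cover the region where the first coordinate is nonzero; multiplying by that
coordinate gives a polynomial that vanishes everywhere. -/
lemma aeval_injective_of_points
    (points : ∀ a b c : ℂ, a ≠ 0 → ∃ φ : A →ₐ[ℂ] ℂ, φ x = a ∧ φ y = b ∧ φ τ = c)
    (p : MvPolynomial (Fin 3) ℂ) (hp : aeval ![x, y, τ] p = 0) : p = 0 := by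
  have h : p * X 0 = 0 := by
    refine MvPolynomial.funext fun v => ?_
    rw [map_mul, eval_X, map_zero]
    by_cases hv : v 0 = 0
    · rw [hv, mul_zero]
    obtain ⟨φ, h0, h1, h2⟩ := points (v 0) (v 1) (v 2) hv
    have := congrArg φ hp
    rw [map_zero, ← AlgHom.comp_apply, comp_aeval] at this
    have hv' : (fun i => φ (![x, y, τ] i)) = v := by
      funext i
      fin_cases i <;> simp [h0, h1, h2]
    rw [hv', aeval_eq_eval] at this
    rw [this, zero_mul]
  exact (mul_eq_zero.mp h).resolve_right (X_ne_zero 0)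

/-- Powers of the non-zero-divisor x carry elements into the subalgebra generated by x, y, τ, which
is a polynomial ring. -/
lemma isDomain_of_points
    (points : ∀ a b c : ℂ, a ≠ 0 → ∃ φ : A →ₐ[ℂ] ℂ, φ x = a ∧ φ y = b ∧ φ τ = c)
    (regular : ∀ a, x * a = 0 → a = 0)
    (exists_mem_x : ∀ a, ∃ K : ℕ, x ^ K * a ∈ Algebra.adjoin ℂ {x, y, τ}) : IsDomain A := by
  obtain ⟨φ, -⟩ := points 1 0 0 one_ne_zero
  have : Nontrivial A := φ.toRingHom.domain_nontrivial
  have reg : ∀ (K : ℕ) a, x ^ K * a = 0 → a = 0 := by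
    intro K
    induction K with
    | zero => simp
    | succ K ih => intro a ha; exact regular a (ih _ (by rw [← ha]; ring))
  have hr : ({x, y, τ} : Set A) = Set.range ![x, y, τ] := by
    rw [Matrix.range_cons, Matrix.range_cons, Matrix.range_cons, Matrix.range_empty]
    simp only [Set.union_empty, Set.singleton_union]
  have : NoZeroDivisors A := by
    refine ⟨fun {a b} hab => ?_⟩
    obtain ⟨K, hK⟩ := exists_mem_x a
    obtain ⟨L, hL⟩ := exists_mem_x b
    rw [hr, Algebra.adjoin_range_eq_range_aeval] at hK hL
    obtain ⟨p, hp⟩ := hK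
    obtain ⟨q, hq⟩ := hL
    change aeval ![x, y, τ] p = _ at hp
    change aeval ![x, y, τ] q = _ at hq
    have h : p * q = 0 := aeval_injective_of_points points _ (by
      rw [map_mul, hp, hq, show x ^ K * a * (x ^ L * b) = x ^ K * x ^ L * (a * b) by ring, hab,
        mul_zero])
    rcases mul_eq_zero.mp h with h | h
    · left; exact reg K a (by rw [← hp, h, map_zero])
    · right; exact reg L b (by rw [← hq, h, map_zero])
  exact NoZeroDivisors.to_isDomain A

end Points

namespace IsTorsorRing
open Polynomial
variable {A : Type*} [CommRing A] [Algebra ℂ A] {x y τ ς : A} {k d : ℕ} {Γ : ℂ[X]}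

lemma isDomain (h : IsTorsorRing x y τ ς k d Γ) : IsDomain A :=
  isDomain_of_points h.points h.regular h.exists_mem_x

lemma x_ne_zero (h : IsTorsorRing x y τ ς k d Γ) : x ≠ 0 := by
  rintro rfl
  obtain ⟨φ, h0, -⟩ := h.points 1 0 0 one_ne_zero
  simp at h0

lemma sub_ne_zero (h : IsTorsorRing x y τ ς k d Γ) (κ : ℂ) : y - algebraMap ℂ A κ * x ≠ 0 := by
  intro h0
  obtain ⟨φ, h1, h2, -⟩ := h.points 1 (κ + 1) 0 one_ne_zero
  have := congrArg φ h0
  simp [h1, h2] at this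

/-- Divisibility by Y = y - κx can be tested away from x = 0, because x, Y behave as a regular
sequence: from x^(K+1) b = Y a one gets y a = x (x^K b + κ a), and `glue` with j = 1 makes a
divisible by x. -/
lemma dvd_of_pow_mul_eq (h : IsTorsorRing x y τ ς k d Γ) (κ : ℂ) (K n : ℕ) (a b : A)
    (hab : x ^ K * b = (y - algebraMap ℂ A κ * x) ^ n * a) :
    (y - algebraMap ℂ A κ * x) ^ n ∣ b := by
  have := h.isDomain
  have h1 : ∀ K a b, x ^ K * b = (y - algebraMap ℂ A κ * x) * a →
      (y - algebraMap ℂ A κ * x) ∣ b := by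
    intro K
    induction K with
    | zero => intro a b hab; exact ⟨a, by rw [← hab]; ring⟩
    | succ K ih =>
      intro a b hab
      obtain ⟨c, hc, -⟩ := h.glue 1 a (x ^ K * b + algebraMap ℂ A κ * a) (by
        linear_combination -hab)
      refine ih c b (mul_left_cancel₀ h.x_ne_zero ?_)
      rw [hc] at hab
      linear_combination hab
  induction n generalizing a b with
  | zero => simp
  | succ n ih =>
    obtain ⟨c, rfl⟩ := h1 K ((y - algebraMap ℂ A κ * x) ^ n * a) b (by rw [hab]; ring)
    obtain ⟨e, rfl⟩ := ih a c (mul_left_cancel₀ (h.sub_ne_zero κ) (by linear_combination hab))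
    exact ⟨e, by ring⟩

/-- The class times Y^(d-1) has degree -1, so it splits, and correcting Y^(d-1)τ and Y^(d-1)ς by the
two halves lets them glue to `V`. On Y = 0 the first formula reads xV = p(κ), which is why p(κ) ≠ 0
is needed later. -/
lemma exists_V (h : IsTorsorRing x y τ ς k d Γ) : ∃ (κ : ℂ) (V : A) (p q : ℂ[X]),
    p.natDegree ≤ k - 1 ∧ p.eval κ ≠ 0 ∧
    x ^ k * V = (y - algebraMap ℂ A κ * x) ^ (d - 1) * τ + form (k - 1) p x y ∧
    y ^ k * V = (y - algebraMap ℂ A κ * x) ^ (d - 1) * ς - form (k - 1) q x y := by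
  have := h.isDomain
  have hd := h.two_le
  have hdk := h.le
  have hdeg := h.natDegree_le
  obtain ⟨i, hi, hik, hΓ⟩ := h.nontrivial
  -- The exponent d - 2 makes k - 1 the middle degree: Γ(X - κ)^(d-2) has degree at most 2(k - 1),
  -- and its middle coefficient will turn out to be p(κ).
  obtain ⟨κ, hκ⟩ := exists_coeff_mul_pow_ne_zero Γ (k - 1) (d - 2) i (by omega) (by omega) hΓ
  obtain ⟨k, rfl⟩ : ∃ m, k = m + 1 := ⟨k - 1, by omega⟩
  rw [Nat.add_sub_cancel] at *
  set r := Γ * (X - C κ) ^ (d - 2) with hr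
  have hpow (e : ℕ) : ((X - C κ) ^ e).natDegree ≤ e := by
    simp
  have hrdeg : r.natDegree ≤ 2 * k := by
    have := hpow (d - 2)
    exact natDegree_mul_le.trans (by omega)
  have hqdeg : (r * (X - C κ)).natDegree ≤ 2 * (k + 1) - 1 := by
    refine natDegree_mul_le.trans ?_
    rw [natDegree_X_sub_C]
    omega
  -- Both sides have the same dehomogenisation; the comparison takes place in the fraction field,
  -- where x is invertible.
  have hform : (y - algebraMap ℂ A κ * x) ^ (d - 1) * form (2 * (k + 1) - d) Γ x y =
      form (2 * (k + 1) - 1) (r * (X - C κ)) x y := by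
    let ι : A →ₐ[ℂ] FractionRing A := IsScalarTower.toAlgHom ℂ A (FractionRing A)
    have hι : Function.Injective ι := IsFractionRing.injective A (FractionRing A)
    have hx : ι x ≠ 0 := by
      rw [← map_zero ι]; exact hι.ne h.x_ne_zero
    apply hι
    rw [map_mul, map_form, map_form, form_eq_pow_mul_aeval hdeg hx,
      form_eq_pow_mul_aeval hqdeg hx, hr]
    simp only [map_mul, map_pow, map_sub, aeval_X, aeval_C, AlgHom.commutes]
    have hY : ι y - algebraMap ℂ (FractionRing A) κ * ι x =
        ι x * (ι y / ι x - algebraMap ℂ (FractionRing A) κ) := by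
      field_simp
    rw [hY, mul_pow, show 2 * (k + 1) - 1 = (d - 1) + (2 * (k + 1) - d) by omega, pow_add,
      show d - 1 = d - 2 + 1 by omega]
    ring
  rw [← h.cocycle, form_split] at hform
  obtain ⟨V, hV1, hV2⟩ := h.glue (k + 1)
    ((y - algebraMap ℂ A κ * x) ^ (d - 1) * τ + form k (divX^[k + 1] (r * (X - C κ))) x y)
    ((y - algebraMap ℂ A κ * x) ^ (d - 1) * ς - form k (r * (X - C κ)) x y)
    (by linear_combination -hform)
  refine ⟨κ, V, divX^[k + 1] (r * (X - C κ)), r * (X - C κ), ?_, ?_, hV1.symm, hV2.symm⟩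
  · exact natDegree_iterate_divX_le _ _ _ (by omega)
  · rwa [eval_iterate_divX r κ k hrdeg]

/-- The expansion of `x V - φ(Y V)` along `Y = y - κ x`, with denominators cleared. -/
lemma exists_expansion (h : IsTorsorRing x y τ ς k d Γ) {κ : ℂ} {V : A} {p φ : ℂ[X]} {n : ℕ}
    (hp : p.natDegree ≤ k - 1)
    (hV : x ^ k * V = (y - algebraMap ℂ A κ * x) ^ n * τ + form (k - 1) p x y)
    (hφ : X ^ n ∣ p.comp (X + C κ) - φ.comp (X * p.comp (X + C κ)))
    (B : Subalgebra ℂ A) (hxB : x ∈ B) (hyB : y ∈ B) (hVB : V ∈ B) :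
    ∃ M : ℕ, ∃ e ∈ B, ∃ s ∈ B,
      x ^ (M + k + n) * (x * V - aeval ((y - algebraMap ℂ A κ * x) * V) φ) =
        (y - algebraMap ℂ A κ * x) ^ n *
          (τ * x ^ n * (x ^ (M + 1) - (y - algebraMap ℂ A κ * x) * e) + x ^ k * s) := by
  have := h.isDomain
  set Y := y - algebraMap ℂ A κ * x with hYdef
  have hYB : Y ∈ B := sub_mem hyB (mul_mem (algebraMap_mem _ _) hxB)
  let ι : A →ₐ[ℂ] FractionRing A := IsScalarTower.toAlgHom ℂ A (FractionRing A)
  have hι : Function.Injective ι := IsFractionRing.injective A (FractionRing A)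
  have hx : ι x ≠ 0 := by
    rw [← map_zero ι]; exact hι.ne h.x_ne_zero
  have hxB' : ι x ∈ B.map ι := ⟨x, hxB, rfl⟩
  -- S is the image of `B` with x inverted as far as the fraction field allows. Keeping ζ, β(ζ) and
  -- the quotient `E` in S ensures that e and s come from `B`. The lemma serves twice: with `B = ⊤`
  -- for divisibility by Y^n, and with the subalgebra of the new generators for recovering τ.
  let S := saturation (B.map ι) (ι x) hxB'
  have hBS : ∀ b ∈ B, ι b ∈ S := fun b hb => le_saturation _ _ _ ⟨b, hb, rfl⟩
  set ζ := ι Y / ι x with hζ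
  have hζS : ζ ∈ S := mem_saturation_of_mul_mem 1 (by
    rw [pow_one, hζ, mul_div_cancel₀ _ hx]; exact hBS Y hYB)
  obtain ⟨r, hr⟩ := hφ
  set β := p.comp (X + C κ) with hβ
  have hkpos : k = (k - 1) + 1 := by have := h.two_le; have := h.le; omega
  have hVK : ι x * ι V = ι x * (ι Y ^ n * (ι τ / ι x ^ k)) + aeval ζ β := by
    have := congrArg ι hV
    rw [map_add, map_mul, map_mul, map_pow, map_pow, map_form,
      form_eq_pow_mul_aeval hp hx] at this
    have hz : aeval ζ β = aeval (ι y / ι x) p := by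
      rw [hβ, aeval_comp]
      congr 2
      simp only [map_add, aeval_X, aeval_C, hζ, hYdef, map_sub, map_mul, AlgHom.commutes]
      field_simp
      ring
    rw [hz]
    rw [hkpos] at this ⊢
    simp only [Nat.add_sub_cancel] at this
    rw [pow_succ] at this ⊢
    field_simp
    field_simp at this
    linear_combination this
  have hYV : ι (Y * V) = ζ * aeval ζ β + ι Y ^ (n + 1) * (ι τ / ι x ^ k) := by
    rw [map_mul, hζ]
    field_simp
    field_simp at hVK
    linear_combination (ι Y) * hVK
  have hβS : aeval ζ β ∈ S := aeval_mem_of_mem hζS β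
  -- Since YV and ζβ(ζ) differ by Y^(n+1)τ/x^k, so do their images under φ up to a factor `E`;
  -- applying `sub_dvd_eval_sub` inside S keeps `E` there.
  have hE : ∃ E ∈ S, aeval (ι (Y * V)) φ - aeval (ζ * aeval ζ β) φ =
      (ι (Y * V) - ζ * aeval ζ β) * E := by
    let a : S := ⟨ι (Y * V), hBS _ (mul_mem hYB hVB)⟩
    let b : S := ⟨ζ * aeval ζ β, mul_mem hζS hβS⟩
    obtain ⟨E, hE⟩ := sub_dvd_eval_sub a b (φ.map (algebraMap ℂ S))
    refine ⟨E, E.2, ?_⟩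
    have := congrArg S.val hE
    rw [eval_map_algebraMap, eval_map_algebraMap, map_sub, map_mul, map_sub, ← aeval_algHom_apply,
      ← aeval_algHom_apply] at this
    exact this
  obtain ⟨E, ⟨M₁, e, heB, he⟩, hE⟩ := hE
  obtain ⟨M₂, s, hsB, hs⟩ := aeval_mem_of_mem hζS r
  have hr' : aeval ζ β - aeval (ζ * aeval ζ β) φ = ζ ^ n * aeval ζ r := by
    have := congrArg (aeval ζ) hr
    simpa [aeval_comp] using this
  refine ⟨M₁ + M₂, x ^ M₂ * e, mul_mem (pow_mem hxB _) heB, x ^ M₁ * s,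
    mul_mem (pow_mem hxB _) hsB, hι ?_⟩
  have he' : ι e = ι x ^ M₁ * E := he
  have hs' : ι s = ι x ^ M₂ * aeval ζ r := hs
  have key : ι x * ι V - aeval (ι (Y * V)) φ =
      ι Y ^ n * (ι τ / ι x ^ k * (ι x - ι Y * E)) + ι Y ^ n / ι x ^ n * aeval ζ r := by
    have h1 : aeval (ι (Y * V)) φ = aeval (ζ * aeval ζ β) φ +
        ι Y ^ (n + 1) * (ι τ / ι x ^ k) * E := by
      rw [hYV] at hE ⊢
      linear_combination hE
    rw [h1, hVK, ← div_pow, ← hζ]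
    linear_combination hr'
  simp only [map_mul, map_sub, map_pow, map_add, ← aeval_algHom_apply, he', hs']
  rw [map_mul] at key
  rw [key]
  field_simp
  ring

lemma form_mem_graded {𝒲 : ℤ → Submodule ℂ A} [SetLike.GradedMonoid 𝒲] (hx : x ∈ 𝒲 1)
    (hy : y ∈ 𝒲 1) (N : ℕ) (p : ℂ[X]) : form N p x y ∈ 𝒲 N := by
  refine sum_mem fun i hi => ?_
  rw [Finset.mem_range] at hi
  rw [← Algebra.smul_def, smul_mul_assoc]
  refine Submodule.smul_mem _ _ ?_
  have h := SetLike.mul_mem_graded (SetLike.pow_mem_graded (N - i) hx)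
    (SetLike.pow_mem_graded i hy)
  convert h using 2
  simp only [nsmul_eq_mul, mul_one]
  omega

/-- The ring of functions of a nontrivial homogeneous torsor of degree `-d` is generated by
elements `x'`, `Y`, `u`, `V` with `x' V - Y ^ (d - 1) u = 1`. -/
theorem exists_coordinates (h : IsTorsorRing x y τ ς k d Γ) : ∃ x' Y u V : A,
    x' * V - Y ^ (d - 1) * u = 1 ∧ IsCoprime x y ∧ Y ≠ 0 ∧ Algebra.adjoin ℂ {x', Y, u, V} = ⊤ ∧
    (∀ p : MvPolynomial (Fin 3) ℂ, MvPolynomial.aeval ![x', Y, V] p = 0 → p = 0) ∧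
    ∀ (𝒲 : ℤ → Submodule ℂ A) [SetLike.GradedMonoid 𝒲],
      (∀ (i j : ℤ) (z a : A), z ≠ 0 → z ∈ 𝒲 i → z * a ∈ 𝒲 (i + j) → a ∈ 𝒲 j) →
      x ∈ 𝒲 1 → y ∈ 𝒲 1 → τ ∈ 𝒲 (k - d) →
      x' ∈ 𝒲 1 ∧ Y ∈ 𝒲 1 ∧ u ∈ 𝒲 (-((d - 1 : ℕ) : ℤ)) ∧ V ∈ 𝒲 (-1) := by
  have := h.isDomain
  have hd := h.two_le
  have hdk := h.le
  obtain ⟨κ, V, p, q, hp, hc, hV1, hV2⟩ := h.exists_V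
  obtain ⟨n, hn⟩ : ∃ n, d - 1 = n + 1 := ⟨d - 2, by omega⟩
  rw [hn] at hV1 hV2 ⊢
  set Y := y - algebraMap ℂ A κ * x with hY
  have hY0 : Y ≠ 0 := h.sub_ne_zero κ
  set c := p.eval κ with hcdef
  set β := p.comp (X + C κ) with hβ
  have hβ0 : β.coeff 0 = c := by
    rw [coeff_zero_eq_eval_zero, hβ, eval_comp]
    simp [hcdef]
  -- As β(0) = c ≠ 0, the polynomial Xβ is a local parameter at 0, so β is a polynomial in Xβ modulo
  -- X^(d-1). In terms of functions, xV is a polynomial in YV modulo Y^(d-1).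
  obtain ⟨φ, hφ⟩ := exists_comp_X_mul_sub β β (by rwa [hβ0]) (n + 1)
  have hφ0 : φ.coeff 0 = c := by
    have h1 : X ∣ β - φ.comp (X * β) := (dvd_pow_self X n.succ_ne_zero).trans hφ
    rw [X_dvd_iff, coeff_sub, hβ0, coeff_zero_eq_eval_zero, eval_comp] at h1
    rw [coeff_zero_eq_eval_zero]
    simp only [eval_mul, eval_X, zero_mul] at h1
    linear_combination -h1
  obtain ⟨u, hu⟩ : Y ^ (n + 1) ∣ x * V - aeval (Y * V) φ := by
    obtain ⟨M, e, -, s, -, hM⟩ := h.exists_expansion hp hV1 hφ ⊤ trivial trivial trivial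
    exact h.dvd_of_pow_mul_eq κ _ _ _ _ hM
  -- Writing φ(YV) = c + YVf turns the divisibility into (x - Yf)V - Y^(d-1)u = c; this dictates x'
  -- = x - Yf.
  set f := aeval (Y * V) φ.divX with hf
  have hφf : aeval (Y * V) φ = f * (Y * V) + algebraMap ℂ A c := by
    conv_lhs => rw [← divX_mul_X_add φ]
    simp [hφ0, hf]
  have hcA : algebraMap ℂ A c * algebraMap ℂ A c⁻¹ = 1 := by
    rw [← map_mul, mul_inv_cancel₀ hc, map_one]
  have hrel : (x - Y * f) * (algebraMap ℂ A c⁻¹ * V) - Y ^ (n + 1) * (algebraMap ℂ A c⁻¹ * u) =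
      1 := by
    linear_combination algebraMap ℂ A c⁻¹ * hu + algebraMap ℂ A c⁻¹ * hφf + hcA
  refine ⟨x - Y * f, Y, algebraMap ℂ A c⁻¹ * u, algebraMap ℂ A c⁻¹ * V, hrel, ?_, hY0, ?_, ?_, ?_⟩
  · refine ⟨algebraMap ℂ A c⁻¹ * V + algebraMap ℂ A κ * (f * (algebraMap ℂ A c⁻¹ * V) +
      Y ^ n * (algebraMap ℂ A c⁻¹ * u)), - (f * (algebraMap ℂ A c⁻¹ * V) +
      Y ^ n * (algebraMap ℂ A c⁻¹ * u)), ?_⟩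
    rw [hY] at hrel ⊢
    linear_combination hrel
  · set B := Algebra.adjoin ℂ {x - Y * f, Y, algebraMap ℂ A c⁻¹ * u, algebraMap ℂ A c⁻¹ * V}
      with hB
    have hx'B : x - Y * f ∈ B := Algebra.subset_adjoin (by simp)
    have hYB : Y ∈ B := Algebra.subset_adjoin (by simp)
    have hUB : algebraMap ℂ A c⁻¹ * u ∈ B := Algebra.subset_adjoin (by simp)
    have hWB : algebraMap ℂ A c⁻¹ * V ∈ B := Algebra.subset_adjoin (by simp)
    have huB : u ∈ B := by
      rw [show u = algebraMap ℂ A c * (algebraMap ℂ A c⁻¹ * u) by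
        linear_combination -u * hcA]
      exact mul_mem (algebraMap_mem _ _) hUB
    have hVB : V ∈ B := by
      rw [show V = algebraMap ℂ A c * (algebraMap ℂ A c⁻¹ * V) by
        linear_combination -V * hcA]
      exact mul_mem (algebraMap_mem _ _) hWB
    have hfB : f ∈ B := aeval_mem_of_mem (mul_mem hYB hVB) _
    have hxB : x ∈ B := by
      rw [show x = (x - Y * f) + Y * f by ring]
      exact add_mem hx'B (mul_mem hYB hfB)
    have hyB : y ∈ B := by
      rw [show y = Y + algebraMap ℂ A κ * x by rw [hY]; ring]
      exact add_mem hYB (mul_mem (algebraMap_mem _ _) hxB)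
    have hYτ : Y ^ (n + 1) * τ ∈ B := by
      rw [show Y ^ (n + 1) * τ = x ^ k * V - form (k - 1) p x y by rw [hV1]; ring]
      exact sub_mem (mul_mem (pow_mem hxB _) hVB) (form_mem hxB hyB _ _)
    have hYς : Y ^ (n + 1) * ς ∈ B := by
      rw [show Y ^ (n + 1) * ς = y ^ k * V + form (k - 1) q x y by rw [hV2]; ring]
      exact add_mem (mul_mem (pow_mem hyB _) hVB) (form_mem hxB hyB _ _)
    have hτ : ∃ L : ℕ, x ^ L * τ ∈ B := by
      obtain ⟨M, e, heB, s, hsB, hM⟩ := h.exists_expansion hp hV1 hφ B hxB hyB hVB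
      rw [← hY, hu] at hM
      have hM' : x ^ (M + k + (n + 1)) * u = τ * x ^ (n + 1) * (x ^ (M + 1) - Y * e) +
          x ^ k * s := mul_left_cancel₀ (pow_ne_zero (n + 1) hY0) (by rw [← hM]; ring)
      -- The factor x^(M+1) - Ye in `hM'` divides x^((M+1)(n+1)) - (Ye)^(n+1). Multiplying by the
      -- cofactor g leaves a power of x times τ, up to a multiple of Y^(n+1)τ, which is already in
      -- `B`.
      obtain ⟨g, hg⟩ := sub_dvd_pow_sub_pow ((⟨x, hxB⟩ : B) ^ (M + 1)) (⟨Y, hYB⟩ * ⟨e, heB⟩ : B)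
        (n + 1)
      have hg' : (x ^ (M + 1)) ^ (n + 1) - (Y * e) ^ (n + 1) = (x ^ (M + 1) - Y * e) * g :=
        congrArg B.val hg
      rw [mul_pow] at hg'
      refine ⟨(M + 1) * (n + 1) + (n + 1), ?_⟩
      rw [show x ^ ((M + 1) * (n + 1) + (n + 1)) * τ =
        (x ^ (M + k + (n + 1)) * u - x ^ k * s) * g +
          e ^ (n + 1) * x ^ (n + 1) * (Y ^ (n + 1) * τ) by
        rw [pow_add, pow_mul]
        linear_combination -(g : A) * hM' + x ^ (n + 1) * τ * hg']
      exact add_mem (mul_mem (sub_mem (mul_mem (pow_mem hxB _) huB) (mul_mem (pow_mem hxB _) hsB))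
        g.2) (mul_mem (mul_mem (pow_mem heB _) (pow_mem hxB _)) hYτ)
    have hxsat : Algebra.adjoin ℂ {x, y, τ} ≤ saturation B x hxB := by
      refine Algebra.adjoin_le ?_
      rintro _ (rfl | rfl | rfl)
      · exact le_saturation _ _ _ hxB
      · exact le_saturation _ _ _ hyB
      · exact hτ
    have hysat : Algebra.adjoin ℂ {x, y, ς} ≤ saturation B Y hYB := by
      refine Algebra.adjoin_le ?_
      rintro _ (rfl | rfl | rfl)
      · exact le_saturation _ _ _ hxB
      · exact le_saturation _ _ _ hyB
      · exact ⟨_, hYς⟩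
    have hcop : IsCoprime (⟨x, hxB⟩ : B) ⟨Y, hYB⟩ := by
      refine ⟨⟨_, hWB⟩, -(⟨f, hfB⟩ * ⟨_, hWB⟩ + ⟨Y, hYB⟩ ^ n * ⟨_, hUB⟩), Subtype.ext ?_⟩
      change (algebraMap ℂ A c⁻¹ * V) * x + -(f * (algebraMap ℂ A c⁻¹ * V) +
        Y ^ n * (algebraMap ℂ A c⁻¹ * u)) * Y = 1
      linear_combination hrel
    have hcop' : IsCoprime (⟨x, hxB⟩ : B) ⟨y, hyB⟩ := by
      have : (⟨y, hyB⟩ : B) = ⟨Y, hYB⟩ + algebraMap ℂ B κ * ⟨x, hxB⟩ := Subtype.ext (by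
        change y = Y + algebraMap ℂ A κ * x
        rw [hY]; ring)
      rw [this]
      exact hcop.add_mul_right_right _
    -- Every a is carried into `B` by a power of x and also by a product of powers of Y and y; these
    -- multipliers are coprime inside `B`.
    refine eq_top_iff.mpr fun a _ => ?_
    obtain ⟨K, hK⟩ := h.exists_mem_x a
    obtain ⟨K', hK'⟩ := mem_saturation_of_mul_mem K (hxsat hK)
    obtain ⟨L, hL⟩ := h.exists_mem_y a
    obtain ⟨L', hL'⟩ := hysat hL
    obtain ⟨s, t, hst⟩ := (((hcop.pow (m := K') (n := L')).mul_right
      (hcop'.pow (m := K') (n := L))))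
    have hst' : s * x ^ K' + t * (Y ^ L' * y ^ L) = (1 : A) := congrArg B.val hst
    rw [show a = s * (x ^ K' * a) + t * (Y ^ L' * (y ^ L * a)) by linear_combination -a * hst']
    exact add_mem (mul_mem s.2 hK') (mul_mem t.2 hL')
  · intro P hP
    -- ψ expresses x through x', Y and the normalised V. A point with prescribed values of these
    -- exists where x ≠ 0 (for `points`) and Y ≠ 0 (to solve for τ), so P is tested after
    -- multiplication by Y and ψ.
    let ψ : MvPolynomial (Fin 3) ℂ :=
      MvPolynomial.X 0 + MvPolynomial.X 1 * aeval (MvPolynomial.X 1 *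
        (MvPolynomial.C c * MvPolynomial.X 2)) φ.divX
    have hψ (v : Fin 3 → ℂ) : MvPolynomial.eval v ψ =
        v 0 + v 1 * φ.divX.eval (v 1 * (c * v 2)) := by
      have : MvPolynomial.eval v (aeval (MvPolynomial.X 1 *
        (MvPolynomial.C c * MvPolynomial.X 2)) φ.divX) = φ.divX.eval (v 1 * (c * v 2)) := by
        rw [← MvPolynomial.coe_aeval_eq_eval, RingHom.coe_coe, ← aeval_algHom_apply,
          ← coe_aeval_eq_eval]
        simp
      simp [ψ, this]
    have h0 : P * MvPolynomial.X 1 * ψ = 0 := by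
      refine MvPolynomial.funext fun v => ?_
      rw [map_mul, map_mul, MvPolynomial.eval_X, map_zero, hψ]
      by_cases hv1 : v 1 = 0
      · simp [hv1]
      by_cases hv0 : v 0 + v 1 * φ.divX.eval (v 1 * (c * v 2)) = 0
      · simp [hv0]
      set a := v 0 + v 1 * φ.divX.eval (v 1 * (c * v 2)) with ha
      obtain ⟨θ, h1, h2, h3⟩ := h.points a (v 1 + κ * a)
        ((a ^ k * (c * v 2) - form (k - 1) p a (v 1 + κ * a)) / v 1 ^ (n + 1)) hv0
      have hθY : θ Y = v 1 := by simp [hY, h1, h2]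
      have hθV : θ V = c * v 2 := by
        have := congrArg θ hV1
        rw [map_add, map_mul, map_mul, map_pow, map_pow, map_form, h1, h2, h3, hθY] at this
        field_simp at this
        apply mul_left_cancel₀ (pow_ne_zero k hv0)
        linear_combination this
      have hθx' : θ (x - Y * f) = v 0 := by
        rw [map_sub, map_mul, h1, hθY, hf, ← aeval_algHom_apply, map_mul, hθY, hθV,
          coe_aeval_eq_eval, ha]
        ring
      have := congrArg θ hP
      rw [map_zero, ← AlgHom.comp_apply, MvPolynomial.comp_aeval] at this
      have hv' : (fun i => θ (![x - Y * f, Y, algebraMap ℂ A c⁻¹ * V] i)) = v := by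
        funext i
        fin_cases i
        · exact hθx'
        · exact hθY
        · simp only [Fin.reduceFinMk, Matrix.cons_val, map_mul, hθV, AlgHom.commutes]
          simp [hc]
      rw [hv', MvPolynomial.aeval_eq_eval] at this
      rw [this, zero_mul, zero_mul]
    have hψ0 : ψ ≠ 0 := by
      intro h0
      have := hψ ![1, 0, 0]
      simp [h0] at this
    exact (mul_eq_zero.mp ((mul_eq_zero.mp h0).resolve_right hψ0)).resolve_right
      (MvPolynomial.X_ne_zero 1)
  · intro 𝒲 _ hsat hx hy hτ
    have hsmul : ∀ {i : ℤ} {a : A} (s : ℂ), a ∈ 𝒲 i → algebraMap ℂ A s * a ∈ 𝒲 i := by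
      intro i a s ha
      rw [← Algebra.smul_def]
      exact Submodule.smul_mem _ _ ha
    have hYW : Y ∈ 𝒲 1 := sub_mem hy (hsmul _ hx)
    have hVW : V ∈ 𝒲 (-1) := by
      -- Degree count: (d - 1) + (k - d) = k - 1, and dividing by x^k leaves -1.
      refine hsat k (-1) (x ^ k) V (pow_ne_zero _ h.x_ne_zero) ?_ ?_
      · simpa using SetLike.pow_mem_graded k hx
      · rw [hV1]
        have h1 := SetLike.mul_mem_graded (SetLike.pow_mem_graded (n + 1) hYW) hτ
        have h2 := form_mem_graded hx hy (k - 1) p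
        refine add_mem ?_ ?_
        · convert h1 using 2
          simp only [nsmul_eq_mul, mul_one]
          omega
        · convert h2 using 2
          omega
    have hYV : Y * V ∈ 𝒲 0 := by simpa using SetLike.mul_mem_graded hYW hVW
    have hfW : f ∈ 𝒲 0 := by
      rw [hf, aeval_eq_sum_range]
      refine sum_mem fun i _ => Submodule.smul_mem _ _ ?_
      simpa using SetLike.pow_mem_graded i hYV
    have hx'W : x - Y * f ∈ 𝒲 1 := sub_mem hx (by simpa using SetLike.mul_mem_graded hYW hfW)
    refine ⟨hx'W, hYW, ?_, hsmul _ hVW⟩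
    refine hsat (n + 1 : ℕ) _ (Y ^ (n + 1)) _ (pow_ne_zero _ hY0) ?_ ?_
    · simpa using SetLike.pow_mem_graded (n + 1) hYW
    · rw [show Y ^ (n + 1) * (algebraMap ℂ A c⁻¹ * u) =
        (x - Y * f) * (algebraMap ℂ A c⁻¹ * V) - 1 by linear_combination -hrel, add_neg_cancel]
      refine sub_mem ?_ (SetLike.one_mem_graded _)
      simpa using SetLike.mul_mem_graded hx'W (hsmul c⁻¹ hVW)

end IsTorsorRing

/-! ### The coordinate rings of the threefolds X_{m,n}. -/

section Threefold
open MvPolynomial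

/-- The equation of the threefold `X_{m,n}`. -/
abbrev threefoldEq (m n : ℕ) : MvPolynomial (Fin 4) ℂ := X 0 ^ m * X 3 - X 1 ^ n * X 2 - 1

/-- The coordinate ring of the threefold `X_{m,n}`. -/
abbrev ThreefoldRing (m n : ℕ) : Type :=
  MvPolynomial (Fin 4) ℂ ⧸ Ideal.span {(X 0 ^ m * X 3 - X 1 ^ n * X 2 - 1 : MvPolynomial (Fin 4) ℂ)}

namespace ThreefoldRing
variable {m n : ℕ}

/-- The coordinate functions `x, y, u, v` on the threefold `X_{m,n}`. -/
def gen (m n : ℕ) (i : Fin 4) : ThreefoldRing m n := Ideal.Quotient.mk _ (X i)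

lemma relation (m n : ℕ) : gen m n 0 ^ m * gen m n 3 - gen m n 1 ^ n * gen m n 2 = 1 := by
  rw [← sub_eq_zero]
  exact Ideal.Quotient.eq_zero_iff_mem.mpr (Ideal.mem_span_singleton_self (threefoldEq m n))

lemma adjoin_gen (m n : ℕ) : Algebra.adjoin ℂ (Set.range (gen m n)) = ⊤ := by
  refine eq_top_iff.mpr fun a _ => ?_
  obtain ⟨p, rfl⟩ := Ideal.Quotient.mk_surjective a
  induction p using MvPolynomial.induction_on with
  | C c => exact Subalgebra.algebraMap_mem _ c
  | add p q hp hq => rw [map_add]; exact add_mem (hp trivial) (hq trivial)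
  | mul_X p i hp => rw [map_mul]; exact mul_mem (hp trivial) (Algebra.subset_adjoin ⟨i, rfl⟩)

lemma algHom_ext {A : Type*} [Semiring A] [Algebra ℂ A] {f g : ThreefoldRing m n →ₐ[ℂ] A}
    (h : ∀ i, f (gen m n i) = g (gen m n i)) : f = g :=
  AlgHom.ext_of_adjoin_eq_top (adjoin_gen m n) (by rintro _ ⟨i, rfl⟩; exact h i)

/-- The homomorphism given by a point of the threefold `X_{m,n}`. -/
def lift {A : Type*} [CommRing A] [Algebra ℂ A] (v : Fin 4 → A)
    (h : v 0 ^ m * v 3 - v 1 ^ n * v 2 = 1) : ThreefoldRing m n →ₐ[ℂ] A :=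
  Ideal.Quotient.liftₐ _ (aeval v) (by
    intro a ha
    obtain ⟨b, rfl⟩ := Ideal.mem_span_singleton'.mp ha
    simp [h])

lemma lift_gen {A : Type*} [CommRing A] [Algebra ℂ A] (v : Fin 4 → A)
    (h : v 0 ^ m * v 3 - v 1 ^ n * v 2 = 1) (i : Fin 4) : lift v h (gen m n i) = v i := by
  change aeval v (X i) = v i
  simp

/-- A coordinate is prime in the polynomial ring and does not divide the equation, whose value at
the origin is -1. -/
lemma gen_regular {i : Fin 4} (hi : i = 0 ∨ i = 1) (hm : 0 < m) (hn : 0 < n)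
    (a : ThreefoldRing m n) (ha : gen m n i * a = 0) : a = 0 := by
  obtain ⟨p, rfl⟩ := Ideal.Quotient.mk_surjective a
  rw [gen, ← map_mul, Ideal.Quotient.eq_zero_iff_mem, Ideal.mem_span_singleton'] at ha
  obtain ⟨b, hb⟩ := ha
  have hprime : Prime (X i : MvPolynomial (Fin 4) ℂ) := X_prime
  rcases hprime.dvd_or_dvd (Dvd.intro p hb.symm) with ⟨c, rfl⟩ | ⟨c, hc⟩
  · rw [Ideal.Quotient.eq_zero_iff_mem, Ideal.mem_span_singleton']
    refine ⟨c, mul_left_cancel₀ (X_ne_zero i) ?_⟩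
    rw [← hb]
    ring
  · have := congrArg (eval (0 : Fin 4 → ℂ)) hc
    rcases hi with rfl | rfl <;> simp [hm.ne', hn.ne'] at this

lemma isCoprime_gen (hm : 0 < m) (hn : 0 < n) : IsCoprime (gen m n 0) (gen m n 1) := by
  have : IsCoprime (gen m n 0 ^ m) (gen m n 1 ^ n) :=
    ⟨gen m n 3, -gen m n 2, by linear_combination relation m n⟩
  exact (IsCoprime.pow_iff hm hn).mp this

lemma mem_of_range_subset {S : Subalgebra ℂ (ThreefoldRing m n)} (h : ∀ i, gen m n i ∈ S)
    (a : ThreefoldRing m n) : a ∈ S := by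
  have : Algebra.adjoin ℂ (Set.range (gen m n)) ≤ S :=
    Algebra.adjoin_le (by rintro _ ⟨i, rfl⟩; exact h i)
  exact this (by rw [adjoin_gen]; trivial)

/-- The fibre coordinates are u/x^m and v/y^n, with difference v/y^n - u/x^m = 1/(x^m y^n), a single
monomial of degree -(m+n). Over the common denominator (xy)^(m+n) the numerator is x^n y^m, hence Γ
= X^m. -/
theorem isTorsorRing (hm : 0 < m) (hn : 0 < n) :
    IsTorsorRing (gen m n 0) (gen m n 1) (gen m n 0 ^ n * gen m n 2) (gen m n 1 ^ m * gen m n 3)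
      (m + n) (m + n) (Polynomial.X ^ m) where
  two_le := by omega
  le := le_rfl
  regular := gen_regular (Or.inl rfl) hm hn
  points a b c ha := by
    refine ⟨lift ![a, b, c / a ^ n, (1 + b ^ n * (c / a ^ n)) / a ^ m] ?_, ?_⟩
    · simp only [Matrix.cons_val]
      field_simp
      ring
    · rw [map_mul, map_pow, lift_gen, lift_gen, lift_gen]
      simp only [Matrix.cons_val]
      exact ⟨trivial, trivial, by field_simp⟩
  exists_mem_x a := by
    have h0 : gen m n 0 ∈ Algebra.adjoin ℂ {gen m n 0, gen m n 1, gen m n 0 ^ n * gen m n 2} :=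
      Algebra.subset_adjoin (by simp)
    have h1 : gen m n 1 ∈ Algebra.adjoin ℂ {gen m n 0, gen m n 1, gen m n 0 ^ n * gen m n 2} :=
      Algebra.subset_adjoin (by simp)
    have h2 : gen m n 0 ^ n * gen m n 2 ∈
        Algebra.adjoin ℂ {gen m n 0, gen m n 1, gen m n 0 ^ n * gen m n 2} :=
      Algebra.subset_adjoin (by simp)
    refine mem_of_range_subset (S := saturation _ _ h0) (fun i => ?_) a
    fin_cases i
    · exact le_saturation _ _ _ h0
    · exact le_saturation _ _ _ h1
    · exact ⟨n, h2⟩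
    · refine ⟨m + n, ?_⟩
      change gen m n 0 ^ (m + n) * gen m n 3 ∈ _
      rw [show gen m n 0 ^ (m + n) * gen m n 3 =
        gen m n 0 ^ n + gen m n 1 ^ n * (gen m n 0 ^ n * gen m n 2) by
        rw [pow_add]; linear_combination gen m n 0 ^ n * relation m n]
      exact add_mem (pow_mem h0 _) (mul_mem (pow_mem h1 _) h2)
  exists_mem_y a := by
    have h0 : gen m n 0 ∈ Algebra.adjoin ℂ {gen m n 0, gen m n 1, gen m n 1 ^ m * gen m n 3} :=
      Algebra.subset_adjoin (by simp)
    have h1 : gen m n 1 ∈ Algebra.adjoin ℂ {gen m n 0, gen m n 1, gen m n 1 ^ m * gen m n 3} :=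
      Algebra.subset_adjoin (by simp)
    have h2 : gen m n 1 ^ m * gen m n 3 ∈
        Algebra.adjoin ℂ {gen m n 0, gen m n 1, gen m n 1 ^ m * gen m n 3} :=
      Algebra.subset_adjoin (by simp)
    refine mem_of_range_subset (S := saturation _ _ h1) (fun i => ?_) a
    fin_cases i
    · exact le_saturation _ _ _ h0
    · exact le_saturation _ _ _ h1
    · refine ⟨m + n, ?_⟩
      change gen m n 1 ^ (m + n) * gen m n 2 ∈ _
      rw [show gen m n 1 ^ (m + n) * gen m n 2 =
        gen m n 0 ^ m * (gen m n 1 ^ m * gen m n 3) - gen m n 1 ^ m by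
        rw [pow_add]; linear_combination -gen m n 1 ^ m * relation m n]
      exact sub_mem (mul_mem (pow_mem h0 _) h2) (pow_mem h1 _)
    · exact ⟨m, h2⟩
  glue j α β h := by
    obtain ⟨p, q, hpq⟩ := (isCoprime_gen hm hn).pow (m := j) (n := j)
    refine ⟨p * α + q * β, ?_, ?_⟩
    · linear_combination -α * hpq + q * h
    · linear_combination -β * hpq - p * h
  natDegree_le := by
    rw [Polynomial.natDegree_X_pow]; omega
  cocycle := by
    rw [form, Finset.sum_eq_single m]
    · rw [Polynomial.coeff_X_pow_self, map_one, show 2 * (m + n) - (m + n) - m = n by omega,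
        pow_add, pow_add]
      linear_combination gen m n 0 ^ n * gen m n 1 ^ m * relation m n
    · intro i _ hi
      rw [Polynomial.coeff_X_pow, if_neg hi, map_zero, zero_mul, zero_mul]
    · intro h
      exact absurd (Finset.mem_range.mpr (by omega)) h
  nontrivial := ⟨m, by omega, by omega, by simp⟩

/-- In the coordinate ring of `x v - y ^ n u = 1` every element is multiplied by a power of `y` to a
polynomial in `x`, `y` and `v`. -/
lemma exists_pow_mul_mem (a : ThreefoldRing 1 n) :
    ∃ K : ℕ, ∃ p : MvPolynomial (Fin 3) ℂ,
      gen 1 n 1 ^ K * a = aeval ![gen 1 n 0, gen 1 n 1, gen 1 n 3] p := by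
  let S := (aeval (R := ℂ) ![gen 1 n 0, gen 1 n 1, gen 1 n 3]).range
  have hS (i : Fin 3) : ![gen 1 n 0, gen 1 n 1, gen 1 n 3] i ∈ S := ⟨X i, by simp⟩
  have h0 : gen 1 n 0 ∈ S := hS 0
  have h1 : gen 1 n 1 ∈ S := hS 1
  have h3 : gen 1 n 3 ∈ S := hS 2
  obtain ⟨K, p, hp⟩ := mem_of_range_subset (S := saturation S _ h1) (fun i => by
    fin_cases i
    · exact le_saturation _ _ _ h0
    · exact le_saturation _ _ _ h1
    · refine ⟨n, ?_⟩
      change gen 1 n 1 ^ n * gen 1 n 2 ∈ S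
      rw [show gen 1 n 1 ^ n * gen 1 n 2 = gen 1 n 0 * gen 1 n 3 - 1 by
        linear_combination -relation 1 n]
      exact sub_mem (mul_mem h0 h3) (one_mem _)
    · exact le_saturation _ _ _ h3) a
  exact ⟨K, p, hp.symm⟩

end ThreefoldRing

open ThreefoldRing in
/-- The ring of functions of a nontrivial homogeneous torsor of degree `-d` is that of the threefold
`X_{1,d-1}`, with the coordinates in the expected degrees. -/
theorem IsTorsorRing.exists_algEquiv {A : Type*} [CommRing A] [Algebra ℂ A] {x y τ ς : A}
    {k d : ℕ} {Γ : Polynomial ℂ} (h : IsTorsorRing x y τ ς k d Γ) :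
    IsCoprime x y ∧ ∃ e : ThreefoldRing 1 (d - 1) ≃ₐ[ℂ] A,
      ∀ (𝒲 : ℤ → Submodule ℂ A) [SetLike.GradedMonoid 𝒲],
        (∀ (i j : ℤ) (z a : A), z ≠ 0 → z ∈ 𝒲 i → z * a ∈ 𝒲 (i + j) → a ∈ 𝒲 j) →
        x ∈ 𝒲 1 → y ∈ 𝒲 1 → τ ∈ 𝒲 (k - d) →
        ∀ i, e (gen 1 (d - 1) i) ∈ 𝒲 (![1, 1, -((d - 1 : ℕ) : ℤ), -1] i) := by
  have := h.isDomain
  obtain ⟨x', Y, u, V, hrel, hcop, hY, hgen, hind, hw⟩ := h.exists_coordinates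
  refine ⟨hcop, ?_⟩
  let f : ThreefoldRing 1 (d - 1) →ₐ[ℂ] A := ThreefoldRing.lift ![x', Y, u, V] (by simpa using hrel)
  have hf (i : Fin 4) : f (gen 1 (d - 1) i) = ![x', Y, u, V] i := lift_gen _ _ i
  have hsurj : Function.Surjective f := by
    rw [← AlgHom.range_eq_top, eq_top_iff, ← hgen]
    refine Algebra.adjoin_le ?_
    rintro _ (rfl | rfl | rfl | rfl)
    exacts [⟨_, hf 0⟩, ⟨_, hf 1⟩, ⟨_, hf 2⟩, ⟨_, hf 3⟩]
  have hinj : Function.Injective f := by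
    rw [injective_iff_map_eq_zero]
    intro a ha
    -- Up to a power of y, an element is a polynomial in x, y, v, and the images of these three are
    -- algebraically independent.
    obtain ⟨K, p, hp⟩ := exists_pow_mul_mem a
    have hp0 : p = 0 := by
      apply hind
      have := congrArg f hp
      rw [map_mul, ha, mul_zero, ← AlgHom.comp_apply, comp_aeval] at this
      rw [this]
      congr 2
      funext i
      fin_cases i
      exacts [(hf 0).symm, (hf 1).symm, (hf 3).symm]
    rw [hp0, map_zero] at hp
    have reg := gen_regular (m := 1) (n := d - 1) (Or.inr rfl) one_pos
      (by have := h.two_le; omega)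
    clear hp0 p ha
    induction K with
    | zero => simpa using hp
    | succ K ih => exact ih (reg _ (by rw [← hp]; ring))
  refine ⟨AlgEquiv.ofBijective f ⟨hinj, hsurj⟩, fun 𝒲 _ hsat hx hy hτ i => ?_⟩
  obtain ⟨h0, h1, h2, h3⟩ := hw 𝒲 hsat hx hy hτ
  change f (gen 1 (d - 1) i) ∈ _
  rw [hf]
  fin_cases i
  exacts [h0, h1, h2, h3]

/-- The threefolds `X_{m,n}` and `X_{p,q}` have isomorphic coordinate rings if `m + n = p + q`. -/
theorem ThreefoldRing.nonempty_algEquiv {m n p q : ℕ} (hm : 0 < m) (hn : 0 < n) (hp : 0 < p)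
    (hq : 0 < q) (h : m + n = p + q) :
    Nonempty (ThreefoldRing m n ≃ₐ[ℂ] ThreefoldRing p q) := by
  obtain ⟨-, e, -⟩ := (isTorsorRing hm hn).exists_algEquiv
  obtain ⟨-, e', -⟩ := (isTorsorRing hp hq).exists_algEquiv
  rw [← h] at e'
  exact ⟨e.symm.trans e'⟩

/-- Isomorphic coordinate rings give isomorphic complex schemes. -/
def overSpecIso {R S : Type} [CommRing R] [CommRing S] [Algebra ℂ R] [Algebra ℂ S]
    (e : R ≃ₐ[ℂ] S) :
    (Over.mk (Spec.map (CommRingCat.ofHom (algebraMap ℂ R))) : CScheme) ≅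
      Over.mk (Spec.map (CommRingCat.ofHom (algebraMap ℂ S))) :=
  Over.isoMk
    { hom := Spec.map (CommRingCat.ofHom e.symm.toAlgHom.toRingHom)
      inv := Spec.map (CommRingCat.ofHom e.toAlgHom.toRingHom)
      hom_inv_id := by
        rw [← Spec.map_comp, ← CommRingCat.ofHom_comp]
        refine (congrArg Spec.map ?_).trans (Spec.map_id (CommRingCat.of R))
        ext r
        simp
      inv_hom_id := by
        rw [← Spec.map_comp, ← CommRingCat.ofHom_comp]
        refine (congrArg Spec.map ?_).trans (Spec.map_id (CommRingCat.of S))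
        ext r
        simp } (by
    change Spec.map _ ≫ Spec.map _ = Spec.map _
    rw [← Spec.map_comp, ← CommRingCat.ofHom_comp]
    congr 2
    ext r
    simp)

theorem nonempty_iso_Xmn {m n p q : ℕ} (hm : 0 < m) (hn : 0 < n) (hp : 0 < p)
    (hq : 0 < q) (h : m + n = p + q) : Nonempty (Xmn m n ≅ Xmn p q) := by
  obtain ⟨e⟩ := ThreefoldRing.nonempty_algEquiv hm hn hp hq h
  exact ⟨overSpecIso e⟩

end Threefold

/-! ### Triderivations. -/

/-- An alternating map of three variables on a complex algebra that is a derivation in each of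
them. -/
structure IsTriderivation {R : Type*} [CommRing R] [Algebra ℂ R] (D : R → R → R → R) : Prop where
  der : ∀ b c, ∃ δ : Derivation ℂ R R, ∀ a, δ a = D a b c
  swap_left : ∀ a b c, D b a c = -D a b c
  swap_right : ∀ a b c, D a c b = -D a b c

namespace IsTriderivation
variable {R R' : Type*} [CommRing R] [Algebra ℂ R] [CommRing R'] [Algebra ℂ R']
  {D D' : R → R → R → R}

/-- Reduces proportionality of two triderivations to the vanishing of one. -/
lemma sub_mul (hD : IsTriderivation D) (hD' : IsTriderivation D') (h : R) :
    IsTriderivation fun a b c => D a b c - h * D' a b c where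
  der b c := by
    obtain ⟨δ, hδ⟩ := hD.der b c
    obtain ⟨δ', hδ'⟩ := hD'.der b c
    exact ⟨δ - h • δ', fun a => by simp [hδ, hδ']⟩
  swap_left a b c := by rw [hD.swap_left, hD'.swap_left]; ring
  swap_right a b c := by rw [hD.swap_right, hD'.swap_right]; ring

lemma conj (hD : IsTriderivation D) (f : R ≃ₐ[ℂ] R') :
    IsTriderivation fun a b c => f (D (f.symm a) (f.symm b) (f.symm c)) where
  der b c := by
    obtain ⟨δ, hδ⟩ := hD.der (f.symm b) (f.symm c)
    refine ⟨Derivation.mk' (f.toLinearMap ∘ₗ δ.toLinearMap ∘ₗ f.symm.toLinearMap) ?_, fun a => ?_⟩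
    · intro a b
      change f (δ (f.symm (a * b))) = a * f (δ (f.symm b)) + b * f (δ (f.symm a))
      simp
    · exact congrArg f (hδ _)
  swap_left a b c := by rw [hD.swap_left, map_neg]
  swap_right a b c := by rw [hD.swap_right, map_neg]

lemma smul_left (hD : IsTriderivation D) (r : ℂ) (a b c : R) :
    D (r • a) b c = r • D a b c := by
  obtain ⟨δ, hδ⟩ := hD.der b c
  rw [← hδ, ← hδ, Derivation.map_smul]

lemma smul_middle (hD : IsTriderivation D) (r : ℂ) (a b c : R) :
    D a (r • b) c = r • D a b c := by
  rw [hD.swap_left, hD.smul_left, hD.swap_left a b, smul_neg, neg_neg]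

lemma smul_right (hD : IsTriderivation D) (r : ℂ) (a b c : R) :
    D a b (r • c) = r • D a b c := by
  rw [hD.swap_right, hD.smul_middle, hD.swap_right a b, smul_neg, neg_neg]

lemma self_left (hD : IsTriderivation D) (a c : R) : D a a c = 0 := by
  have h := hD.swap_left a a c
  have h2 : (2 : ℂ) • D a a c = 0 := by
    rw [two_smul]; linear_combination h
  exact (smul_eq_zero_iff_right two_ne_zero).mp h2

lemma eq_zero (hD : IsTriderivation D) {s : Set R} (hs : Algebra.adjoin ℂ s = ⊤)
    (h : ∀ a ∈ s, ∀ b ∈ s, ∀ c ∈ s, D a b c = 0) (a b c : R) : D a b c = 0 := by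
  have ext : ∀ b c, (∀ a ∈ s, D a b c = 0) → ∀ a, D a b c = 0 := by
    intro b c hbc a
    obtain ⟨δ, hδ⟩ := hD.der b c
    have : δ = 0 := Derivation.ext_of_adjoin_eq_top s hs fun a ha => by
      rw [hδ, hbc a ha]; rfl
    rw [← hδ, this]; rfl
  have h1 : ∀ a, ∀ b ∈ s, ∀ c ∈ s, D a b c = 0 := fun a b hb c hc =>
    ext b c (fun a ha => h a ha b hb c hc) a
  have h2 : ∀ a b, ∀ c ∈ s, D a b c = 0 := fun a b c hc =>
    ext b c (fun a ha => by rw [hD.swap_left, h1 b a ha c hc, neg_zero]) a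
  exact ext b c (fun a ha => by
    rw [hD.swap_left, hD.swap_right, h2 b c a ha, neg_neg]) a

lemma eq_zero_of_lt (hD : IsTriderivation D) {ι : Type*} [LinearOrder ι] {x : ι → R}
    (hs : Algebra.adjoin ℂ (Set.range x) = ⊤)
    (h : ∀ i j k, i < j → j < k → D (x i) (x j) (x k) = 0) (a b c : R) : D a b c = 0 := by
  have sr : ∀ a b, D a b b = 0 := fun a b => by
    rw [hD.swap_left b a, hD.swap_right b b a, hD.self_left]; simp
  have s2 : ∀ a b, D a b a = 0 := fun a b => by
    rw [hD.swap_right a a b, hD.self_left, neg_zero]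
  refine hD.eq_zero hs ?_ a b c
  rintro _ ⟨i, rfl⟩ _ ⟨j, rfl⟩ _ ⟨k, rfl⟩
  rcases lt_trichotomy i j with hij | rfl | hij
  · rcases lt_trichotomy j k with hjk | rfl | hjk
    · exact h i j k hij hjk
    · exact sr _ _
    · rcases lt_trichotomy i k with hik | rfl | hik
      · rw [hD.swap_right, h i k j hik hjk, neg_zero]
      · exact s2 _ _
      · rw [hD.swap_right (x i) (x k) (x j), hD.swap_left (x k) (x i) (x j), h k i j hik hij]
        simp
  · exact hD.self_left _ _
  · rcases lt_trichotomy i k with hik | rfl | hik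
    · rw [hD.swap_left (x j) (x i), h j i k hij hik, neg_zero]
    · exact s2 _ _
    · rw [hD.swap_left (x j) (x i), hD.swap_right (x j) (x k) (x i)]
      rcases lt_trichotomy j k with hjk | rfl | hjk
      · rw [h j k i hjk hik]; simp
      · rw [hD.self_left]; simp
      · rw [hD.swap_left (x k) (x j), h k j i hjk hij]; simp

end IsTriderivation

/-! ### The Jacobian bracket on X_{1,n}, and the recovery of n from the grading. -/

namespace ThreefoldRing
open MvPolynomial
variable {n : ℕ}

/-- The Jacobian matrix of `a, b, c` and the equation of the threefold `X_{1,n}`. -/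
def jacobianMatrix (n : ℕ) (a b c : MvPolynomial (Fin 4) ℂ) :
    Matrix (Fin 4) (Fin 4) (MvPolynomial (Fin 4) ℂ) :=
  Matrix.of fun i j => pderiv j (![a, b, c, threefoldEq 1 n] i)

/-- The Jacobian determinant as a derivation of its first variable. -/
def jacobianDer (n : ℕ) (b c : MvPolynomial (Fin 4) ℂ) :
    Derivation ℂ (MvPolynomial (Fin 4) ℂ) (MvPolynomial (Fin 4) ℂ) :=
  ∑ j : Fin 4, ((-1) ^ (j : ℕ) *
    ((jacobianMatrix n 0 b c).submatrix Fin.succ j.succAbove).det) • pderiv j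

lemma jacobianDer_apply (a b c : MvPolynomial (Fin 4) ℂ) :
    jacobianDer n b c a = (jacobianMatrix n a b c).det := by
  have h (j : Fin 4) : (jacobianMatrix n a b c).submatrix Fin.succ j.succAbove =
      (jacobianMatrix n 0 b c).submatrix Fin.succ j.succAbove := by
    ext1 i k
    simp only [jacobianMatrix, Matrix.submatrix_apply, Matrix.of_apply, Matrix.cons_val_succ]
  have h0 (j : Fin 4) : jacobianMatrix n a b c 0 j = pderiv j a := by
    simp only [jacobianMatrix, Matrix.of_apply, Matrix.cons_val_zero]
  rw [Matrix.det_succ_row_zero, jacobianDer, Fin.sum_univ_four, Fin.sum_univ_four]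
  simp only [Derivation.add_apply, Derivation.smul_apply, smul_eq_mul, h, h0]
  ring

lemma jacobianDer_threefoldEq (b c : MvPolynomial (Fin 4) ℂ) :
    jacobianDer n b c (threefoldEq 1 n) = 0 := by
  rw [jacobianDer_apply]
  exact Matrix.det_zero_of_row_eq (i := 0) (j := 3) (by decide) rfl

lemma cons_swap_left {α : Type*} (a b c e : α) :
    ![b, a, c, e] = ![a, b, c, e] ∘ Equiv.swap 0 1 := by
  funext i
  fin_cases i <;> rfl

lemma cons_swap_right {α : Type*} (a b c e : α) :
    ![a, c, b, e] = ![a, b, c, e] ∘ Equiv.swap 1 2 := by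
  funext i
  fin_cases i <;> rfl

lemma jacobian_swap_left (a b c : MvPolynomial (Fin 4) ℂ) :
    (jacobianMatrix n b a c).det = -(jacobianMatrix n a b c).det := by
  have : jacobianMatrix n b a c = (jacobianMatrix n a b c).submatrix (Equiv.swap 0 1) id := by
    rw [jacobianMatrix, cons_swap_left]
    rfl
  rw [this, Matrix.det_permute, Equiv.Perm.sign_swap (by decide)]
  simp

lemma jacobian_swap_right (a b c : MvPolynomial (Fin 4) ℂ) :
    (jacobianMatrix n a c b).det = -(jacobianMatrix n a b c).det := by
  have : jacobianMatrix n a c b = (jacobianMatrix n a b c).submatrix (Equiv.swap 1 2) id := by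
    rw [jacobianMatrix, cons_swap_right]
    rfl
  rw [this, Matrix.det_permute, Equiv.Perm.sign_swap (by decide)]
  simp

/-- The projection to the coordinate ring. -/
abbrev proj (n : ℕ) : MvPolynomial (Fin 4) ℂ →ₐ[ℂ] ThreefoldRing 1 n :=
  Ideal.Quotient.mkₐ ℂ _

lemma proj_surjective (n : ℕ) : Function.Surjective (proj n) := Ideal.Quotient.mkₐ_surjective _ _

lemma proj_jacobianDer_eq_zero (b c a : MvPolynomial (Fin 4) ℂ) (ha : proj n a = 0) :
    proj n (jacobianDer n b c a) = 0 := by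
  obtain ⟨e, rfl⟩ := Ideal.mem_span_singleton'.mp (Ideal.Quotient.eq_zero_iff_mem.mp ha)
  have hF : proj n (threefoldEq 1 n) = 0 :=
    Ideal.Quotient.eq_zero_iff_mem.mpr (Ideal.mem_span_singleton_self _)
  have : jacobianDer n b c (e * threefoldEq 1 n) = threefoldEq 1 n * jacobianDer n b c e := by
    rw [Derivation.leibniz, jacobianDer_threefoldEq, smul_zero, zero_add, smul_eq_mul]
  rw [this, map_mul, hF, zero_mul]

/-- The Jacobian bracket on the coordinate ring of `X_{1,n}`. -/
def bracket (n : ℕ) (a b c : ThreefoldRing 1 n) : ThreefoldRing 1 n :=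
  Derivation.liftOfSurjective (f := proj n) (proj_surjective n)
    (d := jacobianDer n (Function.surjInv (proj_surjective n) b)
      (Function.surjInv (proj_surjective n) c)) (proj_jacobianDer_eq_zero _ _) a

lemma bracket_proj_left (a : MvPolynomial (Fin 4) ℂ) (b c : ThreefoldRing 1 n) :
    bracket n (proj n a) b c = proj n (jacobianMatrix n a (Function.surjInv (proj_surjective n) b)
      (Function.surjInv (proj_surjective n) c)).det := by
  rw [bracket, Derivation.liftOfSurjective_apply, jacobianDer_apply]

lemma isTriderivation_bracket (n : ℕ) : IsTriderivation (bracket n) where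
  der b c := ⟨_, fun a => rfl⟩
  swap_left a b c := by
    have ha := Function.surjInv_eq (proj_surjective n) a
    have hb := Function.surjInv_eq (proj_surjective n) b
    have h1 := bracket_proj_left (Function.surjInv (proj_surjective n) b) a c
    have h2 := bracket_proj_left (Function.surjInv (proj_surjective n) a) b c
    rw [hb] at h1
    rw [ha] at h2
    rw [h1, h2, jacobian_swap_left, map_neg]
  swap_right a b c := by
    obtain ⟨a, rfl⟩ := proj_surjective n a
    rw [bracket_proj_left, bracket_proj_left, jacobian_swap_right, map_neg]

/-- `bracket` is defined by chosen lifts of its last two arguments. Other lifts differ by multiples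
of the equation, and alternation moves these into the first slot, where the Jacobian kills them
modulo the equation. -/
lemma bracket_proj (a b c : MvPolynomial (Fin 4) ℂ) :
    bracket n (proj n a) (proj n b) (proj n c) = proj n (jacobianMatrix n a b c).det := by
  have h := isTriderivation_bracket n
  set b' := Function.surjInv (proj_surjective n) (proj n b) with hb
  set c' := Function.surjInv (proj_surjective n) (proj n c) with hc
  have hb' : proj n (b - b') = 0 := by
    rw [map_sub, hb, Function.surjInv_eq (proj_surjective n) (proj n b), sub_self]
  have hc' : proj n (c - c') = 0 := by
    rw [map_sub, hc, Function.surjInv_eq (proj_surjective n) (proj n c), sub_self]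
  have h1 := proj_jacobianDer_eq_zero (n := n) a c' _ hb'
  have h2 := proj_jacobianDer_eq_zero (n := n) a b _ hc'
  rw [map_sub, map_sub, jacobianDer_apply, jacobianDer_apply, sub_eq_zero] at h1 h2
  rw [bracket_proj_left, ← hb, ← hc, jacobian_swap_left, map_neg, ← h1, ← map_neg,
    ← jacobian_swap_left, jacobian_swap_right, map_neg, jacobian_swap_left, map_neg, ← h2,
    jacobian_swap_left, map_neg, jacobian_swap_right, map_neg]
  ring

lemma bracket_gen_two : bracket n (gen 1 n 0) (gen 1 n 1) (gen 1 n 2) = gen 1 n 0 := by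
  refine (bracket_proj (X 0) (X 1) (X 2)).trans ?_
  have : (jacobianMatrix n (X 0) (X 1) (X 2)).det = X 0 := by
    rw [← jacobianDer_apply, jacobianDer, Fin.sum_univ_four]
    simp only [Derivation.add_apply, Derivation.smul_apply, smul_eq_mul, pderiv_X]
    simp [Matrix.det_fin_three, jacobianMatrix, pderiv_X, Fin.succAbove]
  rw [this]
  rfl

lemma bracket_gen_three : bracket n (gen 1 n 0) (gen 1 n 1) (gen 1 n 3) = gen 1 n 1 ^ n := by
  refine (bracket_proj (X 0) (X 1) (X 3)).trans ?_
  have : (jacobianMatrix n (X 0) (X 1) (X 3)).det = X 1 ^ n := by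
    rw [← jacobianDer_apply, jacobianDer, Fin.sum_univ_four]
    simp only [Derivation.add_apply, Derivation.smul_apply, smul_eq_mul, pderiv_X]
    simp [Matrix.det_fin_three, jacobianMatrix, pderiv_X, Fin.succAbove]
  rw [this]
  rfl

lemma pow_gen_regular (hn : 0 < n) (K : ℕ) (a b : ThreefoldRing 1 n)
    (h : gen 1 n 1 ^ K * a = gen 1 n 1 ^ K * b) : a = b := by
  induction K with
  | zero => simpa using h
  | succ K ih =>
    refine ih (sub_eq_zero.mp (gen_regular (Or.inr rfl) one_pos hn _ ?_))
    linear_combination h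

/-- A triderivation of the coordinate ring of `X_{1,n}` is determined by one function. -/
lemma triderivation_eq_zero (hn : 0 < n)
    {D : ThreefoldRing 1 n → ThreefoldRing 1 n → ThreefoldRing 1 n → ThreefoldRing 1 n}
    (hD : IsTriderivation D)
    (h : gen 1 n 3 * D (gen 1 n 0) (gen 1 n 1) (gen 1 n 2) -
      gen 1 n 2 * D (gen 1 n 0) (gen 1 n 1) (gen 1 n 3) = 0) (a b c : ThreefoldRing 1 n) :
    D a b c = 0 := by
  have hrel : gen 1 n 0 * gen 1 n 3 - gen 1 n 1 ^ n * gen 1 n 2 = 1 := by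
    linear_combination relation 1 n
  have rel : ∀ b c, gen 1 n 3 * D (gen 1 n 0) b c + gen 1 n 0 * D (gen 1 n 3) b c -
      gen 1 n 1 ^ n * D (gen 1 n 2) b c -
      gen 1 n 2 * ((n : ThreefoldRing 1 n) * gen 1 n 1 ^ (n - 1) * D (gen 1 n 1) b c) = 0 := by
    intro b c
    obtain ⟨δ, hδ⟩ := hD.der b c
    have := congrArg δ hrel
    rw [map_sub, Derivation.leibniz, Derivation.leibniz, Derivation.leibniz_pow,
      Derivation.map_one_eq_zero] at this
    simp only [hδ, smul_eq_mul, nsmul_eq_mul] at this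
    linear_combination this
  -- Differentiating xv - y^n u = 1 gives x D(x,y,v) = y^n D(x,y,u), which together with `h` forces
  -- D(x,y,v) = 0. The other three values then vanish after cancelling y^n.
  have c1 := rel (gen 1 n 0) (gen 1 n 1)
  have c2 := rel (gen 1 n 1) (gen 1 n 3)
  have c3 := rel (gen 1 n 0) (gen 1 n 3)
  have sr : ∀ a b, D a b b = 0 := fun a b => by
    rw [hD.swap_left, hD.swap_right, hD.self_left]; simp
  have s2 : ∀ a b, D a b a = 0 := fun a b => by rw [hD.swap_right, hD.self_left, neg_zero]
  have e301 : D (gen 1 n 3) (gen 1 n 0) (gen 1 n 1) = D (gen 1 n 0) (gen 1 n 1) (gen 1 n 3) := by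
    rw [hD.swap_left, hD.swap_right, neg_neg]
  have e201 : D (gen 1 n 2) (gen 1 n 0) (gen 1 n 1) = D (gen 1 n 0) (gen 1 n 1) (gen 1 n 2) := by
    rw [hD.swap_left, hD.swap_right, neg_neg]
  rw [hD.self_left, s2, e301, e201] at c1
  rw [hD.self_left, s2, hD.swap_left (gen 1 n 1) (gen 1 n 2)] at c2
  rw [hD.self_left, s2, hD.swap_left (gen 1 n 0), hD.swap_left (gen 1 n 0)] at c3
  have v013 : D (gen 1 n 0) (gen 1 n 1) (gen 1 n 3) = 0 := by
    linear_combination -D (gen 1 n 0) (gen 1 n 1) (gen 1 n 3) * hrel +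
      gen 1 n 3 * c1 + gen 1 n 1 ^ n * h
  have v012 : D (gen 1 n 0) (gen 1 n 1) (gen 1 n 2) = 0 := by
    refine pow_gen_regular hn n _ _ ?_
    rw [v013] at c1
    linear_combination -c1
  have v123 : D (gen 1 n 1) (gen 1 n 2) (gen 1 n 3) = 0 := by
    refine pow_gen_regular hn n _ _ ?_
    rw [v013] at c2
    linear_combination c2
  have v023 : D (gen 1 n 0) (gen 1 n 2) (gen 1 n 3) = 0 := by
    refine pow_gen_regular hn n _ _ ?_
    rw [v013] at c3
    linear_combination c3
  refine hD.eq_zero_of_lt (adjoin_gen 1 n) (fun i j k hij hjk => ?_) a b c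
  fin_cases i <;> fin_cases j <;> first | exact absurd hij (by decide) | skip
  all_goals fin_cases k <;> first | exact absurd hjk (by decide) | assumption

/-- The Jacobian of an isomorphism between the threefolds `X_{1,m}` and `X_{1,n}`. -/
lemma exists_jacobian {m : ℕ} (hn : 0 < n) (f : ThreefoldRing 1 m ≃ₐ[ℂ] ThreefoldRing 1 n) :
    ∃ h, ∀ a b c, f (bracket m a b c) = h * bracket n (f a) (f b) (f c) := by
  have hD := (isTriderivation_bracket m).conj f
  set D := fun a b c => f (bracket m (f.symm a) (f.symm b) (f.symm c)) with hDdef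
  -- The bracket takes the values x on (x, y, u) and y^n on (x, y, v), and v·x - u·y^n = 1; so this
  -- combination is the only possible factor.
  refine ⟨gen 1 n 3 * D (gen 1 n 0) (gen 1 n 1) (gen 1 n 2) -
    gen 1 n 2 * D (gen 1 n 0) (gen 1 n 1) (gen 1 n 3), fun a b c => ?_⟩
  have h0 := triderivation_eq_zero hn (hD.sub_mul (isTriderivation_bracket n)
    (gen 1 n 3 * D (gen 1 n 0) (gen 1 n 1) (gen 1 n 2) -
      gen 1 n 2 * D (gen 1 n 0) (gen 1 n 1) (gen 1 n 3))) (by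
    simp only [bracket_gen_two, bracket_gen_three]
    linear_combination -(gen 1 n 3 * D (gen 1 n 0) (gen 1 n 1) (gen 1 n 2) -
      gen 1 n 2 * D (gen 1 n 0) (gen 1 n 1) (gen 1 n 3)) * relation 1 n) (f a) (f b) (f c)
  simp only [hDdef, AlgEquiv.symm_apply_apply] at h0 ⊢
  linear_combination h0

/-- The values x and y^n of the bracket generate the unit ideal. -/
lemma jacobian_unique {g g' : ThreefoldRing 1 n}
    (h : ∀ a b c, g * bracket n a b c = g' * bracket n a b c) : g = g' := by
  have h2 := h (gen 1 n 0) (gen 1 n 1) (gen 1 n 2)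
  have h3 := h (gen 1 n 0) (gen 1 n 1) (gen 1 n 3)
  rw [bracket_gen_two] at h2
  rw [bracket_gen_three] at h3
  linear_combination (g' - g) * relation 1 n + gen 1 n 3 * h2 - gen 1 n 2 * h3

/-- The degrees of the coordinates of `X_{1,n}`. -/
def weight (n : ℕ) : Fin 4 → ℤ := ![1, 1, -n, -1]

/-- The action of a nonzero scalar on the coordinate ring of `X_{1,n}`. -/
def scale (n : ℕ) (c : ℂˣ) : ThreefoldRing 1 n →ₐ[ℂ] ThreefoldRing 1 n :=
  lift (fun i => ((c ^ weight n i : ℂˣ) : ℂ) • gen 1 n i) (by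
    have h1 : ((c ^ weight n 0 : ℂˣ) : ℂ) * ((c ^ weight n 3 : ℂˣ) : ℂ) = 1 := by
      rw [← Units.val_mul, ← zpow_add]; simp [weight]
    have h2 : ((c ^ weight n 1 : ℂˣ) : ℂ) ^ n * ((c ^ weight n 2 : ℂˣ) : ℂ) = 1 := by
      rw [← Units.val_pow_eq_pow_val, ← Units.val_mul, ← zpow_natCast, ← zpow_mul, ← zpow_add]
      simp [weight]
    rw [pow_one (_ • _), smul_pow, smul_mul_smul_comm, smul_mul_smul_comm, h1, h2, one_smul,
      one_smul]
    linear_combination relation 1 n)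

lemma scale_gen (c : ℂˣ) (i : Fin 4) :
    scale n c (gen 1 n i) = ((c ^ weight n i : ℂˣ) : ℂ) • gen 1 n i := lift_gen _ _ i

/-- The action of a nonzero scalar as an automorphism. -/
def scaleEquiv (n : ℕ) (c : ℂˣ) : ThreefoldRing 1 n ≃ₐ[ℂ] ThreefoldRing 1 n :=
  AlgEquiv.ofAlgHom (scale n c) (scale n c⁻¹)
    (algHom_ext fun i => by
      rw [AlgHom.comp_apply, scale_gen, map_smul, scale_gen, smul_smul, ← Units.val_mul, inv_zpow,
        inv_mul_cancel]
      simp)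
    (algHom_ext fun i => by
      rw [AlgHom.comp_apply, scale_gen, map_smul, scale_gen, smul_smul, ← Units.val_mul, inv_zpow,
        mul_inv_cancel]
      simp)

/-- The four coordinates have total weight 1 + 1 - n - 1 = 1 - n and the equation has weight 0, so
the Jacobian determinant of the scaling is c^(1-n). -/
lemma scale_bracket (hn : 0 < n) (c : ℂˣ) (a b e : ThreefoldRing 1 n) :
    scale n c (bracket n a b e) =
      ((c ^ ((n : ℤ) - 1) : ℂˣ) : ℂ) • bracket n (scale n c a) (scale n c b) (scale n c e) := by
  obtain ⟨h, hh⟩ := exists_jacobian hn (scaleEquiv n c)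
  change ∀ a b e, scale n c (bracket n a b e) =
    h * bracket n (scale n c a) (scale n c b) (scale n c e) at hh
  have hB := isTriderivation_bracket n
  have h2 := hh (gen 1 n 0) (gen 1 n 1) (gen 1 n 2)
  have h3 := hh (gen 1 n 0) (gen 1 n 1) (gen 1 n 3)
  rw [scale_gen, scale_gen, scale_gen, hB.smul_left, hB.smul_middle, hB.smul_right,
    bracket_gen_two, scale_gen, smul_smul, smul_smul, ← Units.val_mul, ← Units.val_mul] at h2
  rw [scale_gen, scale_gen, scale_gen, hB.smul_left, hB.smul_middle, hB.smul_right,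
    bracket_gen_three, map_pow, scale_gen, smul_pow, smul_smul, smul_smul, ← Units.val_mul,
    ← Units.val_mul, ← Units.val_pow_eq_pow_val] at h3
  have w2 : c ^ weight n 0 * c ^ weight n 1 * c ^ weight n 2 = c * (c ^ ((n : ℤ) - 1))⁻¹ := by
    rw [← zpow_add, ← zpow_add, ← zpow_neg, ← zpow_one_add]
    congr 1
    simp only [weight, Matrix.cons_val]
    ring
  have w3 : c ^ weight n 0 * c ^ weight n 1 * c ^ weight n 3 = c := by simp [weight]
  have w1 : (c ^ weight n 1) ^ n = c * c ^ ((n : ℤ) - 1) := by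
    rw [← zpow_natCast, ← zpow_mul, ← zpow_one_add]
    simp [weight]
  have w0 : c ^ weight n 0 = c := by simp [weight]
  rw [w2, w0] at h2
  rw [w3, w1] at h3
  set q := c ^ ((n : ℤ) - 1)
  have hc : algebraMap ℂ (ThreefoldRing 1 n) (c : ℂ) *
      algebraMap ℂ (ThreefoldRing 1 n) ((c⁻¹ : ℂˣ) : ℂ) = 1 := by
    rw [← map_mul, Units.mul_inv, map_one]
  have hq : algebraMap ℂ (ThreefoldRing 1 n) (q : ℂ) *
      algebraMap ℂ (ThreefoldRing 1 n) ((q⁻¹ : ℂˣ) : ℂ) = 1 := by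
    rw [← map_mul, Units.mul_inv, map_one]
  have hsmul (r : ℂ) (a : ThreefoldRing 1 n) :
      r • a = algebraMap ℂ (ThreefoldRing 1 n) r * a := Algebra.smul_def r a
  rw [hsmul, hsmul, Units.val_mul, map_mul] at h2
  rw [hsmul, hsmul, Units.val_mul, map_mul] at h3
  rw [hsmul]
  set C₁ := algebraMap ℂ (ThreefoldRing 1 n) (c : ℂ)
  set C₂ := algebraMap ℂ (ThreefoldRing 1 n) ((c⁻¹ : ℂˣ) : ℂ)
  set Q₁ := algebraMap ℂ (ThreefoldRing 1 n) (q : ℂ)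
  set Q₂ := algebraMap ℂ (ThreefoldRing 1 n) ((q⁻¹ : ℂˣ) : ℂ)
  have h2' : Q₁ * gen 1 n 0 = h * gen 1 n 0 := by
    linear_combination Q₁ * C₂ * h2 - Q₁ * gen 1 n 0 * hc + h * gen 1 n 0 * Q₁ * Q₂ * hc +
      h * gen 1 n 0 * hq
  have h3' : Q₁ * gen 1 n 1 ^ n = h * gen 1 n 1 ^ n := by
    linear_combination C₂ * h3 - Q₁ * gen 1 n 1 ^ n * hc + h * gen 1 n 1 ^ n * hc
  have hhq : h = Q₁ := by
    linear_combination (Q₁ - h) * relation 1 n - gen 1 n 3 * h2' + gen 1 n 2 * h3'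
  rw [hh, hhq]

/-- A function without zeros on `X_{1,n}` that is homogeneous has degree zero. -/
lemma weight_eq_zero_of_isUnit {h : ThreefoldRing 1 n} (hu : IsUnit h) (e : ℤ)
    (he : ∀ c : ℂˣ, scale n c h = ((c ^ e : ℂˣ) : ℂ) • h) : e = 0 := by
  -- Restrictions to the planes y = 1 and v = 1 in the threefold. Units of a polynomial ring over ℂ
  -- are constants, so h is constant on each plane.
  let θ : ThreefoldRing 1 n →ₐ[ℂ] MvPolynomial (Fin 2) ℂ :=
    lift ![X 0, 1, X 0 * X 1 - 1, X 1] (by simp)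
  let θ' : ThreefoldRing 1 n →ₐ[ℂ] MvPolynomial (Fin 2) ℂ :=
    lift ![1 + X 0 ^ n * X 1, X 0, X 1, 1] (by simp)
  obtain ⟨r, hr, hθ⟩ := isUnit_iff_eq_C_of_isReduced.mp (hu.map θ)
  obtain ⟨r', hr', hθ'⟩ := isUnit_iff_eq_C_of_isReduced.mp (hu.map θ')
  -- The point (a, 1, 0, a⁻¹) of the first plane is the translate by a of the point (1, a⁻¹, 0, 1)
  -- of the second.
  have key (a : ℂˣ) : r = ((a ^ e : ℂˣ) : ℂ) * r' := by
    have hcomp : (aeval ![(a : ℂ), ((a⁻¹ : ℂˣ) : ℂ)]).comp θ =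
        ((aeval ![((a⁻¹ : ℂˣ) : ℂ), (0 : ℂ)]).comp θ').comp (scale n a) := by
      refine algHom_ext fun i => ?_
      rw [AlgHom.comp_apply, AlgHom.comp_apply, AlgHom.comp_apply, scale_gen, map_smul, map_smul,
        lift_gen, lift_gen]
      fin_cases i <;> simp [weight]
    have := DFunLike.congr_fun hcomp h
    rw [AlgHom.comp_apply, AlgHom.comp_apply, AlgHom.comp_apply, he, map_smul, map_smul, hθ, hθ',
      aeval_C, aeval_C] at this
    exact this
  have h1 := key 1
  have h2 := key (Units.mk0 2 two_ne_zero)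
  rw [one_zpow, Units.val_one, one_mul] at h1
  rw [h1] at h2
  have h3 : ((2 : ℂ) ^ e) = 1 := by
    have := mul_right_cancel₀ hr'.ne_zero ((one_mul r').trans h2)
    simpa using this.symm
  have h4 : ((2 : ℝ) ^ e) = 1 := by
    have := congrArg norm h3
    simpa using this
  exact (zpow_eq_one_iff_right₀ (by norm_num) (by norm_num)).mp h4

/-- Threefolds `X_{1,m}` and `X_{1,n}` that are equivariantly isomorphic are equal. -/
theorem eq_of_equivariant {m : ℕ} (hm : 0 < m) (hn : 0 < n)
    (f : ThreefoldRing 1 m ≃ₐ[ℂ] ThreefoldRing 1 n)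
    (hf : ∀ (c : ℂˣ) (i : Fin 4), scale n c (f (gen 1 m i)) =
      ((c ^ weight m i : ℂˣ) : ℂ) • f (gen 1 m i)) : m = n := by
  have hcomm (c : ℂˣ) (a : ThreefoldRing 1 m) : scale n c (f a) = f (scale m c a) := by
    have : (scale n c).comp f.toAlgHom = f.toAlgHom.comp (scale m c) := algHom_ext fun i => by
      rw [AlgHom.comp_apply, AlgHom.comp_apply, scale_gen, map_smul]
      exact hf c i
    exact DFunLike.congr_fun this a
  obtain ⟨h, hh⟩ := exists_jacobian hn f
  obtain ⟨h', hh'⟩ := exists_jacobian hm f.symm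
  have hunit : f h' * h = 1 := jacobian_unique fun a b c => by
    have h1 := congrArg f (hh' a b c)
    rw [AlgEquiv.apply_symm_apply, map_mul, hh, AlgEquiv.apply_symm_apply,
      AlgEquiv.apply_symm_apply, AlgEquiv.apply_symm_apply] at h1
    rw [one_mul, mul_assoc, ← h1]
  -- Scaling the identity that defines h introduces c^(m-1) on one side and c^(n-1) on the other.
  have hw (c : ℂˣ) : scale n c h = ((c ^ ((m : ℤ) - n) : ℂˣ) : ℂ) • h := by
    have h1 : ((c ^ ((n : ℤ) - 1) : ℂˣ) : ℂ) • scale n c h =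
        ((c ^ ((m : ℤ) - 1) : ℂˣ) : ℂ) • h := jacobian_unique fun a b e => by
      obtain ⟨a, rfl⟩ := (scaleEquiv n c).surjective a
      obtain ⟨b, rfl⟩ := (scaleEquiv n c).surjective b
      obtain ⟨e, rfl⟩ := (scaleEquiv n c).surjective e
      obtain ⟨a, rfl⟩ := f.surjective a
      obtain ⟨b, rfl⟩ := f.surjective b
      obtain ⟨e, rfl⟩ := f.surjective e
      change _ * bracket n (scale n c (f a)) (scale n c (f b)) (scale n c (f e)) =
        _ * bracket n (scale n c (f a)) (scale n c (f b)) (scale n c (f e))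
      have h2 := congrArg (scale n c) (hh a b e)
      rw [map_mul, hcomm, scale_bracket hm, scale_bracket hn, map_smul, hh, ← hcomm, ← hcomm,
        ← hcomm] at h2
      rw [smul_mul_assoc, smul_mul_assoc, h2, mul_smul_comm]
    have h2 : scale n c h = ((c ^ ((n : ℤ) - 1))⁻¹ : ℂˣ) •
        ((c ^ ((n : ℤ) - 1) : ℂˣ) : ℂ) • scale n c h := by
      rw [Units.smul_def, smul_smul, Units.inv_mul, one_smul]
    rw [h2, h1, Units.smul_def, smul_smul, ← Units.val_mul, ← zpow_neg, ← zpow_add]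
    congr 3
    ring
  have := weight_eq_zero_of_isUnit (.of_mul_eq_one_right _ hunit) _ hw
  omega
end ThreefoldRing

/-! ### Sections and points given locally. -/

section Sections
variable {Z Z' : Scheme.{0}}

lemma section_ext {a b : Γ(Z, ⊤)}
    (h : ∀ s : Z, ∃ O : Z.Opens, s ∈ O ∧ O.ι.appTop a = O.ι.appTop b) : a = b := by
  choose U hU h using h
  refine Z.sheaf.eq_of_locally_eq' (fun s => (U s).ι ''ᵁ ⊤) ⊤ (fun s => homOfLE le_top) ?_ a b h
  intro s _
  rw [TopologicalSpace.Opens.mem_iSup]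
  exact ⟨s, by simpa using hU s⟩

lemma topIso_hom_appTop (U : Z.Opens) (z : Γ(Z, ⊤)) :
    U.topIso.hom (U.ι.appTop z) = Z.presheaf.map (homOfLE (le_top : U ≤ ⊤)).op z :=
  ConcreteCategory.congr_hom (show U.ι.appTop ≫ U.topIso.hom = _ from
    (Z.presheaf.map_comp _ _).symm) z

lemma topIso_hom_injective (U : Z.Opens) : Function.Injective U.topIso.hom :=
  (ConcreteCategory.bijective_of_isIso U.topIso.hom).1

lemma exists_pow_mul_eq_zero [CompactSpace Z] (f : Γ(Z, ⊤)) {O : Z.Opens}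
    (hO : O = Z.basicOpen f) (z : Γ(Z, ⊤)) (h : O.ι.appTop z = 0) : ∃ n : ℕ, f ^ n * z = 0 := by
  subst hO
  refine exists_pow_mul_eq_zero_of_res_basicOpen_eq_zero_of_isCompact Z (U := ⊤)
    CompactSpace.isCompact_univ z f ?_
  have := congrArg (Z.basicOpen f).topIso.hom h
  rw [map_zero, topIso_hom_appTop] at this
  exact this

lemma exists_appTop_eq_pow_mul [CompactSpace Z] [QuasiSeparatedSpace Z] (f : Γ(Z, ⊤))
    {O : Z.Opens} (hO : O = Z.basicOpen f) (w : Γ(O.toScheme, ⊤)) :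
    ∃ (n : ℕ) (e : Γ(Z, ⊤)), O.ι.appTop e = O.ι.appTop f ^ n * w := by
  subst hO
  obtain ⟨n, e, he⟩ := exists_eq_pow_mul_of_isCompact_of_isQuasiSeparated Z ⊤
    CompactSpace.isCompact_univ isQuasiSeparated_univ f ((Z.basicOpen f).topIso.hom w)
  refine ⟨n, e, topIso_hom_injective _ ?_⟩
  rw [map_mul, map_pow, topIso_hom_appTop, topIso_hom_appTop]
  exact he

lemma isUnit_appTop_basicOpen (f : Γ(Z, ⊤)) {O : Z.Opens} (hO : O = Z.basicOpen f) :
    IsUnit (O.ι.appTop f) := by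
  subst hO
  have h : IsUnit ((Z.basicOpen f).topIso.hom ((Z.basicOpen f).ι.appTop f)) := by
    rw [topIso_hom_appTop]
    exact RingedSpace.isUnit_res_basicOpen _ f
  exact (isUnit_map_iff (Z.basicOpen f).topIso.commRingCatIsoToRingEquiv _).mp h

end Sections

section Restriction
variable {T : CScheme}

/-- The open subscheme `O` of a complex scheme. -/
def restr (T : CScheme) (O : T.left.Opens) : CScheme := Over.mk (O.ι ≫ T.hom)

/-- The inclusion of an open subscheme. -/
def restrι (T : CScheme) (O : T.left.Opens) : restr T O ⟶ T := Over.homMk O.ι rfl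

lemma point_ext_local {X : CScheme} {p p' : T ⟶ X}
    (h : ∀ s : T.left, ∃ O : T.left.Opens, s ∈ O ∧ restrι T O ≫ p = restrι T O ≫ p') : p = p' := by
  ext1
  refine Scheme.hom_ext_of_forall _ _ fun s => ?_
  obtain ⟨O, hs, hO⟩ := h s
  exact ⟨O, hs, congrArg CommaMorphism.left hO⟩

end Restriction

/-! ### Equivariant functions and trivializations of bundles. -/

namespace GaBundle
variable (B : GaBundle) {T : CScheme} {V : puncturedPlane.left.Opens}

/-- The part of the total space over `V`. -/
abbrev part (V : puncturedPlane.left.Opens) : Scheme := (B.ρ.left ⁻¹ᵁ V).toScheme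

/-- The inclusion of the part of the total space over `V`. -/
abbrev partι (V : puncturedPlane.left.Opens) : B.part V ⟶ B.X.left := (B.ρ.left ⁻¹ᵁ V).ι

variable {B}

lemma exists_lift (p : T ⟶ B.X) (h : ∀ s : T.left, (p ≫ B.ρ).left s ∈ V) :
    ∃ q : T.left ⟶ B.part V, q ≫ B.partι V = p.left := by
  refine ⟨IsOpenImmersion.lift (B.partι V) p.left ?_, IsOpenImmersion.lift_fac _ _ _⟩
  rw [Scheme.Opens.range_ι]
  rintro _ ⟨s, rfl⟩
  exact h s

lemma mem_of_lift {p : T ⟶ B.X} {q : T.left ⟶ B.part V} (h : q ≫ B.partι V = p.left)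
    (s : T.left) : (p ≫ B.ρ).left s ∈ V := by
  change B.ρ.left (p.left s) ∈ V
  rw [← h, Scheme.Hom.comp_apply]
  exact (q s).2

lemma exists_lift_of_comp_eq {p p' : T ⟶ B.X} (h : p' ≫ B.ρ = p ≫ B.ρ) {q : T.left ⟶ B.part V}
    (hq : q ≫ B.partι V = p.left) : ∃ q' : T.left ⟶ B.part V, q' ≫ B.partι V = p'.left :=
  exists_lift p' fun s => by rw [h]; exact mem_of_lift hq s

/-- A function on the part of the total space over `V` that is equivariant for the translations of
`𝔸¹`. -/
def IsEquivariant (t : Γ(B.part V, ⊤)) : Prop :=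
  ∀ ⦃T : CScheme⦄ (a : Γ(T.left, ⊤)) (p : T ⟶ B.X) (q q' : T.left ⟶ B.part V),
    q ≫ B.partι V = p.left → q' ≫ B.partι V = (B.action.act a p).left →
      q'.appTop t = q.appTop t + a

/-- The fibre coordinate of a trivialization. -/
def coordinate {U : puncturedPlane.left.Opens} (τ : Trivialization B.ρ B.action U) :
    Γ(B.part U, ⊤) :=
  τ.iso.hom.appTop (AffineSpace.coord _ 0)

lemma appTop_coordinate {U : puncturedPlane.left.Opens} (τ : Trivialization B.ρ B.action U)
    {Z : Scheme} (q : Z ⟶ B.part U) :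
    q.appTop (coordinate τ) = (q ≫ τ.iso.hom).appTop (AffineSpace.coord _ 0) := by
  rw [Scheme.Hom.comp_appTop]
  rfl

lemma isEquivariant_coordinate {U : puncturedPlane.left.Opens}
    (τ : Trivialization B.ρ B.action U) : IsEquivariant (coordinate τ) := by
  intro T a p q q' hq hq'
  rw [appTop_coordinate, appTop_coordinate]
  exact τ.equivariant a p q q' hq hq'

lemma trivialization_ext {U : puncturedPlane.left.Opens} (τ : Trivialization B.ρ B.action U)
    {p p' : T ⟶ B.X} (h : p ≫ B.ρ = p' ≫ B.ρ) {q q' : T.left ⟶ B.part U}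
    (hq : q ≫ B.partι U = p.left) (hq' : q' ≫ B.partι U = p'.left)
    (ht : q.appTop (coordinate τ) = q'.appTop (coordinate τ)) : p = p' := by
  ext1
  rw [← hq, ← hq']
  congr 1
  rw [← cancel_mono τ.iso.hom]
  refine AffineSpace.hom_ext ?_ fun i => ?_
  · rw [Category.assoc, Category.assoc, τ.iso_over, ← cancel_mono U.ι, Category.assoc,
      Category.assoc, morphismRestrict_ι, reassoc_of% hq, reassoc_of% hq']
    exact congrArg CommaMorphism.left h
  · rw [appTop_coordinate, appTop_coordinate] at ht
    rw [Subsingleton.elim i 0]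
    exact ht

/-- Points with the same image in the base differ by a translation. -/
lemma eq_act_of_comp_eq {U : puncturedPlane.left.Opens} (τ : Trivialization B.ρ B.action U)
    {p p' : T ⟶ B.X} (h : p ≫ B.ρ = p' ≫ B.ρ) {q q' : T.left ⟶ B.part U}
    (hq : q ≫ B.partι U = p.left) (hq' : q' ≫ B.partι U = p'.left) :
    p' = B.action.act (q'.appTop (coordinate τ) - q.appTop (coordinate τ)) p := by
  obtain ⟨r, hr⟩ := exists_lift_of_comp_eq (B.invariant
    (q'.appTop (coordinate τ) - q.appTop (coordinate τ)) p) hq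
  refine trivialization_ext τ ?_ hq' hr ?_
  · rw [B.invariant, h]
  · rw [isEquivariant_coordinate τ _ p q r hq hr]
    ring

lemma IsHomogeneousLift.isAffineHom {μ : GmAction B.X} {d : ℕ} (h : B.IsHomogeneousLift μ d) :
    IsAffineHom B.ρ.left := by
  refine isAffineHom_of_forall_exists_isAffineOpen _ fun s => ?_
  obtain ⟨U, hs, -, hU, τ, -⟩ := h.cover s
  refine ⟨U, hs, hU, ?_⟩
  have : IsAffine U.toScheme := hU
  exact IsAffine.of_isIso τ.iso.hom

/-- Points over `U` lift to the total space. -/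
lemma exists_point_over {U : puncturedPlane.left.Opens} (τ : Trivialization B.ρ B.action U)
    (b : T ⟶ puncturedPlane) (hb : ∀ s, b.left s ∈ U) : ∃ p : T ⟶ B.X, p ≫ B.ρ = b := by
  have hr : Set.range b.left ⊆ Set.range U.ι := by
    rw [Scheme.Opens.range_ι]
    rintro _ ⟨s, rfl⟩
    exact hb s
  have key : (AffineSpace.homOfVector (IsOpenImmersion.lift U.ι b.left hr) (fun _ : Fin 1 => 0) ≫
      τ.iso.inv ≫ B.partι U) ≫ B.ρ.left = b.left := by
    rw [Category.assoc, Category.assoc, ← morphismRestrict_ι, ← τ.iso_over]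
    simp
  refine ⟨Over.homMk (AffineSpace.homOfVector (IsOpenImmersion.lift U.ι b.left hr)
    (fun _ : Fin 1 => 0) ≫ τ.iso.inv ≫ B.partι U) ?_, ?_⟩
  · rw [← Over.w B.ρ, ← Category.assoc, key, Over.w]
  · ext1
    exact key

/-- An equivariant function separates the points of the fibres. -/
lemma IsEquivariant.point_ext {t : Γ(B.part V, ⊤)} (ht : IsEquivariant t) {p p' : T ⟶ B.X}
    (h : p ≫ B.ρ = p' ≫ B.ρ) {q q' : T.left ⟶ B.part V} (hq : q ≫ B.partι V = p.left)
    (hq' : q' ≫ B.partι V = p'.left) (e : q.appTop t = q'.appTop t) : p = p' := by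
  refine point_ext_local fun s => ?_
  obtain ⟨U, hs, ⟨τ⟩⟩ := B.locallyTrivial ((p ≫ B.ρ).left s)
  refine ⟨(p ≫ B.ρ).left ⁻¹ᵁ U, hs, ?_⟩
  set O := (p ≫ B.ρ).left ⁻¹ᵁ U
  have h2 : (restrι T O ≫ p) ≫ B.ρ = (restrι T O ≫ p') ≫ B.ρ := by
    rw [Category.assoc, Category.assoc, h]
  have hO : ∀ s, ((restrι T O ≫ p) ≫ B.ρ).left s ∈ U := fun s => s.2
  obtain ⟨r, hr⟩ := exists_lift (restrι T O ≫ p) hO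
  obtain ⟨r', hr'⟩ := exists_lift_of_comp_eq h2.symm hr
  have h3 := eq_act_of_comp_eq τ h2 hr hr'
  set a := r'.appTop (coordinate τ) - r.appTop (coordinate τ)
  have h4 := ht a (restrι T O ≫ p) ((restrι T O).left ≫ q)
    ((restrι T O).left ≫ q') (by rw [Category.assoc, hq]; rfl)
    (by rw [Category.assoc, hq', ← h3]; rfl)
  rw [Scheme.Hom.comp_appTop, Scheme.Hom.comp_appTop, ConcreteCategory.comp_apply,
    ConcreteCategory.comp_apply, e, left_eq_add] at h4
  rw [h3, h4, B.action.zero_act]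

/-- The morphism to `V × 𝔸¹` given by a function on the part over `V`. -/
def toAffineSpace (t : Γ(B.part V, ⊤)) : B.part V ⟶ 𝔸(Fin 1; V.toScheme) :=
  AffineSpace.homOfVector (B.ρ.left ∣_ V) (fun _ => t)

lemma toAffineSpace_over (t : Γ(B.part V, ⊤)) :
    toAffineSpace t ≫ (𝔸(Fin 1; V.toScheme) ↘ V.toScheme) = B.ρ.left ∣_ V :=
  AffineSpace.homOfVector_over _ _

lemma toAffineSpace_coord (t : Γ(B.part V, ⊤)) :
    (toAffineSpace t).appTop (AffineSpace.coord _ 0) = t :=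
  AffineSpace.homOfVector_appTop_coord _ _ _

lemma IsEquivariant.mono_toAffineSpace {t : Γ(B.part V, ⊤)} (ht : IsEquivariant t) :
    Mono (toAffineSpace t) := by
  refine ⟨fun {Z} g h e => ?_⟩
  have e1 : g ≫ B.partι V ≫ B.ρ.left = h ≫ B.partι V ≫ B.ρ.left := by
    rw [← morphismRestrict_ι, ← toAffineSpace_over t]
    simp only [Category.assoc]
    rw [reassoc_of% e]
  let T : CScheme := Over.mk (g ≫ B.partι V ≫ B.X.hom)
  let p : T ⟶ B.X := Over.homMk (g ≫ B.partι V) (by simp [T])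
  let p' : T ⟶ B.X := Over.homMk (h ≫ B.partι V) (by
    rw [← Over.w B.ρ, Category.assoc, ← reassoc_of% e1, Over.w]
    rfl)
  have hp : p = p' := by
    refine ht.point_ext (q := g) (q' := h) ?_ rfl rfl ?_
    · ext1
      simpa [p, p'] using e1
    · rw [← toAffineSpace_coord t, ← ConcreteCategory.comp_apply, ← ConcreteCategory.comp_apply,
        ← Scheme.Hom.comp_appTop, ← Scheme.Hom.comp_appTop, e]
  rw [← cancel_mono (B.partι V)]
  exact congrArg CommaMorphism.left hp

lemma IsEquivariant.exists_point {t : Γ(B.part V, ⊤)} (ht : IsEquivariant t)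
    {U : puncturedPlane.left.Opens} (τ : Trivialization B.ρ B.action U) (b : T ⟶ puncturedPlane)
    (hU : ∀ s, b.left s ∈ U) (hV : ∀ s, b.left s ∈ V) (c : Γ(T.left, ⊤)) :
    ∃ q : T.left ⟶ B.part V, q ≫ B.partι V ≫ B.ρ.left = b.left ∧ q.appTop t = c := by
  obtain ⟨p, hp⟩ := exists_point_over τ b hU
  obtain ⟨q, hq⟩ := exists_lift (V := V) p (by rw [hp]; exact hV)
  obtain ⟨q', hq'⟩ := exists_lift_of_comp_eq (B.invariant (c - q.appTop t) p) hq
  refine ⟨q', ?_, ?_⟩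
  · rw [reassoc_of% hq']
    exact congrArg CommaMorphism.left ((B.invariant _ p).trans hp)
  · rw [ht _ p q q' hq hq']
    ring

/-- A monomorphism that has sections locally on the target is an isomorphism. Sections exist over
each trivializing open: lift the base point arbitrarily, then translate until t takes the required
value. -/
lemma IsEquivariant.isIso_toAffineSpace {t : Γ(B.part V, ⊤)} (ht : IsEquivariant t) :
    IsIso (toAffineSpace t) := by
  have hm := ht.mono_toAffineSpace
  refine IsZariskiLocalAtTarget.of_forall_exists_morphismRestrict
    (P := MorphismProperty.isomorphisms Scheme) fun z => ?_
  let π := (𝔸(Fin 1; V.toScheme) ↘ V.toScheme)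
  obtain ⟨U, hs, ⟨τ⟩⟩ := B.locallyTrivial ((π ≫ V.ι) z)
  refine ⟨(π ≫ V.ι) ⁻¹ᵁ U, hs, ?_⟩
  set W := (π ≫ V.ι) ⁻¹ᵁ U
  -- T is the tautological point of the part of V × 𝔸¹ lying over U; lifting it gives the section.
  let T : CScheme := Over.mk (W.ι ≫ π ≫ V.ι ≫ puncturedPlane.hom)
  let b : T ⟶ puncturedPlane := Over.homMk (W.ι ≫ π ≫ V.ι) (by simp [T])
  obtain ⟨q, hq, hqt⟩ := ht.exists_point τ b (fun s => s.2) (fun s => (π (W.ι s)).2)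
    (W.ι.appTop (AffineSpace.coord _ 0))
  have hqΦ : q ≫ toAffineSpace t = W.ι := by
    refine AffineSpace.hom_ext ?_ fun i => ?_
    · rw [Category.assoc, toAffineSpace_over, ← cancel_mono V.ι, Category.assoc,
        morphismRestrict_ι, hq]
      exact (Category.assoc _ _ _).symm
    · rw [Subsingleton.elim i 0, Scheme.Hom.comp_appTop, ConcreteCategory.comp_apply,
        toAffineSpace_coord]
      exact hqt
  have hpb := isPullback_morphismRestrict (toAffineSpace t) W
  have : Mono (toAffineSpace t ∣_ W) := by
    have : Mono ((toAffineSpace t ∣_ W) ≫ W.ι) := by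
      rw [morphismRestrict_ι]
      infer_instance
    exact mono_of_mono _ W.ι
  have : IsSplitEpi (toAffineSpace t ∣_ W) :=
    ⟨⟨hpb.lift (𝟙 _) q (by simpa using hqΦ.symm), hpb.lift_fst _ _ _⟩⟩
  exact isIso_of_mono_of_isSplitEpi _

/-- The trivialization given by an equivariant function. -/
def IsEquivariant.trivialization {t : Γ(B.part V, ⊤)} (ht : IsEquivariant t) :
    Trivialization B.ρ B.action V where
  iso :=
    have := ht.isIso_toAffineSpace
    asIso (toAffineSpace t)
  iso_over := toAffineSpace_over t
  equivariant a p q q' hq hq' := by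
    simp only [asIso_hom, Scheme.Hom.comp_appTop, ConcreteCategory.comp_apply, toAffineSpace_coord]
    exact ht a p q q' hq hq'

end GaBundle

lemma appTop_comp {T T' X : CScheme} (f : T' ⟶ T) (p : T ⟶ X) (a : Γ(X.left, ⊤)) :
    (f ≫ p).left.appTop a = f.left.appTop (p.left.appTop a) := by
  rw [Over.comp_left, Scheme.Hom.comp_appTop, ConcreteCategory.comp_apply]

/-! ### The universal point paired with a function. -/

section Line
variable (X : CScheme) {T : CScheme}

/-- The product of `X` and the affine line. -/
def line : CScheme := Over.mk ((𝔸(Fin 1; X.left) ↘ X.left) ≫ X.hom)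

/-- The projection from the product with the affine line. -/
def lineProj : line X ⟶ X := Over.homMk (𝔸(Fin 1; X.left) ↘ X.left) rfl

/-- The coordinate on the product with the affine line. -/
def lineCoord : Γ((line X).left, ⊤) := (AffineSpace.coord _ 0 : Γ(𝔸(Fin 1; X.left), ⊤))

variable {X}

/-- Every pair (p, a) is pulled back from (`lineProj`, `lineCoord`), so an identity for all p and a
need only be checked on one scheme. That scheme is quasi-compact if X is, which allows denominators
to be cleared uniformly. -/
lemma exists_line_lift (p : T ⟶ X) (a : Γ(T.left, ⊤)) :
    ∃ g : T ⟶ line X, g ≫ lineProj X = p ∧ g.left.appTop (lineCoord X) = a := by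
  have h : AffineSpace.homOfVector p.left (fun _ : Fin 1 => a) ≫ (𝔸(Fin 1; X.left) ↘ X.left) =
    p.left := AffineSpace.homOfVector_over _ _
  refine ⟨Over.homMk (U := T) (V := line X) (AffineSpace.homOfVector p.left fun _ => a) ?_, ?_, ?_⟩
  · exact (Category.assoc _ _ _).symm.trans ((congrArg (· ≫ X.hom) h).trans (Over.w p))
  · ext1
    exact h
  · exact AffineSpace.homOfVector_appTop_coord _ _ _

instance : IsAffineHom (lineProj X).left :=
  inferInstanceAs (IsAffineHom (𝔸(Fin 1; X.left) ↘ X.left))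

instance [CompactSpace X.left] : CompactSpace (line X).left :=
  QuasiCompact.compactSpace_of_compactSpace (lineProj X).left

end Line

/-! ### Functions of given slope along the fibres. -/

/-- The locus in the punctured plane where a function is invertible. -/
def locus (f : Γ(plane, ⊤)) : puncturedPlane.left.Opens := incl ⁻¹ᵁ plane.basicOpen f

namespace GaBundle
variable (B : GaBundle) {T : CScheme}

/-- The pullback to the total space of a function on the plane, as a ring homomorphism. -/
def pullbackHom : Γ(plane, ⊤) →+* Γ(B.X.left, ⊤) := (B.ρ.left ≫ incl).appTop.hom

lemma preimage_locus (f : Γ(plane, ⊤)) :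
    B.ρ.left ⁻¹ᵁ locus f = B.X.left.basicOpen (B.pullbackHom f) :=
  Scheme.preimage_basicOpen_top (B.ρ.left ≫ incl) f

variable {B}

lemma mem_locus_iff (p : T ⟶ B.X) (f : Γ(plane, ⊤)) (s : T.left) :
    (p ≫ B.ρ).left s ∈ locus f ↔ s ∈ T.left.basicOpen (p.left.appTop (B.pullbackHom f)) := by
  rw [← Scheme.preimage_basicOpen_top, ← preimage_locus]
  rfl

lemma appTop_pullbackHom (p : T ⟶ B.X) (f : Γ(plane, ⊤)) :
    p.left.appTop (B.pullbackHom f) = ((p ≫ B.ρ).left ≫ incl).appTop f := by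
  rw [Over.comp_left, Category.assoc, Scheme.Hom.comp_appTop p.left, ConcreteCategory.comp_apply]
  rfl

lemma appTop_coord (p : T ⟶ B.X) (i : Fin 2) :
    p.left.appTop (B.pullbackHom (AffineSpace.coord _ i)) = coords (p ≫ B.ρ) i :=
  appTop_pullbackHom p _

lemma pullbackHom_act (a : Γ(T.left, ⊤)) (p : T ⟶ B.X) (f : Γ(plane, ⊤)) :
    (B.action.act a p).left.appTop (B.pullbackHom f) = p.left.appTop (B.pullbackHom f) := by
  rw [appTop_pullbackHom, appTop_pullbackHom, B.invariant]

/-- The function `e` grows along the fibres with slope `r`. -/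
def HasSlope (e r : Γ(B.X.left, ⊤)) : Prop :=
  ∀ ⦃T : CScheme⦄ (a : Γ(T.left, ⊤)) (p : T ⟶ B.X),
    (B.action.act a p).left.appTop e = p.left.appTop e + p.left.appTop r * a

lemma HasSlope.add {e r e' r' : Γ(B.X.left, ⊤)} (h : HasSlope e r) (h' : HasSlope e' r') :
    HasSlope (e + e') (r + r') := by
  intro T a p
  rw [map_add, map_add, map_add, h, h']
  ring

lemma HasSlope.pullback_mul {e r : Γ(B.X.left, ⊤)} (h : HasSlope e r) (f : Γ(plane, ⊤)) :
    HasSlope (B.pullbackHom f * e) (B.pullbackHom f * r) := by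
  intro T a p
  rw [map_mul, map_mul, map_mul, h, pullbackHom_act]
  ring

/-- An equivariant function on the locus where `f` is invertible extends to a function on the whole
total space after multiplication by a power of `f`. -/
lemma IsEquivariant.exists_hasSlope [CompactSpace B.X.left] [QuasiSeparatedSpace B.X.left]
    {f : Γ(plane, ⊤)} {t : Γ(B.part (locus f), ⊤)} (ht : IsEquivariant t) :
    ∃ (N : ℕ) (e : Γ(B.X.left, ⊤)), HasSlope e (B.pullbackHom f ^ N) ∧
      (B.partι (locus f)).appTop e = (B.partι (locus f)).appTop (B.pullbackHom f) ^ N * t := by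
  have key : ∃ (N : ℕ) (e : Γ(B.X.left, ⊤)),
      (B.partι (locus f)).appTop e = (B.partι (locus f)).appTop (B.pullbackHom f) ^ N * t :=
    exists_appTop_eq_pow_mul _ (B.preimage_locus f) t
  obtain ⟨N, e, he⟩ := key
  set F := B.pullbackHom f with hF
  let p₀ := lineProj B.X
  let a₀ := lineCoord B.X
  -- For the universal pair the slope identity holds where F is invertible, hence everywhere after
  -- multiplication by one power of F.
  obtain ⟨n, hn⟩ := exists_pow_mul_eq_zero (p₀.left.appTop F) rfl
    ((B.action.act a₀ p₀).left.appTop e - (p₀.left.appTop e + p₀.left.appTop F ^ N * a₀)) (by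
      set O := (line B.X).left.basicOpen (p₀.left.appTop F)
      let j := restrι (line B.X) O
      obtain ⟨q, hq⟩ := exists_lift (V := locus f) (j ≫ p₀) (fun s => by
        rw [Category.assoc]
        exact (mem_locus_iff p₀ f (O.ι s)).2 s.2)
      obtain ⟨q', hq'⟩ := exists_lift_of_comp_eq (B.invariant (j.left.appTop a₀) (j ≫ p₀)) hq
      have h1 := ht _ _ q q' hq hq'
      have h2 : ∀ {p : restr (line B.X) O ⟶ B.X} {q : (restr (line B.X) O).left ⟶ B.part (locus f)},
          q ≫ B.partι (locus f) = p.left →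
            p.left.appTop e = p.left.appTop F ^ N * q.appTop t := by
        intro p q h
        rw [← h, Scheme.Hom.comp_appTop, ConcreteCategory.comp_apply, ConcreteCategory.comp_apply,
          he, map_mul, map_pow]
      have h3 := h2 hq'
      rw [h1, pullbackHom_act, mul_add, ← h2 hq, ← B.action.natural, appTop_comp, appTop_comp,
        appTop_comp, ← map_pow, ← map_mul, ← map_add] at h3
      rw [map_sub, sub_eq_zero]
      exact h3)
  refine ⟨n + N, F ^ n * e, ?_, ?_⟩
  · intro T a p
    obtain ⟨g, hg, hga⟩ := exists_line_lift p a
    have h4 := congrArg g.left.appTop hn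
    rw [map_zero, map_mul, map_sub, map_add, map_mul, map_pow, map_pow] at h4
    simp only [← appTop_comp, p₀, a₀] at h4
    rw [B.action.natural, hg, hga] at h4
    simp only [map_mul, map_pow, hF, pullbackHom_act] at h4 ⊢
    linear_combination h4
  · rw [map_mul, map_pow, he]
    ring

lemma IsEquivariant.restrict {V V' : puncturedPlane.left.Opens} {t : Γ(B.part V, ⊤)}
    (ht : IsEquivariant t) (h : V' ≤ V) :
    IsEquivariant (V := V') ((B.X.left.homOfLE (B.ρ.left.preimage_mono h)).appTop t) := by
  intro T a p q q' hq hq'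
  rw [← ConcreteCategory.comp_apply, ← ConcreteCategory.comp_apply, ← Scheme.Hom.comp_appTop,
    ← Scheme.Hom.comp_appTop]
  refine ht a p _ _ ?_ ?_
  · rw [Category.assoc, Scheme.homOfLE_ι, hq]
  · rw [Category.assoc, Scheme.homOfLE_ι, hq']

instance : CompactSpace puncturedPlane.left := by
  refine isCompact_iff_compactSpace.mp (?_ : IsCompact (puncturedOpen : Set plane))
  exact (((isAffineOpen_top plane).basicOpen _).isCompact).union
    ((isAffineOpen_top plane).basicOpen _).isCompact

instance : QuasiSeparatedSpace puncturedPlane.left :=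
  quasiSeparatedSpace_of_quasiSeparated incl

lemma IsHomogeneousLift.compactSpace {μ : GmAction B.X} {d : ℕ} (h : B.IsHomogeneousLift μ d) :
    CompactSpace B.X.left :=
  have := h.isAffineHom
  QuasiCompact.compactSpace_of_compactSpace B.ρ.left

lemma IsHomogeneousLift.quasiSeparatedSpace {μ : GmAction B.X} {d : ℕ}
    (h : B.IsHomogeneousLift μ d) : QuasiSeparatedSpace B.X.left :=
  have := h.isAffineHom
  quasiSeparatedSpace_of_quasiSeparated B.ρ.left

variable (B) in
/-- The ideal of slopes of functions on the total space. -/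
def slopeIdeal : Ideal Γ(plane, ⊤) where
  carrier := {r | ∃ e : Γ(B.X.left, ⊤), HasSlope e (B.pullbackHom r)}
  zero_mem' := ⟨0, fun _ a p => by simp⟩
  add_mem' := by
    rintro r r' ⟨e, he⟩ ⟨e', he'⟩
    exact ⟨e + e', by rw [map_add]; exact he.add he'⟩
  smul_mem' := by
    rintro c r ⟨e, he⟩
    exact ⟨B.pullbackHom c * e, by rw [smul_eq_mul, map_mul]; exact he.pullback_mul c⟩

/-- Each point has a principal neighbourhood inside a trivializing open, and the fibre coordinate
there extends after multiplication by a power of f. -/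
lemma exists_pow_mem_slopeIdeal [CompactSpace B.X.left] [QuasiSeparatedSpace B.X.left]
    (s : puncturedPlane.left) : ∃ (f : Γ(plane, ⊤)) (N : ℕ),
      incl s ∈ plane.basicOpen f ∧ f ^ N ∈ B.slopeIdeal := by
  obtain ⟨U, hs, ⟨τ⟩⟩ := B.locallyTrivial s
  obtain ⟨f, hf, hsf⟩ := (isAffineOpen_top plane).exists_basicOpen_le (V := incl ''ᵁ U)
    ⟨incl s, ⟨s, hs, rfl⟩⟩ trivial
  have hle : locus f ≤ U := by
    intro z hz
    obtain ⟨z', hz', e⟩ := hf hz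
    rwa [← incl.isOpenEmbedding.injective e]
  obtain ⟨N, e, he, -⟩ := ((isEquivariant_coordinate τ).restrict hle).exists_hasSlope
  exact ⟨f, N, hsf, e, by rwa [map_pow]⟩

/-- This takes the place of the triviality of torsors over an affine chart. A prime containing the
slope ideal but not the coordinate would be a point of the punctured plane, where some f^N in the
ideal does not vanish. -/
lemma exists_hasSlope_coord_pow [CompactSpace B.X.left] [QuasiSeparatedSpace B.X.left]
    (i : Fin 2) : ∃ (k : ℕ) (e : Γ(B.X.left, ⊤)),
      HasSlope e (B.pullbackHom (AffineSpace.coord _ i) ^ k) := by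
  have key : (AffineSpace.coord _ i : Γ(plane, ⊤)) ∈ B.slopeIdeal.radical := by
    rw [Ideal.radical_eq_sInf, Ideal.mem_sInf]
    rintro J ⟨hJ, hJp⟩
    by_contra hi
    obtain ⟨P, hPJ⟩ : ∃ P : Spec Γ(plane, ⊤), P.asIdeal = J := ⟨⟨J, hJp⟩, rfl⟩
    have hP : plane.isoSpec.hom (plane.isoSpec.inv P) = P := by
      rw [← Scheme.Hom.comp_apply, Iso.inv_hom_id]
      rfl
    have hmem : ∀ f, plane.isoSpec.inv P ∈ plane.basicOpen f ↔ f ∉ J := by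
      intro f
      rw [← Scheme.map_PrimeSpectrum_basicOpen_of_affine, ← hPJ]
      exact (iff_of_eq (congrArg (fun z : PrimeSpectrum Γ(plane, ⊤) =>
        z ∈ PrimeSpectrum.basicOpen f) hP)).trans Iff.rfl
    have hs : plane.isoSpec.inv P ∈ Set.range incl := by
      rw [range_incl]
      have := (hmem _).2 hi
      fin_cases i
      · exact Or.inl this
      · exact Or.inr this
    obtain ⟨s, hs⟩ := hs
    obtain ⟨f, N, hf, hN⟩ := B.exists_pow_mem_slopeIdeal s
    rw [hs, hmem] at hf
    exact hf (hJp.mem_of_pow_mem N (hJ hN))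
  obtain ⟨k, e, he⟩ := key
  exact ⟨k, e, by rwa [map_pow] at he⟩

end GaBundle

/-! ### Universal points for 𝔾ₘ, and homogeneous fibre coordinates. -/

/-- The pullback of invertible functions. -/
abbrev unitsMap {T T' : CScheme} (f : T' ⟶ T) : Γ(T.left, ⊤)ˣ →* Γ(T'.left, ⊤)ˣ :=
  Units.map (f.left.appTop.hom : Γ(T.left, ⊤) →* Γ(T'.left, ⊤))

lemma coe_unitsMap {T T' : CScheme} (f : T' ⟶ T) (c : Γ(T.left, ⊤)ˣ) :
    (unitsMap f c : Γ(T'.left, ⊤)) = f.left.appTop (c : Γ(T.left, ⊤)) := rfl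

lemma coe_unitsMap_zpow {T T' : CScheme} (f : T' ⟶ T) (c : Γ(T.left, ⊤)ˣ) (w : ℤ) :
    ((unitsMap f c ^ w : Γ(T'.left, ⊤)ˣ) : Γ(T'.left, ⊤)) =
      f.left.appTop ((c ^ w : Γ(T.left, ⊤)ˣ) : Γ(T.left, ⊤)) := by
  rw [← map_zpow]
  rfl

lemma exists_restr_lift {T Y : CScheme} (g : T ⟶ Y) {O : Y.left.Opens} (h : ∀ s, g.left s ∈ O) :
    ∃ g' : T ⟶ restr Y O, g' ≫ restrι Y O = g := by
  have hr : Set.range g.left ⊆ Set.range O.ι := by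
    rw [Scheme.Opens.range_ι]
    rintro _ ⟨s, rfl⟩
    exact h s
  let l := IsOpenImmersion.lift O.ι g.left hr
  have hl : l ≫ O.ι = g.left := IsOpenImmersion.lift_fac O.ι g.left hr
  refine ⟨Over.homMk (U := T) (V := restr Y O) l ?_, ?_⟩
  · exact (Category.assoc _ _ _).symm.trans ((congrArg (· ≫ Y.hom) hl).trans (Over.w g))
  · ext1
    exact hl

section Torus
variable (X : CScheme) {T : CScheme}

/-- The product of `X` and the multiplicative group. -/
abbrev torus : CScheme := restr (line X) ((line X).left.basicOpen (lineCoord X))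

/-- The projection from the product with the multiplicative group. -/
def torusProj : torus X ⟶ X := restrι (line X) _ ≫ lineProj X

/-- The coordinate on the product with the multiplicative group. -/
def torusUnit : Γ((torus X).left, ⊤)ˣ :=
  (isUnit_appTop_basicOpen (lineCoord X) rfl).unit

variable {X}

lemma exists_torus_lift (p : T ⟶ X) (c : Γ(T.left, ⊤)ˣ) :
    ∃ g : T ⟶ torus X, g ≫ torusProj X = p ∧ unitsMap g (torusUnit X) = c := by
  obtain ⟨g, hg, hc⟩ := exists_line_lift p (c : Γ(T.left, ⊤))
  obtain ⟨g', hg'⟩ := exists_restr_lift g (O := (line X).left.basicOpen (lineCoord X)) (by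
    intro s
    change s ∈ g.left ⁻¹ᵁ (line X).left.basicOpen (lineCoord X)
    rw [Scheme.preimage_basicOpen_top, hc, Scheme.basicOpen_of_isUnit _ c.isUnit]
    trivial)
  refine ⟨g', ?_, ?_⟩
  · rw [torusProj, reassoc_of% hg', hg]
  · ext1
    rw [coe_unitsMap, ← hc, ← hg', appTop_comp]
    rfl

instance [CompactSpace X.left] : CompactSpace (torus X).left :=
  isCompact_iff_compactSpace.mp (isCompact_basicOpen _ isCompact_univ (lineCoord X))

end Torus

/-- A function of weight `w` for an action of the multiplicative group. -/
def HasGmWeight {X : CScheme} (μ : GmAction X) (e : Γ(X.left, ⊤)) (w : ℤ) : Prop :=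
  ∀ ⦃T : CScheme⦄ (c : Γ(T.left, ⊤)ˣ) (p : T ⟶ X),
    (μ.act c p).left.appTop e = ((c ^ w : Γ(T.left, ⊤)ˣ) : Γ(T.left, ⊤)) * p.left.appTop e

namespace GaBundle
variable {B : GaBundle} {μ : GmAction B.X} {d : ℕ} {T : CScheme}

/-- Both sides lie in the same fibre, and in the fibre coordinate t both are c^(-d)(t + a). -/
lemma act_comm_of_mem {U : puncturedPlane.left.Opens}
    (hl : ∀ {T : CScheme} (c : Γ(T.left, ⊤)ˣ) (p : T ⟶ B.X),
      μ.act c p ≫ B.ρ = linearAction.act c (p ≫ B.ρ)) (hU : IsStable U)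
    (τ : Trivialization B.ρ B.action U) (hτ : τ.HasWeight μ d) (c : Γ(T.left, ⊤)ˣ)
    (a : Γ(T.left, ⊤)) (p : T ⟶ B.X) (hp : ∀ s, (p ≫ B.ρ).left s ∈ U) :
    μ.act c (B.action.act a p) =
      B.action.act (((c ^ (-(d : ℤ)) : Γ(T.left, ⊤)ˣ) : Γ(T.left, ⊤)) * a) (μ.act c p) := by
  have hμ : ∀ p' : T ⟶ B.X, (∀ s, (p' ≫ B.ρ).left s ∈ U) →
      ∀ s, (μ.act c p' ≫ B.ρ).left s ∈ U := by
    intro p' hp' s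
    rw [hl]
    refine hU c (p' ≫ B.ρ) ?_ ⟨s, rfl⟩
    rintro _ ⟨s, rfl⟩
    exact hp' s
  have hp1 : ∀ s, (B.action.act a p ≫ B.ρ).left s ∈ U := by rwa [B.invariant]
  obtain ⟨q, hq⟩ := exists_lift p hp
  obtain ⟨q₁, hq₁⟩ := exists_lift (B.action.act a p) hp1
  obtain ⟨r, hr⟩ := exists_lift (μ.act c p) (hμ p hp)
  obtain ⟨r₁, hr₁⟩ := exists_lift (μ.act c (B.action.act a p)) (hμ _ hp1)
  obtain ⟨r₂, hr₂⟩ := exists_lift_of_comp_eq (B.invariant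
    (((c ^ (-(d : ℤ)) : Γ(T.left, ⊤)ˣ) : Γ(T.left, ⊤)) * a) (μ.act c p)) hr
  refine trivialization_ext τ ?_ hr₁ hr₂ ?_
  · rw [B.invariant, hl, hl, B.invariant]
  · have h1 := hτ c p q r hq hr
    have h2 := hτ c (B.action.act a p) q₁ r₁ hq₁ hr₁
    rw [← appTop_coordinate, ← appTop_coordinate] at h1 h2
    rw [h2, isEquivariant_coordinate τ _ _ _ _ hr hr₂, h1,
      isEquivariant_coordinate τ _ _ _ _ hq hq₁]
    ring

/-- The actions of the additive and the multiplicative group commute up to a character. -/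
lemma IsHomogeneousLift.act_comm (h : B.IsHomogeneousLift μ d) (c : Γ(T.left, ⊤)ˣ)
    (a : Γ(T.left, ⊤)) (p : T ⟶ B.X) :
    μ.act c (B.action.act a p) =
      B.action.act (((c ^ (-(d : ℤ)) : Γ(T.left, ⊤)ˣ) : Γ(T.left, ⊤)) * a) (μ.act c p) := by
  refine point_ext_local fun s => ?_
  obtain ⟨U, hs, hU, -, τ, hτ⟩ := h.cover ((p ≫ B.ρ).left s)
  refine ⟨(p ≫ B.ρ).left ⁻¹ᵁ U, hs, ?_⟩
  rw [μ.natural, B.action.natural, B.action.natural, μ.natural, map_mul, ← coe_unitsMap_zpow]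
  exact act_comm_of_mem h.lifts hU τ hτ _ _ _ fun s => s.2

lemma IsHomogeneousLift.hasGmWeight_coord (h : B.IsHomogeneousLift μ d) (i : Fin 2) :
    HasGmWeight μ (B.pullbackHom (AffineSpace.coord _ i)) 1 := by
  intro T c p
  rw [appTop_coord, h.lifts, appTop_coord, zpow_one]
  exact coords_scaled c _ i

/-- The function `x⁻ᵈ e(x⁻¹ q)` on the locus where the coordinate `x` is invertible. -/
def homogenization (μ : GmAction B.X) (d : ℕ) (i : Fin 2) (e : Γ(B.X.left, ⊤)) :
    Γ(B.part (locus (AffineSpace.coord _ i)), ⊤) :=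
  let u : Γ((restr B.X (B.ρ.left ⁻¹ᵁ locus (AffineSpace.coord _ i))).left, ⊤)ˣ :=
    (isUnit_appTop_basicOpen (B.pullbackHom (AffineSpace.coord _ i)) (B.preimage_locus _)).unit
  ((u ^ (-(d : ℤ)) : Γ((restr B.X (B.ρ.left ⁻¹ᵁ locus (AffineSpace.coord _ i))).left, ⊤)ˣ) :
    Γ((restr B.X (B.ρ.left ⁻¹ᵁ locus (AffineSpace.coord _ i))).left, ⊤)) *
      (μ.act u⁻¹ (restrι B.X (B.ρ.left ⁻¹ᵁ locus (AffineSpace.coord _ i)))).left.appTop e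

lemma appTop_homogenization (i : Fin 2) (e : Γ(B.X.left, ⊤)) {p : T ⟶ B.X}
    {q : T.left ⟶ B.part (locus (AffineSpace.coord _ i))} (hq : q ≫ B.partι _ = p.left)
    {v : Γ(T.left, ⊤)ˣ} (hv : v = p.left.appTop (B.pullbackHom (AffineSpace.coord _ i))) :
    q.appTop (homogenization μ d i e) =
      ((v ^ (-(d : ℤ)) : Γ(T.left, ⊤)ˣ) : Γ(T.left, ⊤)) * (μ.act v⁻¹ p).left.appTop e := by
  set O := B.ρ.left ⁻¹ᵁ locus (AffineSpace.coord _ i)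
  obtain ⟨g, hg⟩ : ∃ g : T ⟶ restr B.X O, g.left = q := by
    refine ⟨Over.homMk (U := T) (V := restr B.X O) q ?_, rfl⟩
    exact (Category.assoc _ _ _).symm.trans ((congrArg (· ≫ B.X.hom) hq).trans (Over.w p))
  have hgp : g ≫ restrι B.X O = p := by
    ext1
    rw [← hq, ← hg]
    rfl
  let u : Γ((restr B.X O).left, ⊤)ˣ :=
    (isUnit_appTop_basicOpen (B.pullbackHom (AffineSpace.coord _ i)) (B.preimage_locus _)).unit
  have hu : unitsMap g u = v := by
    ext1
    rw [hv, ← hgp, appTop_comp]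
    rfl
  subst hg
  change g.left.appTop (((u ^ (-(d : ℤ)) : Γ((restr B.X O).left, ⊤)ˣ) : Γ((restr B.X O).left, ⊤)) *
    (μ.act u⁻¹ (restrι B.X O)).left.appTop e) = _
  rw [map_mul, ← coe_unitsMap_zpow, hu, ← appTop_comp, μ.natural, hgp, map_inv]
  erw [hu]

lemma IsHomogeneousLift.coord_act_inv (h : B.IsHomogeneousLift μ d) (i : Fin 2) {p : T ⟶ B.X}
    {v : Γ(T.left, ⊤)ˣ} (hv : v = p.left.appTop (B.pullbackHom (AffineSpace.coord _ i))) :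
    (μ.act v⁻¹ p).left.appTop (B.pullbackHom (AffineSpace.coord _ i)) = 1 := by
  rw [h.hasGmWeight_coord i, zpow_one, ← hv, Units.inv_mul]

lemma isUnit_coord_of_lift (i : Fin 2) {p : T ⟶ B.X}
    {q : T.left ⟶ B.part (locus (AffineSpace.coord _ i))} (hq : q ≫ B.partι _ = p.left) :
    IsUnit (p.left.appTop (B.pullbackHom (AffineSpace.coord _ i))) := by
  rw [← hq, Scheme.Hom.comp_appTop, ConcreteCategory.comp_apply]
  exact (isUnit_appTop_basicOpen (B.pullbackHom (AffineSpace.coord _ i))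
    (B.preimage_locus _)).map q.appTop.hom

/-- At the point x⁻¹q the coordinate is 1, so e has slope 1 there. Translating q by a translates
x⁻¹q by x^d a, and the factor x^(-d) compensates. -/
lemma IsHomogeneousLift.isEquivariant_homogenization (h : B.IsHomogeneousLift μ d) (i : Fin 2)
    {e : Γ(B.X.left, ⊤)} {k : ℕ} (he : HasSlope e (B.pullbackHom (AffineSpace.coord _ i) ^ k)) :
    IsEquivariant (homogenization μ d i e) := by
  intro T a p q q' hq hq'
  obtain ⟨v, hv⟩ := isUnit_coord_of_lift i hq
  rw [appTop_homogenization i e hq hv, appTop_homogenization i e hq' (v := v)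
    (by rw [hv, pullbackHom_act]), h.act_comm, he, map_pow, h.coord_act_inv i hv, one_pow, one_mul,
    mul_add, ← mul_assoc, ← Units.val_mul, inv_zpow, mul_inv_cancel, Units.val_one, one_mul]

/-- Since (cx)⁻¹(cq) = x⁻¹q, only the prefactor changes, from x^(-d) to (cx)^(-d). -/
lemma homogenization_act (i : Fin 2) (h : B.IsHomogeneousLift μ d) (e : Γ(B.X.left, ⊤))
    (c : Γ(T.left, ⊤)ˣ) {p : T ⟶ B.X}
    {q q' : T.left ⟶ B.part (locus (AffineSpace.coord _ i))} (hq : q ≫ B.partι _ = p.left)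
    (hq' : q' ≫ B.partι _ = (μ.act c p).left) :
    q'.appTop (homogenization μ d i e) = ((c ^ (-(d : ℤ)) : Γ(T.left, ⊤)ˣ) : Γ(T.left, ⊤)) *
      q.appTop (homogenization μ d i e) := by
  obtain ⟨v, hv⟩ := isUnit_coord_of_lift i hq
  rw [appTop_homogenization i e hq hv, appTop_homogenization i e hq' (v := c * v)
    (by rw [h.hasGmWeight_coord, zpow_one, Units.val_mul, hv]), ← μ.mul_act, mul_inv, mul_comm c⁻¹,
    inv_mul_cancel_right, mul_zpow, Units.val_mul, mul_assoc]

/-- A power of a coordinate is the slope of a homogeneous function. -/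
lemma IsHomogeneousLift.exists_hasSlope_hasGmWeight (h : B.IsHomogeneousLift μ d) (i : Fin 2) :
    ∃ (k : ℕ) (e : Γ(B.X.left, ⊤)), HasSlope e (B.pullbackHom (AffineSpace.coord _ i) ^ k) ∧
      HasGmWeight μ e (k - d) := by
  have := h.compactSpace
  have := h.quasiSeparatedSpace
  obtain ⟨k₀, e₀, he₀⟩ := B.exists_hasSlope_coord_pow i
  set f : Γ(plane, ⊤) := AffineSpace.coord _ i with hf
  set F := B.pullbackHom f with hF
  obtain ⟨N, e, hs, he⟩ := (h.isEquivariant_homogenization i he₀).exists_hasSlope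
  let p₀ := torusProj B.X
  let c₀ := torusUnit B.X
  -- The weight identity holds for the universal pair where F is invertible; a power of F makes it
  -- global, shifting slope and weight together.
  obtain ⟨n, hn⟩ := exists_pow_mul_eq_zero (p₀.left.appTop F) rfl ((μ.act c₀ p₀).left.appTop e -
    ((c₀ ^ ((N : ℤ) - d) : Γ((torus B.X).left, ⊤)ˣ) : Γ((torus B.X).left, ⊤)) *
      p₀.left.appTop e) (by
      set O := (torus B.X).left.basicOpen (p₀.left.appTop F)
      let j := restrι (torus B.X) O
      have hj : ∀ s, ((j ≫ p₀) ≫ B.ρ).left s ∈ locus f := fun s => by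
        rw [Category.assoc]
        exact (mem_locus_iff p₀ f (O.ι s)).2 s.2
      obtain ⟨q, hq⟩ := exists_lift (V := locus f) (j ≫ p₀) hj
      obtain ⟨q', hq'⟩ := exists_lift (V := locus f) (μ.act (unitsMap j c₀) (j ≫ p₀)) (fun s => by
        have h1 := (mem_locus_iff _ _ _).1 (hj s)
        rw [mem_locus_iff, h.hasGmWeight_coord i, Scheme.basicOpen_mul,
          Scheme.basicOpen_of_isUnit _ (Units.isUnit _), top_inf_eq]
        exact h1)
      have h1 := homogenization_act i h e₀ (unitsMap j c₀) hq hq'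
      have h2 : ∀ {p : restr (torus B.X) O ⟶ B.X}
          {q : (restr (torus B.X) O).left ⟶ B.part (locus f)}, q ≫ B.partι (locus f) = p.left →
            p.left.appTop e = p.left.appTop F ^ N * q.appTop (homogenization μ d i e₀) := by
        intro p q h
        rw [← h, Scheme.Hom.comp_appTop, ConcreteCategory.comp_apply, ConcreteCategory.comp_apply,
          he, map_mul, map_pow]
      have h3 := h2 hq'
      have h4 : unitsMap j c₀ ^ N * unitsMap j c₀ ^ (-(d : ℤ)) =
          unitsMap j c₀ ^ ((N : ℤ) - d) := by
        rw [sub_eq_add_neg, zpow_add, zpow_natCast]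
      rw [h1, h.hasGmWeight_coord i, zpow_one, mul_pow, mul_mul_mul_comm, ← h2 hq,
        ← Units.val_pow_eq_pow_val, ← Units.val_mul, h4, coe_unitsMap_zpow, ← μ.natural,
        appTop_comp, appTop_comp, ← map_mul] at h3
      rw [map_sub, sub_eq_zero]
      exact h3)
  refine ⟨n + N, F ^ n * e, ?_, ?_⟩
  · rw [pow_add, hF, ← map_pow]
    exact hs.pullback_mul _
  · intro T c p
    obtain ⟨g, hg, hga⟩ := exists_torus_lift p c
    have h4 := congrArg g.left.appTop hn
    rw [map_zero, map_mul, map_sub, map_mul, map_pow, ← coe_unitsMap_zpow] at h4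
    simp only [← appTop_comp, p₀, c₀] at h4
    rw [μ.natural, hg, hga] at h4
    have h5 : c ^ (((n + N : ℕ) : ℤ) - d) = c ^ n * c ^ ((N : ℤ) - d) := by
      rw [← zpow_natCast, ← zpow_add]
      congr 1
      push_cast
      ring
    rw [map_mul, map_mul, map_pow, map_pow, h.hasGmWeight_coord i, zpow_one, h5, Units.val_mul,
      Units.val_pow_eq_pow_val]
    linear_combination (c : Γ(T.left, ⊤)) ^ n * h4

end GaBundle

/-! ### Homogeneous invariant functions are binary forms. -/

section Invariants
open Polynomial
variable {A : Type*} [CommRing A] [Algebra ℂ A] {x y τ ς : A} {k : ℕ}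

lemma exists_aeval_eq {u v w a : A} (h : a ∈ Algebra.adjoin ℂ {u, v, w}) :
    ∃ p : MvPolynomial (Fin 3) ℂ, a = MvPolynomial.aeval ![u, v, w] p := by
  have hr : ({u, v, w} : Set A) = Set.range ![u, v, w] := by
    ext a
    simp [eq_comm]
    tauto
  rw [hr, Algebra.adjoin_range_eq_range_aeval] at h
  obtain ⟨p, hp⟩ := h
  exact ⟨p, hp.symm⟩

/-- The values of a homogeneous invariant function of degree `N`. -/
lemma exists_values_of_invariant {u v w z : A} {N : ℕ}
    (hmem : ∃ K : ℕ, u ^ K * z ∈ Algebra.adjoin ℂ {u, v, w})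
    (htr : ∀ s : ℂ, ∃ θ : A →ₐ[ℂ] A, θ u = u ∧ θ v = v ∧ θ w = w + s • u ^ k ∧ θ z = z)
    (hsc : ∀ c : ℂ, c ≠ 0 → ∃ θ : A →ₐ[ℂ] A, θ u = c • u ∧ θ v = c • v ∧ θ z = c ^ N • z) :
    ∃ g : ℂ[X], ∀ φ : A →ₐ[ℂ] ℂ, φ u ≠ 0 → φ z = φ u ^ N * g.eval (φ v / φ u) := by
  obtain ⟨K, hK⟩ := hmem
  obtain ⟨p, hp⟩ := exists_aeval_eq hK
  -- Scaling brings u to 1 and translation brings w to 0, so z depends only on the ratio v/u.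
  let g : ℂ[X] := MvPolynomial.aeval ![1, X, 0] p
  refine ⟨g, fun φ hφ => ?_⟩
  obtain ⟨θ, h0, h1, h2⟩ := hsc (φ u)⁻¹ (inv_ne_zero hφ)
  have e0 : φ (θ u) = 1 := by rw [h0, map_smul, smul_eq_mul, inv_mul_cancel₀ hφ]
  have e1 : φ (θ v) = φ v / φ u := by rw [h1, map_smul, smul_eq_mul, div_eq_inv_mul]
  have e2 : φ (θ z) = (φ u)⁻¹ ^ N * φ z := by rw [h2, map_smul, smul_eq_mul]
  obtain ⟨θ', h0', h1', h2', h3'⟩ := htr (-(φ (θ w)))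
  have key := congrArg (fun a => φ (θ (θ' a))) hp
  simp only [map_mul, map_pow, h0', h3', e0, one_pow, one_mul, e2] at key
  rw [← AlgHom.comp_apply, ← AlgHom.comp_apply, ← AlgHom.comp_apply, MvPolynomial.comp_aeval] at key
  have h4 : g.eval (φ v / φ u) = (φ u)⁻¹ ^ N * φ z := by
    rw [key, ← coe_aeval_eq_eval, ← AlgHom.comp_apply, MvPolynomial.comp_aeval]
    congr 2
    funext i
    fin_cases i
    · simp [h0', e0]
    · simp [h1', e1]
    · simp [h2', e0]
  rw [h4, ← mul_assoc, ← mul_pow, mul_inv_cancel₀ hφ, one_pow, one_mul]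

/-- The hypothesis bounds the pole of g at infinity by N; algebraically, it compares g with the
reverse of h. -/
lemma natDegree_le_of_eval_eq {N : ℕ} {g h : ℂ[X]}
    (H : ∀ t : ℂ, t ≠ 0 → g.eval t = t ^ N * h.eval t⁻¹) : g.natDegree ≤ N := by
  have hp : X ^ h.natDegree * g * X = X ^ N * h.reverse * X := by
    refine Polynomial.funext fun t => ?_
    by_cases ht : t = 0
    · simp [ht]
    have h2 : h.reverse.eval t = t ^ h.natDegree * h.eval t⁻¹ := by
      let _ : Invertible t⁻¹ := invertibleOfNonzero (inv_ne_zero ht)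
      have h3 := eval₂_reverse_mul_pow (RingHom.id ℂ) t⁻¹ h
      simp only [invOf_eq_inv, inv_inv, eval₂_id] at h3
      rw [← h3, mul_left_comm, ← mul_pow, mul_inv_cancel₀ ht, one_pow, mul_one]
    simp only [eval_mul, eval_pow, eval_X, H t ht, h2]
    ring
  have hp' := mul_right_cancel₀ X_ne_zero hp
  by_cases hg : g = 0
  · simp [hg]
  have h1 := congrArg natDegree hp'
  rw [natDegree_mul (pow_ne_zero _ X_ne_zero) hg, natDegree_X_pow] at h1
  have h2 : (X ^ N * h.reverse).natDegree ≤ N + h.natDegree :=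
    natDegree_mul_le.trans (by
      rw [natDegree_X_pow]
      exact Nat.add_le_add_left (reverse_natDegree_le h) _)
  omega

/-- On the two charts z is x^N g(y/x) and y^N h(x/y), and the overlap bounds the degree of g. -/
lemma exists_eq_form_of_invariant {z : A} {N : ℕ}
    (regular : ∀ a, x * a = 0 → a = 0)
    (points : ∀ a b c : ℂ, a ≠ 0 → ∃ φ : A →ₐ[ℂ] ℂ, φ x = a ∧ φ y = b ∧ φ τ = c)
    (hx : ∀ a, ∃ K : ℕ, x ^ K * a ∈ Algebra.adjoin ℂ {x, y, τ})
    (hy : ∀ a, ∃ K : ℕ, y ^ K * a ∈ Algebra.adjoin ℂ {x, y, ς})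
    (htr : ∀ s : ℂ, ∃ θ : A →ₐ[ℂ] A, θ x = x ∧ θ y = y ∧ θ τ = τ + s • x ^ k ∧
      θ ς = ς + s • y ^ k ∧ θ z = z)
    (hsc : ∀ c : ℂ, c ≠ 0 → ∃ θ : A →ₐ[ℂ] A, θ x = c • x ∧ θ y = c • y ∧ θ z = c ^ N • z) :
    ∃ g : ℂ[X], g.natDegree ≤ N ∧ z = form N g x y := by
  obtain ⟨g, hg⟩ := exists_values_of_invariant (k := k) (N := N) (hx z)
    (fun s => by obtain ⟨θ, h0, h1, h2, -, h4⟩ := htr s; exact ⟨θ, h0, h1, h2, h4⟩) hsc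
  obtain ⟨h, hh⟩ := exists_values_of_invariant (u := y) (v := x) (w := ς) (z := z) (k := k) (N := N)
    (by rw [Set.insert_comm]; exact hy z)
    (fun s => by obtain ⟨θ, h0, h1, -, h3, h4⟩ := htr s; exact ⟨θ, h1, h0, h3, h4⟩)
    (fun c hc => by obtain ⟨θ, h0, h1, h2⟩ := hsc c hc; exact ⟨θ, h1, h0, h2⟩)
  have hdeg : g.natDegree ≤ N := natDegree_le_of_eval_eq (h := h) fun t ht => by
    obtain ⟨φ, h0, h1, -⟩ := points 1 t 0 one_ne_zero
    have e1 := hg φ (by simp [h0])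
    have e2 := hh φ (by simpa [h1] using ht)
    rw [h0, h1] at e1 e2
    rw [e1] at e2
    simpa using e2
  refine ⟨g, hdeg, ?_⟩
  -- The points with x ≠ 0 are dense: a function vanishing at all of them is zero.
  have key : ∀ w : A, (∀ φ : A →ₐ[ℂ] ℂ, φ x ≠ 0 → φ w = 0) → w = 0 := by
    intro w hw
    obtain ⟨K, hK⟩ := hx w
    obtain ⟨p, hp⟩ := exists_aeval_eq hK
    have hp0 : p * MvPolynomial.X 0 = 0 := by
      refine MvPolynomial.funext fun v => ?_
      rw [map_mul, MvPolynomial.eval_X, map_zero]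
      by_cases hv : v 0 = 0
      · rw [hv, mul_zero]
      obtain ⟨φ, h0, h1, h2⟩ := points (v 0) (v 1) (v 2) hv
      have := congrArg φ hp
      rw [map_mul, hw φ (by rwa [h0]), mul_zero, ← AlgHom.comp_apply,
        MvPolynomial.comp_aeval] at this
      have hv' : (fun i => φ (![x, y, τ] i)) = v := by
        funext i
        fin_cases i
        exacts [h0, h1, h2]
      rw [hv'] at this
      rw [← MvPolynomial.aeval_eq_eval, ← this, zero_mul]
    have hp1 := (mul_eq_zero.mp hp0).resolve_right (MvPolynomial.X_ne_zero 0)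
    rw [hp1, map_zero] at hp
    clear hK
    induction K with
    | zero => simpa using hp
    | succ K ih => exact ih (regular _ (by rw [← hp]; ring))
  rw [← sub_eq_zero]
  refine key _ fun φ hφ => ?_
  rw [map_sub, map_form, form_eq_pow_mul_aeval hdeg hφ, hg φ hφ, coe_aeval_eq_eval, sub_self]

/-- A form without the monomials that are divisible by neither `x ^ k` nor `y ^ k`. -/
lemma exists_form_eq_add {d : ℕ} (hd : d ≤ k) (h1 : 1 ≤ d) (Γ : ℂ[X])
    (h : ∀ i, k < i + d → i < k → Γ.coeff i = 0) (x y : A) :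
    ∃ p q : ℂ[X], form (2 * k - d) Γ x y =
      x ^ k * form (k - d) p x y + y ^ k * form (k - d) q x y := by
  -- `form (k - d)` ignores the coefficients above k - d, so Γ itself can serve as p.
  refine ⟨Γ, divX^[k] Γ, ?_⟩
  simp only [form, coeff_iterate_divX, Finset.mul_sum]
  rw [show 2 * k - d + 1 = k + (k - d + 1) by omega, Finset.sum_range_add]
  congr 1
  · rw [← Finset.sum_subset (Finset.range_subset_range.mpr (show k - d + 1 ≤ k by omega))]
    · refine Finset.sum_congr rfl fun i hi => ?_
      rw [Finset.mem_range] at hi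
      rw [show 2 * k - d - i = k + (k - d - i) by omega, pow_add]
      ring
    · intro i hi hi'
      rw [Finset.mem_range] at hi hi'
      rw [h i (by omega) hi, map_zero, zero_mul, zero_mul]
  · refine Finset.sum_congr rfl fun i hi => ?_
    rw [Finset.mem_range] at hi
    rw [show 2 * k - d - (k + i) = k - d - i by omega, pow_add]
    ring

end Invariants

/-! ### Functions as complex algebras, and the complex point. -/

section Functions
variable {T T' X : CScheme}

/-- Functions on a complex scheme form a complex algebra. -/
instance algebraFunctions (T : CScheme) : Algebra ℂ Γ(T.left, ⊤) :=
  ((Scheme.ΓSpecIso (CommRingCat.of ℂ)).inv ≫ T.hom.appTop).hom.toAlgebra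

lemma algebraMap_functions (c : ℂ) : algebraMap ℂ Γ(T.left, ⊤) c =
    T.hom.appTop ((Scheme.ΓSpecIso (CommRingCat.of ℂ)).inv c) := rfl

/-- The pullback of functions as a homomorphism of complex algebras. -/
def appTopAlgHom (p : T ⟶ X) : Γ(X.left, ⊤) →ₐ[ℂ] Γ(T.left, ⊤) where
  __ := p.left.appTop.hom
  commutes' c := by
    change p.left.appTop (algebraMap ℂ Γ(X.left, ⊤) c) = _
    rw [algebraMap_functions, algebraMap_functions, ← Over.w p, Scheme.Hom.comp_appTop,
      ConcreteCategory.comp_apply]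

lemma appTopAlgHom_apply (p : T ⟶ X) (a : Γ(X.left, ⊤)) : appTopAlgHom p a = p.left.appTop a := rfl

/-- The spectrum of the complex numbers as a complex scheme. -/
def complexPoint : CScheme := Over.mk (𝟙 (Spec (CommRingCat.of ℂ)))

/-- The functions on the complex point are the complex numbers. -/
def complexPointEval : Γ(complexPoint.left, ⊤) →ₐ[ℂ] ℂ where
  __ := (Scheme.ΓSpecIso (CommRingCat.of ℂ)).hom.hom
  commutes' c := by
    change (Scheme.ΓSpecIso (CommRingCat.of ℂ)).hom (algebraMap ℂ Γ(complexPoint.left, ⊤) c) = _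
    rw [algebraMap_functions]
    change ((Scheme.ΓSpecIso (CommRingCat.of ℂ)).inv ≫
      (𝟙 (Spec (CommRingCat.of ℂ)) : Spec (CommRingCat.of ℂ) ⟶ _).appTop ≫
        (Scheme.ΓSpecIso (CommRingCat.of ℂ)).hom) c = c
    simp

instance : Subsingleton complexPoint.left :=
  inferInstanceAs (Subsingleton (PrimeSpectrum ℂ))

instance : Nonempty complexPoint.left :=
  inferInstanceAs (Nonempty (PrimeSpectrum ℂ))

end Functions

/-! ### Functions on the punctured plane and on the total space. -/

/-- A point of the punctured plane with prescribed coordinates. -/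
lemma exists_coords_eq {T : CScheme} (v : Fin 2 → Γ(T.left, ⊤)) (h : IsUnit (v 0)) :
    ∃ b : T ⟶ puncturedPlane, ∀ i, coords b i = v i := by
  have hr : Set.range (AffineSpace.homOfVector T.hom v) ⊆ Set.range incl := by
    rw [range_incl]
    rintro _ ⟨t, rfl⟩
    change t ∈ AffineSpace.homOfVector T.hom v ⁻¹ᵁ puncturedOpen
    rw [preimage_puncturedOpen, AffineSpace.homOfVector_appTop_coord,
      Scheme.basicOpen_of_isUnit _ h, top_sup_eq]
    trivial
  refine ⟨Over.homMk (IsOpenImmersion.lift incl (AffineSpace.homOfVector T.hom v) hr)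
    (by rw [← incl_over, IsOpenImmersion.lift_fac_assoc, AffineSpace.homOfVector_over]),
      fun i => ?_⟩
  simp only [coords, Over.homMk_left, IsOpenImmersion.lift_fac]
  exact AffineSpace.homOfVector_appTop_coord _ _ _

lemma coord_basicOpen_le (i : Fin 2) :
    plane.basicOpen (AffineSpace.coord _ i) ≤ puncturedOpen := by
  fin_cases i
  · exact le_sup_left
  · exact le_sup_right

lemma isIso_incl_restrict {O : plane.Opens} (hO : O ≤ puncturedOpen) : IsIso (incl ∣_ O) := by
  have h1 : Set.range O.ι ⊆ Set.range incl := by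
    rw [range_incl, Scheme.Opens.range_ι]
    exact hO
  have hpb := isPullback_morphismRestrict incl O
  have : IsSplitEpi (incl ∣_ O) :=
    ⟨⟨hpb.lift (𝟙 _) (IsOpenImmersion.lift incl O.ι h1) (by simp), hpb.lift_fst _ _ _⟩⟩
  exact isIso_of_mono_of_isSplitEpi _

lemma isAffine_locus (i : Fin 2) : IsAffine (locus (AffineSpace.coord _ i)).toScheme := by
  have := isIso_incl_restrict (coord_basicOpen_le i)
  have : IsAffine (plane.basicOpen (AffineSpace.coord _ i)).toScheme :=
    (isAffineOpen_top plane).basicOpen _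
  have key : IsAffine (incl ⁻¹ᵁ plane.basicOpen (AffineSpace.coord _ i)).toScheme :=
    IsAffine.of_isIso (incl ∣_ plane.basicOpen (AffineSpace.coord _ i))
  exact key

lemma appTop_iso_hom_surjective {Z Z' : Scheme.{0}} (e : Z ≅ Z') :
    Function.Surjective e.hom.appTop := fun z =>
  ⟨e.inv.appTop z, by
    rw [← ConcreteCategory.comp_apply, ← Scheme.Hom.comp_appTop, e.hom_inv_id]
    simp⟩

lemma exists_eval₂_eq {n : Type} {S : Scheme.{0}} [IsAffine S] (z : Γ(𝔸(n; S), ⊤)) :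
    ∃ P : MvPolynomial n Γ(S, ⊤),
      MvPolynomial.eval₂ (𝔸(n; S) ↘ S).appTop.hom (AffineSpace.coord S) P = z := by
  have hb := appTop_iso_hom_surjective (AffineSpace.isoOfIsAffine n S) z
  rw [AffineSpace.isoOfIsAffine_hom_appTop] at hb
  obtain ⟨P, hP⟩ := hb
  exact ⟨_, hP⟩

/-- Functions on the plane are polynomials in the coordinates. -/
lemma exists_eval₂_plane (z : Γ(plane, ⊤)) : ∃ P : MvPolynomial (Fin 2) ℂ,
    MvPolynomial.eval₂ ((Scheme.ΓSpecIso (CommRingCat.of ℂ)).inv ≫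
      (plane ↘ Spec (CommRingCat.of ℂ)).appTop).hom (AffineSpace.coord _) P = z := by
  have hb := appTop_iso_hom_surjective (AffineSpace.SpecIso (Fin 2) (CommRingCat.of ℂ)) z
  rw [AffineSpace.SpecIso_hom_appTop] at hb
  obtain ⟨P, hP⟩ := hb
  exact ⟨_, hP⟩

instance : Nonempty puncturedPlane.left := by
  obtain ⟨b, -⟩ := exists_coords_eq (T := complexPoint) ![1, 1] isUnit_one
  exact ⟨b.left (Classical.arbitrary _)⟩

instance : IsIntegral puncturedPlane.left := isIntegral_of_isOpenImmersion incl

lemma nonempty_locus (i : Fin 2) :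
    (locus (AffineSpace.coord _ i) : Set puncturedPlane.left).Nonempty := by
  obtain ⟨b, hb⟩ := exists_coords_eq (T := complexPoint) ![1, 1] isUnit_one
  refine ⟨b.left (Classical.arbitrary _), ?_⟩
  change _ ∈ (b.left ≫ incl) ⁻¹ᵁ plane.basicOpen (AffineSpace.coord _ i)
  rw [Scheme.preimage_basicOpen_top]
  change _ ∈ complexPoint.left.basicOpen (coords b i)
  rw [hb, Scheme.basicOpen_of_isUnit _ (by fin_cases i <;> exact isUnit_one)]
  trivial

namespace GaBundle
variable {B : GaBundle} {μ : GmAction B.X} {d : ℕ} {T : CScheme}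

variable (B) in
/-- The coordinates of the punctured plane as functions on the total space. -/
def coordFun (i : Fin 2) : Γ(B.X.left, ⊤) := B.pullbackHom (AffineSpace.coord _ i)

lemma pullbackHom_algebraMap (c : ℂ) :
    B.pullbackHom (((Scheme.ΓSpecIso (CommRingCat.of ℂ)).inv ≫
      (plane ↘ Spec (CommRingCat.of ℂ)).appTop) c) = algebraMap ℂ _ c := by
  rw [algebraMap_functions, ← Over.w B.ρ, ← incl_over, Scheme.Hom.comp_appTop,
    Scheme.Hom.comp_appTop, pullbackHom, Scheme.Hom.comp_appTop]
  rfl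

lemma pullbackHom_mem_adjoin (f : Γ(plane, ⊤)) :
    B.pullbackHom f ∈ Algebra.adjoin ℂ {B.coordFun 0, B.coordFun 1} := by
  obtain ⟨P, rfl⟩ := exists_eval₂_plane f
  induction P using MvPolynomial.induction_on with
  | C c =>
    rw [MvPolynomial.eval₂_C]
    exact (pullbackHom_algebraMap (B := B) c).symm ▸ Subalgebra.algebraMap_mem _ c
  | add p q hp hq =>
    rw [MvPolynomial.eval₂_add, map_add]
    exact add_mem hp hq
  | mul_X p i hp =>
    rw [MvPolynomial.eval₂_mul, MvPolynomial.eval₂_X, map_mul]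
    refine mul_mem hp (Algebra.subset_adjoin ?_)
    fin_cases i
    · exact Or.inl rfl
    · exact Or.inr rfl

/-- Over a trivializing open U the total space is integral, and the coordinate is nonzero there
because U meets the locus where it is invertible, the base being irreducible. -/
lemma IsHomogeneousLift.coordFun_regular (h : B.IsHomogeneousLift μ d) (i : Fin 2)
    (a : Γ(B.X.left, ⊤)) (ha : B.coordFun i * a = 0) : a = 0 := by
  refine section_ext fun s => ?_
  obtain ⟨U, hs, -, -, τ, -⟩ := h.cover (B.ρ.left s)
  refine ⟨B.ρ.left ⁻¹ᵁ U, hs, ?_⟩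
  have : Nonempty U.toScheme := ⟨⟨_, hs⟩⟩
  have : Nonempty (B.part U) := ⟨⟨s, hs⟩⟩
  have : IsIntegral (B.part U) := isIntegral_of_isOpenImmersion τ.iso.hom
  have h0 := congrArg (B.partι U).appTop ha
  rw [map_mul, map_zero, mul_eq_zero] at h0
  rw [map_zero]
  refine h0.resolve_left fun h0 => ?_
  obtain ⟨w, hwU, hwx⟩ := nonempty_preirreducible_inter (s := (U : Set puncturedPlane.left))
    U.2 (locus (AffineSpace.coord _ i)).2 ⟨_, hs⟩ (nonempty_locus i)
  have hsurj : Function.Surjective (B.ρ.left ∣_ U) := by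
    rw [← τ.iso_over]
    exact Scheme.Hom.surjective _
  obtain ⟨z, hz⟩ := hsurj ⟨w, hwU⟩
  have hz1 : B.ρ.left (B.partι U z) = w := by
    rw [← Scheme.Hom.comp_apply, ← morphismRestrict_ι, Scheme.Hom.comp_apply, hz]
    rfl
  have hz2 : z ∈ B.partι U ⁻¹ᵁ B.X.left.basicOpen (B.coordFun i) := by
    rw [coordFun, ← preimage_locus]
    change B.ρ.left (B.partι U z) ∈ locus _
    rw [hz1]
    exact hwx
  rw [Scheme.preimage_basicOpen_top, h0, Scheme.basicOpen_zero] at hz2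
  exact hz2

end GaBundle

/-- By `h` the sections α_i / f_i^j agree on the overlaps. -/
lemma exists_glue {Z : Scheme.{0}} {f : Fin 2 → Γ(Z, ⊤)} (hf : ∀ s : Z, ∃ i, s ∈ Z.basicOpen (f i))
    (j : ℕ) (α : Fin 2 → Γ(Z, ⊤)) (h : ∀ i l, f l ^ j * α i = f i ^ j * α l) :
    ∃ a, ∀ i, α i = f i ^ j * a := by
  let res (i : Fin 2) : Γ(Z, ⊤) ⟶ Γ(Z, Z.basicOpen (f i)) :=
    Z.presheaf.map (homOfLE (le_top : Z.basicOpen (f i) ≤ ⊤)).op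
  have hu (i : Fin 2) : IsUnit (res i (f i)) := RingedSpace.isUnit_res_basicOpen _ (f i)
  choose v hv using fun i => (hu i).exists_right_inv
  have hv' (i : Fin 2) : res i (f i) ^ j * v i ^ j = 1 := by rw [← mul_pow, hv, one_pow]
  have hcov : (⊤ : Z.Opens) ≤ ⨆ i, Z.basicOpen (f i) := by
    intro s _
    rw [TopologicalSpace.Opens.mem_iSup]
    exact hf s
  obtain ⟨a, ha⟩ : ∃ a : Γ(Z, ⊤), ∀ i, res i a = v i ^ j * res i (α i) := by
    refine (Z.sheaf.existsUnique_gluing' (fun i => Z.basicOpen (f i)) ⊤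
      (fun i => homOfLE le_top) hcov (fun i => v i ^ j * res i (α i)) ?_).exists
    · intro i l
      let W := Z.basicOpen (f i) ⊓ Z.basicOpen (f l)
      let r₁ : Γ(Z, Z.basicOpen (f i)) ⟶ Γ(Z, W) := Z.presheaf.map (homOfLE inf_le_left).op
      let r₂ : Γ(Z, Z.basicOpen (f l)) ⟶ Γ(Z, W) := Z.presheaf.map (homOfLE inf_le_right).op
      let r : Γ(Z, ⊤) ⟶ Γ(Z, W) := Z.presheaf.map (homOfLE le_top).op
      have e₁ (z : Γ(Z, ⊤)) : r₁ (res i z) = r z :=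
        ConcreteCategory.congr_hom (Z.presheaf.map_comp _ _).symm z
      have e₂ (z : Γ(Z, ⊤)) : r₂ (res l z) = r z :=
        ConcreteCategory.congr_hom (Z.presheaf.map_comp _ _).symm z
      change r₁ (v i ^ j * res i (α i)) = r₂ (v l ^ j * res l (α l))
      have h1 := congrArg r₁ (hv' i)
      have h2 := congrArg r₂ (hv' l)
      have h3 := congrArg r (h i l)
      simp only [map_mul, map_pow, map_one, e₁, e₂] at h1 h2 h3 ⊢
      linear_combination (-(r₁ (v i) ^ j * r (α i))) * h2 + (r₂ (v l) ^ j * r (α l)) * h1 +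
        (r₁ (v i) ^ j * r₂ (v l) ^ j) * h3
  refine ⟨a, fun i => ?_⟩
  refine Z.sheaf.eq_of_locally_eq' (fun i => Z.basicOpen (f i)) ⊤ (fun i => homOfLE le_top)
    hcov _ _ fun l => ?_
  change res l (α i) = res l (f i ^ j * a)
  have h1 := congrArg (res l) (h i l)
  have h2 := hv' l
  simp only [map_mul, map_pow] at h1 ⊢
  rw [ha]
  linear_combination (v l ^ j) * h1 - res l (α i) * h2

namespace GaBundle
variable {B : GaBundle} {μ : GmAction B.X} {d : ℕ} {T : CScheme}

lemma HasSlope.exists_isEquivariant {i : Fin 2} {k : ℕ} {e : Γ(B.X.left, ⊤)}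
    (he : HasSlope e (B.coordFun i ^ k)) :
    ∃ t : Γ(B.part (locus (AffineSpace.coord _ i)), ⊤), IsEquivariant t ∧
      (B.partι _).appTop e = (B.partι _).appTop (B.coordFun i) ^ k * t := by
  obtain ⟨v, hv⟩ := (isUnit_appTop_basicOpen (B.coordFun i) (B.preimage_locus _)).exists_right_inv
  have ht : (B.partι _).appTop e = (B.partι _).appTop (B.coordFun i) ^ k *
      (v ^ k * (B.partι (locus (AffineSpace.coord _ i))).appTop e) := by
    rw [← mul_assoc, ← mul_pow, hv, one_pow, one_mul]
  refine ⟨v ^ k * (B.partι _).appTop e, ?_, ht⟩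
  intro T a p q q' hq hq'
  generalize v ^ k * (B.partι _).appTop e = t at ht
  have h2 : ∀ {p : T ⟶ B.X} {q : T.left ⟶ B.part (locus (AffineSpace.coord _ i))},
      q ≫ B.partι _ = p.left →
        p.left.appTop e = p.left.appTop (B.coordFun i) ^ k * q.appTop t := by
    intro p q h
    rw [← h, Scheme.Hom.comp_appTop, ConcreteCategory.comp_apply, ConcreteCategory.comp_apply, ht,
      map_mul, map_pow]
  have h3 := h2 hq'
  rw [he, h2 hq, coordFun, pullbackHom_act, map_pow, ← mul_add] at h3
  exact ((isUnit_coord_of_lift i hq).pow k).mul_left_cancel h3.symm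

lemma exists_appTop_restrict (i : Fin 2)
    (g : Γ((locus (AffineSpace.coord _ i)).toScheme, ⊤)) :
    ∃ (n : ℕ) (G : Γ(plane, ⊤)), (B.partι _).appTop (B.pullbackHom G) =
      (B.partι _).appTop (B.coordFun i) ^ n *
        (B.ρ.left ∣_ (locus (AffineSpace.coord _ i))).appTop g := by
  set O := plane.basicOpen (AffineSpace.coord _ i)
  let r : (locus (AffineSpace.coord _ i)).toScheme ⟶ O.toScheme := incl ∣_ O
  have hr : r ≫ O.ι = (locus (AffineSpace.coord _ i)).ι ≫ incl := morphismRestrict_ι _ _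
  have : IsIso r := isIso_incl_restrict (coord_basicOpen_le i)
  obtain ⟨g, rfl⟩ := appTop_iso_hom_surjective (asIso r) g
  obtain ⟨n, G, hG⟩ := exists_appTop_eq_pow_mul (AffineSpace.coord _ i) (O := O) rfl g
  refine ⟨n, G, ?_⟩
  have key : ∀ z : Γ(plane, ⊤), (B.partι _).appTop (B.pullbackHom z) =
      (B.ρ.left ∣_ (locus (AffineSpace.coord _ i))).appTop (r.appTop (O.ι.appTop z)) := by
    intro z
    have h1 : B.partι _ ≫ B.ρ.left ≫ incl =
        (B.ρ.left ∣_ (locus (AffineSpace.coord _ i))) ≫ r ≫ O.ι := by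
      rw [hr, morphismRestrict_ι_assoc]
    have h2 := congrArg (fun m => Scheme.Hom.appTop m z) h1
    simp only [Scheme.Hom.comp_appTop, ConcreteCategory.comp_apply] at h2
    rw [← h2, pullbackHom, Scheme.Hom.comp_appTop]
    rfl
  rw [key, coordFun, key, hG, map_mul, map_mul, map_pow, map_pow, asIso_hom]

/-- Where the coordinate f is invertible, the total space is a product with 𝔸¹ with fibre coordinate
e/f^k; its functions are polynomials in e/f^k whose coefficients come from the plane up to powers of
f. -/
lemma HasSlope.exists_mem_adjoin [CompactSpace B.X.left] {i : Fin 2} {k : ℕ} {e : Γ(B.X.left, ⊤)}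
    (he : HasSlope e (B.coordFun i ^ k)) (w : Γ(B.X.left, ⊤)) :
    ∃ K : ℕ, B.coordFun i ^ K * w ∈ Algebra.adjoin ℂ {B.coordFun 0, B.coordFun 1, e} := by
  obtain ⟨t, ht, het⟩ := he.exists_isEquivariant
  have := ht.isIso_toAffineSpace
  have : IsAffine (locus (AffineSpace.coord _ i)).toScheme := isAffine_locus i
  have hle : Algebra.adjoin ℂ {B.coordFun 0, B.coordFun 1} ≤
      Algebra.adjoin ℂ {B.coordFun 0, B.coordFun 1, e} :=
    Algebra.adjoin_mono (by
      rintro a (rfl | rfl)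
      · exact Or.inl rfl
      · exact Or.inr (Or.inl rfl))
  set S := Algebra.adjoin ℂ {B.coordFun 0, B.coordFun 1, e}
  have hxS : B.coordFun i ∈ S := hle (pullbackHom_mem_adjoin _)
  set u := (B.partι (locus (AffineSpace.coord _ i))).appTop (B.coordFun i)
  have key : ∀ P : MvPolynomial (Fin 1) Γ((locus (AffineSpace.coord _ i)).toScheme, ⊤),
      ∃ (K : ℕ) (w' : Γ(B.X.left, ⊤)), w' ∈ S ∧
        (B.partι _).appTop w' = u ^ K * (toAffineSpace t).appTop (MvPolynomial.eval₂
          (𝔸(Fin 1; (locus (AffineSpace.coord _ i)).toScheme) ↘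
            (locus (AffineSpace.coord _ i)).toScheme).appTop.hom (AffineSpace.coord _) P) := by
    intro P
    induction P using MvPolynomial.induction_on with
    | C g =>
      obtain ⟨n, G, hG⟩ := exists_appTop_restrict (B := B) i g
      refine ⟨n, B.pullbackHom G, hle (pullbackHom_mem_adjoin _), ?_⟩
      rw [hG, MvPolynomial.eval₂_C, ← toAffineSpace_over t, Scheme.Hom.comp_appTop]
      rfl
    | add p q hp hq =>
      obtain ⟨K, a, ha, hKa⟩ := hp
      obtain ⟨L, b, hb, hLb⟩ := hq
      refine ⟨K + L, B.coordFun i ^ L * a + B.coordFun i ^ K * b,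
        add_mem (mul_mem (pow_mem hxS _) ha) (mul_mem (pow_mem hxS _) hb), ?_⟩
      rw [map_add, map_mul, map_mul, map_pow, map_pow, hKa, hLb, MvPolynomial.eval₂_add, map_add]
      ring
    | mul_X p j hp =>
      obtain ⟨K, a, ha, hKa⟩ := hp
      refine ⟨K + k, a * e, mul_mem ha (Algebra.subset_adjoin (Or.inr (Or.inr rfl))), ?_⟩
      rw [map_mul, hKa, MvPolynomial.eval₂_mul, MvPolynomial.eval₂_X, map_mul,
        Subsingleton.elim j 0, toAffineSpace_coord, het]
      ring
  obtain ⟨z, hz⟩ := appTop_iso_hom_surjective (asIso (toAffineSpace t)) ((B.partι _).appTop w)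
  obtain ⟨P, rfl⟩ := exists_eval₂_eq z
  obtain ⟨K, w', hw', h1⟩ := key P
  rw [asIso_hom] at hz
  rw [hz] at h1
  obtain ⟨n, hn⟩ := exists_pow_mul_eq_zero (B.coordFun i) (B.preimage_locus _)
    (w' - B.coordFun i ^ K * w) (by rw [map_sub, map_mul, map_pow, h1, sub_self])
  refine ⟨n + K, ?_⟩
  rw [show B.coordFun i ^ (n + K) * w = B.coordFun i ^ n * w' by linear_combination -hn]
  exact mul_mem (pow_mem hxS _) hw'

/-- A complex point over (a, b) can be translated to give e any value, because the slope a^k is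
nonzero. -/
lemma HasSlope.exists_algHom {k : ℕ} {e : Γ(B.X.left, ⊤)} (he : HasSlope e (B.coordFun 0 ^ k))
    (a b c : ℂ) (ha : a ≠ 0) : ∃ φ : Γ(B.X.left, ⊤) →ₐ[ℂ] ℂ,
      φ (B.coordFun 0) = a ∧ φ (B.coordFun 1) = b ∧ φ e = c := by
  have hu : IsUnit (algebraMap ℂ Γ(complexPoint.left, ⊤) a) := (IsUnit.mk0 a ha).map _
  obtain ⟨p, hp⟩ := exists_coords_eq (T := complexPoint)
    ![algebraMap ℂ _ a, algebraMap ℂ _ b] hu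
  obtain ⟨U, hs, ⟨τ⟩⟩ := B.locallyTrivial (p.left (Classical.arbitrary _))
  obtain ⟨q, hq⟩ := exists_point_over τ p fun s => by
    rw [Subsingleton.elim s (Classical.arbitrary _)]
    exact hs
  let s : ℂ := (c - complexPointEval (q.left.appTop e)) / a ^ k
  let q' := B.action.act (algebraMap ℂ _ s) q
  have hq' : ∀ i, q'.left.appTop (B.coordFun i) = coords p i := fun i => by
    rw [coordFun, appTop_coord, B.invariant, hq]
  have hq0 : q.left.appTop (B.coordFun 0) = algebraMap ℂ _ a := by
    rw [coordFun, appTop_coord, hq, hp]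
    rfl
  refine ⟨complexPointEval.comp (appTopAlgHom q'), ?_, ?_, ?_⟩
  · rw [AlgHom.comp_apply, appTopAlgHom_apply, hq', hp]
    exact AlgHom.commutes _ _
  · rw [AlgHom.comp_apply, appTopAlgHom_apply, hq', hp]
    exact AlgHom.commutes _ _
  · rw [AlgHom.comp_apply, appTopAlgHom_apply, he, map_add, map_mul, AlgHom.commutes, map_pow, hq0,
      map_pow, AlgHom.commutes]
    change _ + a ^ k * s = c
    rw [mul_div_cancel₀ _ (pow_ne_zero k ha)]
    ring

end GaBundle

/-! ### Calculus of weights. -/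

section Weights
variable {X : CScheme} {μ : GmAction X} {a b : Γ(X.left, ⊤)} {v w : ℤ}

lemma HasGmWeight.mul (ha : HasGmWeight μ a v) (hb : HasGmWeight μ b w) :
    HasGmWeight μ (a * b) (v + w) := by
  intro T c p
  rw [map_mul, map_mul, ha, hb, zpow_add, Units.val_mul]
  ring

lemma HasGmWeight.one : HasGmWeight μ 1 0 := by
  intro T c p
  simp

lemma HasGmWeight.pow (ha : HasGmWeight μ a v) (n : ℕ) : HasGmWeight μ (a ^ n) (n * v) := by
  induction n with
  | zero => simpa using HasGmWeight.one
  | succ n ih =>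
    rw [pow_succ, Nat.cast_succ, add_mul, one_mul]
    exact ih.mul ha

lemma HasGmWeight.add (ha : HasGmWeight μ a w) (hb : HasGmWeight μ b w) :
    HasGmWeight μ (a + b) w := by
  intro T c p
  rw [map_add, map_add, ha, hb, mul_add]

lemma HasGmWeight.sub (ha : HasGmWeight μ a w) (hb : HasGmWeight μ b w) :
    HasGmWeight μ (a - b) w := by
  intro T c p
  rw [map_sub, map_sub, ha, hb, mul_sub]

/-- A nonzero complex number as an invertible function. -/
def constUnit (T : CScheme) (c : ℂˣ) : Γ(T.left, ⊤)ˣ :=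
  Units.map (algebraMap ℂ Γ(T.left, ⊤) : ℂ →* Γ(T.left, ⊤)) c

lemma constUnit_zpow (T : CScheme) (c : ℂˣ) (w : ℤ) :
    ((constUnit T c ^ w : Γ(T.left, ⊤)ˣ) : Γ(T.left, ⊤)) =
      algebraMap ℂ Γ(T.left, ⊤) ((c ^ w : ℂˣ) : ℂ) := by
  rw [constUnit, ← map_zpow]
  rfl

lemma id_appTop : (𝟙 X : X ⟶ X).left.appTop a = a := by
  rw [Over.id_left, Scheme.Hom.id_appTop]
  rfl

/-- The action of a nonzero complex number on functions. -/
def constAct (μ : GmAction X) (c : ℂˣ) : Γ(X.left, ⊤) →ₐ[ℂ] Γ(X.left, ⊤) :=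
  appTopAlgHom (μ.act (constUnit X c) (𝟙 X))

lemma HasGmWeight.constAct (ha : HasGmWeight μ a w) (c : ℂˣ) :
    constAct μ c a = ((c ^ w : ℂˣ) : ℂ) • a := by
  rw [PuncturedPlane.constAct, appTopAlgHom_apply, ha, id_appTop, constUnit_zpow, Algebra.smul_def]

end Weights

/-! ### The functions on a homogeneous bundle form a torsor ring. -/

namespace GaBundle
variable {B : GaBundle} {μ : GmAction B.X} {d : ℕ} {T : CScheme}

lemma IsHomogeneousLift.hasGmWeight_coordFun (h : B.IsHomogeneousLift μ d) (i : Fin 2) :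
    HasGmWeight μ (B.coordFun i) 1 :=
  h.hasGmWeight_coord i

lemma exists_mem_basicOpen_coordFun (s : B.X.left) :
    ∃ i, s ∈ B.X.left.basicOpen (B.coordFun i) := by
  have h : s ∈ (B.ρ.left ≫ incl) ⁻¹ᵁ puncturedOpen := by
    change (B.ρ.left ≫ incl) s ∈ (puncturedOpen : Set plane)
    rw [← range_incl, Scheme.Hom.comp_apply]
    exact ⟨_, rfl⟩
  rw [preimage_puncturedOpen] at h
  rcases h with h | h
  · exact ⟨0, h⟩
  · exact ⟨1, h⟩

lemma coordFun_glue (j : ℕ) (α β : Γ(B.X.left, ⊤))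
    (h : B.coordFun 1 ^ j * α = B.coordFun 0 ^ j * β) :
    ∃ a, α = B.coordFun 0 ^ j * a ∧ β = B.coordFun 1 ^ j * a := by
  obtain ⟨a, ha⟩ := exists_glue B.exists_mem_basicOpen_coordFun j ![α, β] (by
    intro i l
    fin_cases i <;> fin_cases l
    exacts [rfl, h, h.symm, rfl])
  exact ⟨a, ha 0, ha 1⟩

/-- The translation by a complex number, on functions. -/
def constTranslate (B : GaBundle) (s : ℂ) : Γ(B.X.left, ⊤) →ₐ[ℂ] Γ(B.X.left, ⊤) :=
  appTopAlgHom (B.action.act (algebraMap ℂ _ s) (𝟙 B.X))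

lemma constTranslate_coordFun (s : ℂ) (i : Fin 2) :
    B.constTranslate s (B.coordFun i) = B.coordFun i := by
  rw [constTranslate, appTopAlgHom_apply, coordFun, pullbackHom_act, id_appTop]

lemma HasSlope.constTranslate {e r : Γ(B.X.left, ⊤)} (h : HasSlope e r) (s : ℂ) :
    B.constTranslate s e = e + s • r := by
  rw [GaBundle.constTranslate, appTopAlgHom_apply, h, id_appTop, id_appTop, Algebra.smul_def,
    mul_comm]

lemma form_coordFun_act (a : Γ(T.left, ⊤)) (p : T ⟶ B.X) (N : ℕ) (g : Polynomial ℂ) :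
    (B.action.act a p).left.appTop (form N g (B.coordFun 0) (B.coordFun 1)) =
      p.left.appTop (form N g (B.coordFun 0) (B.coordFun 1)) := by
  rw [← appTopAlgHom_apply, ← appTopAlgHom_apply, map_form, map_form]
  simp only [appTopAlgHom_apply, coordFun, pullbackHom_act]

/-- A function of slope one trivializes the bundle. -/
lemma HasSlope.isTrivial {a : Γ(B.X.left, ⊤)} (h : HasSlope a 1) : B.IsTrivial := by
  have ht : IsEquivariant (V := ⊤) ((B.partι ⊤).appTop a) := by
    intro T b p q q' hq hq'
    rw [← ConcreteCategory.comp_apply, ← ConcreteCategory.comp_apply, ← Scheme.Hom.comp_appTop,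
      ← Scheme.Hom.comp_appTop, hq, hq', h, map_one, one_mul]
  exact ⟨ht.trivialization⟩

lemma hasSlope_one_of_mul {k : ℕ} {a : Γ(B.X.left, ⊤)}
    (h : ∀ i, HasSlope (B.coordFun i ^ k * a) (B.coordFun i ^ k)) : HasSlope a 1 := by
  intro T b p
  refine section_ext fun s => ?_
  obtain ⟨i, hi⟩ := B.exists_mem_basicOpen_coordFun (p.left s)
  change s ∈ p.left ⁻¹ᵁ B.X.left.basicOpen (B.coordFun i) at hi
  rw [Scheme.preimage_basicOpen_top] at hi
  refine ⟨_, hi, ((isUnit_appTop_basicOpen (p.left.appTop (B.coordFun i)) rfl).pow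
    k).mul_left_cancel ?_⟩
  rw [← map_pow, ← map_mul, ← map_mul]
  congr 1
  have h1 := h i b p
  simp only [map_mul, map_pow, map_one, coordFun, pullbackHom_act] at h1 ⊢
  rw [h1]
  ring

/-- The functions on the total space of a homogeneous bundle. -/
theorem IsHomogeneousWith.exists_isTorsorRing (h : B.IsHomogeneousWith μ d) :
    ∃ (τ ς : Γ(B.X.left, ⊤)) (k : ℕ) (g : Polynomial ℂ),
      IsTorsorRing (B.coordFun 0) (B.coordFun 1) τ ς k d g ∧ HasGmWeight μ τ (k - d) := by
  have := h.isLift.compactSpace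
  have key (i : Fin 2) : ∃ k₀ : ℕ, ∀ k, k₀ ≤ k → ∃ e, HasSlope e (B.coordFun i ^ k) ∧
      HasGmWeight μ e (k - d) := by
    obtain ⟨k₀, e₀, h1, h2⟩ := h.isLift.exists_hasSlope_hasGmWeight i
    refine ⟨k₀, fun k hk => ?_⟩
    obtain ⟨n, rfl⟩ := Nat.exists_eq_add_of_le' hk
    refine ⟨B.coordFun i ^ n * e₀, ?_, ?_⟩
    · have := h1.pullback_mul (AffineSpace.coord _ i ^ n)
      rwa [map_pow, ← pow_add] at this
    · have := ((h.isLift.hasGmWeight_coordFun i).pow n).mul h2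
      convert this using 1
      push_cast
      ring
  obtain ⟨k₀, h0⟩ := key 0
  obtain ⟨k₁, h1⟩ := key 1
  -- One exponent for both charts; the summand d secures d ≤ k.
  obtain ⟨k, hk⟩ : ∃ k, k = k₀ + k₁ + d := ⟨_, rfl⟩
  obtain ⟨τ, hτ, hτw⟩ := h0 k (by omega)
  obtain ⟨ς, hς, hςw⟩ := h1 k (by omega)
  have hzw : HasGmWeight μ (B.coordFun 0 ^ k * ς - B.coordFun 1 ^ k * τ)
      (((2 * k - d : ℕ) : ℤ)) := by
    have e0 := ((h.isLift.hasGmWeight_coordFun 0).pow k).mul hςw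
    have e1 := ((h.isLift.hasGmWeight_coordFun 1).pow k).mul hτw
    convert e0.sub e1 using 1
    push_cast [show d ≤ 2 * k by omega]
    ring
  obtain ⟨g, hg, hz⟩ := exists_eq_form_of_invariant (k := k) (N := 2 * k - d)
    (z := B.coordFun 0 ^ k * ς - B.coordFun 1 ^ k * τ)
    (h.isLift.coordFun_regular 0) hτ.exists_algHom hτ.exists_mem_adjoin hς.exists_mem_adjoin
    (fun s => ⟨B.constTranslate s, constTranslate_coordFun s 0, constTranslate_coordFun s 1,
      hτ.constTranslate s, hς.constTranslate s, by
        rw [map_sub, map_mul, map_mul, map_pow, map_pow, hτ.constTranslate, hς.constTranslate,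
          constTranslate_coordFun, constTranslate_coordFun, mul_add, mul_add, mul_smul_comm,
          mul_smul_comm, mul_comm (B.coordFun 1 ^ k) (B.coordFun 0 ^ k)]
        ring⟩)
    (fun c hc => ⟨constAct μ (Units.mk0 c hc),
      by simpa using (h.isLift.hasGmWeight_coordFun 0).constAct (Units.mk0 c hc),
      by simpa using (h.isLift.hasGmWeight_coordFun 1).constAct (Units.mk0 c hc),
      by simpa using hzw.constAct (Units.mk0 c hc)⟩)
  refine ⟨τ, ς, k, g, ⟨h.two_le, by omega, h.isLift.coordFun_regular 0, hτ.exists_algHom,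
    hτ.exists_mem_adjoin, hς.exists_mem_adjoin, coordFun_glue, hg, hz, ?_⟩, hτw⟩
  -- Without such a coefficient the cocycle is a coboundary: τ and ς, corrected by forms, become x^k
  -- a and y^k a, and a has slope one.
  by_contra! hcon
  obtain ⟨p, q, hpq⟩ := exists_form_eq_add (by omega) (by have := h.two_le; omega) g hcon
    (B.coordFun 0) (B.coordFun 1)
  rw [hpq] at hz
  obtain ⟨a, ha0, ha1⟩ := B.coordFun_glue k (τ + form (k - d) q (B.coordFun 0) (B.coordFun 1))
    (ς - form (k - d) p (B.coordFun 0) (B.coordFun 1)) (by linear_combination -hz)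
  refine h.nontrivial (hasSlope_one_of_mul (k := k) (a := a)
    (Fin.forall_fin_two.2 ⟨fun T b r => ?_, fun T b r => ?_⟩)).isTrivial
  · rw [← ha0, map_add, map_add, form_coordFun_act, hτ]
    ring
  · rw [← ha1, map_sub, map_sub, form_coordFun_act, hς]
    ring

end GaBundle

/-! ### Morphisms to affine schemes. -/

section Affine
variable {T X X' : CScheme}

lemma hom_ext_of_isAffine [IsAffine X.left] {p q : T ⟶ X}
    (h : ∀ a, p.left.appTop a = q.left.appTop a) : p = q := by
  ext1
  exact ext_of_isAffine (by ext a; exact h a)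

lemma exists_appTop_eq {Z Z' : Scheme.{0}} [IsAffine Z'] (φ : Γ(Z', ⊤) ⟶ Γ(Z, ⊤)) :
    ∃ f : Z ⟶ Z', f.appTop = φ := by
  obtain ⟨f, hf⟩ : ∃ f, f = Z.toSpecΓ ≫ Spec.map φ ≫ Z'.isoSpec.inv := ⟨_, rfl⟩
  have h1 : f ≫ Z'.toSpecΓ = Z.toSpecΓ ≫ Spec.map φ := by
    change f ≫ Z'.isoSpec.hom = _
    rw [hf, Category.assoc, Category.assoc, Iso.inv_hom_id, Category.comp_id]
  have h2 := congrArg Scheme.Hom.appTop h1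
  rw [Scheme.Hom.comp_appTop, Scheme.Hom.comp_appTop, Scheme.toSpecΓ_appTop, Scheme.toSpecΓ_appTop,
    Scheme.ΓSpecIso_naturality] at h2
  exact ⟨f, (cancel_epi _).mp h2⟩

/-- Morphisms to an affine scheme are homomorphisms of the rings of functions. -/
lemma exists_hom_of_algHom [IsAffine X.left] (φ : Γ(X.left, ⊤) →ₐ[ℂ] Γ(T.left, ⊤)) :
    ∃ f : T ⟶ X, ∀ a, f.left.appTop a = φ a := by
  obtain ⟨f, hf⟩ := exists_appTop_eq (CommRingCat.ofHom φ.toRingHom)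
  refine ⟨Over.homMk f ?_, fun a => ?_⟩
  · refine ext_of_isAffine ?_
    rw [← cancel_epi (Scheme.ΓSpecIso (CommRingCat.of ℂ)).inv]
    ext c
    rw [Scheme.Hom.comp_appTop, hf]
    exact φ.commutes c
  · change f.appTop a = φ a
    rw [hf]
    rfl

lemma exists_iso_of_algEquiv [IsAffine X.left] [IsAffine X'.left]
    (φ : Γ(X'.left, ⊤) ≃ₐ[ℂ] Γ(X.left, ⊤)) :
    ∃ f : X ≅ X', ∀ a, f.hom.left.appTop a = φ a := by
  obtain ⟨f, hf⟩ := exists_hom_of_algHom φ.toAlgHom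
  obtain ⟨g, hg⟩ := exists_hom_of_algHom φ.symm.toAlgHom
  refine ⟨⟨f, g, hom_ext_of_isAffine fun a => ?_, hom_ext_of_isAffine fun a => ?_⟩, hf⟩
  · rw [appTop_comp, hf, hg, id_appTop]
    exact φ.apply_symm_apply a
  · rw [appTop_comp, hf, hg, id_appTop]
    exact φ.symm_apply_apply a

end Affine

/-! ### Homogeneous functions on an integral scheme. -/

section Saturation
variable {X : CScheme} {μ : GmAction X}

variable (μ) in
/-- The functions of weight `w`. -/
def weightSpace (w : ℤ) : Submodule ℂ Γ(X.left, ⊤) where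
  carrier := {a | HasGmWeight μ a w}
  zero_mem' := by
    intro T c p
    rw [map_zero, map_zero, mul_zero]
  add_mem' ha hb := HasGmWeight.add ha hb
  smul_mem' s a ha := by
    intro T c p
    rw [← appTopAlgHom_apply, ← appTopAlgHom_apply, map_smul, map_smul, appTopAlgHom_apply,
      appTopAlgHom_apply, ha, mul_smul_comm]

instance : SetLike.GradedMonoid (weightSpace μ) where
  one_mem := HasGmWeight.one
  mul_mem _ _ _ _ ha hb := HasGmWeight.mul ha hb

lemma isIntegral_torus [IsIntegral X.left] : IsIntegral (torus X).left := by
  have : IsIntegral (line X).left := inferInstanceAs (IsIntegral 𝔸(Fin 1; X.left))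
  obtain ⟨g, -⟩ := exists_torus_lift (𝟙 X) 1
  have : Nonempty ((line X).left.basicOpen (lineCoord X)).toScheme :=
    ⟨g.left (Classical.arbitrary X.left)⟩
  have key : IsIntegral ((line X).left.basicOpen (lineCoord X)).toScheme :=
    isIntegral_of_isOpenImmersion ((line X).left.basicOpen (lineCoord X)).ι
  exact key

/-- The homogeneous functions on an integral scheme are closed under division. -/
lemma HasGmWeight.of_mul [IsIntegral X.left] {z a : Γ(X.left, ⊤)} {i j : ℤ} (hz0 : z ≠ 0)
    (hz : HasGmWeight μ z i) (hza : HasGmWeight μ (z * a) (i + j)) : HasGmWeight μ a j := by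
  have := isIntegral_torus (X := X)
  obtain ⟨g, hg, -⟩ := exists_torus_lift (𝟙 X) 1
  have hne : (torusProj X).left.appTop z ≠ 0 := by
    intro h0
    apply hz0
    have := congrArg g.left.appTop h0
    rwa [← appTop_comp, hg, id_appTop, map_zero] at this
  -- Cancelling z needs an integral scheme, which a general T is not; on the universal point it is
  -- allowed, and the identity then pulls back.
  have key : (μ.act (torusUnit X) (torusProj X)).left.appTop a =
      ((torusUnit X ^ j : Γ((torus X).left, ⊤)ˣ) : Γ((torus X).left, ⊤)) *
        (torusProj X).left.appTop a := by
    have h1 := hza (torusUnit X) (torusProj X)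
    rw [map_mul, map_mul, hz, zpow_add, Units.val_mul] at h1
    refine mul_left_cancel₀ hne ((torusUnit X ^ i).isUnit.mul_left_cancel ?_)
    linear_combination h1
  intro T c p
  obtain ⟨g, hg, hc⟩ := exists_torus_lift p c
  have h2 := congrArg g.left.appTop key
  rwa [map_mul, ← coe_unitsMap_zpow, ← appTop_comp, ← appTop_comp, μ.natural, hg, hc] at h2

end Saturation

/-! ### Classification of homogeneous bundles. -/

namespace GaBundle
variable {B B' : GaBundle} {μ : GmAction B.X} {μ' : GmAction B'.X} {d d' : ℕ}

/-- The total space of a nontrivial homogeneous bundle is affine, and its ring of functions is that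
of the threefold `X_{1,d-1}`, with homogeneous coordinates. -/
theorem IsHomogeneousWith.isAffine_and_exists_algEquiv (h : B.IsHomogeneousWith μ d) :
    IsAffine B.X.left ∧ ∃ e : ThreefoldRing 1 (d - 1) ≃ₐ[ℂ] Γ(B.X.left, ⊤),
      ∀ i, HasGmWeight μ (e (ThreefoldRing.gen 1 (d - 1) i)) (ThreefoldRing.weight (d - 1) i) := by
  obtain ⟨τ, ς, k, g, htor, hτ⟩ := h.exists_isTorsorRing
  obtain ⟨hcop, e, he⟩ := htor.exists_algEquiv
  have := h.isLift.isAffineHom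
  have hdom := htor.isDomain
  have haff : IsAffine B.X.left := by
    -- x and y generate the unit ideal, and the loci where they are invertible are affine, being
    -- preimages of affine charts under the affine morphism ρ.
    refine isAffine_of_isAffineOpen_basicOpen {B.coordFun 0, B.coordFun 1}
      ((Ideal.eq_top_iff_one _).mpr (Ideal.mem_span_pair.mpr hcop)) ?_
    have key (i : Fin 2) : IsAffineOpen (B.X.left.basicOpen (B.coordFun i)) := by
      rw [coordFun, ← preimage_locus]
      exact IsAffineOpen.preimage (isAffine_locus i) _
    rintro _ (rfl | rfl)
    exacts [key 0, key 1]
  have : Nonempty B.X.left :=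
    ⟨B.X.left.isoSpec.inv (Classical.arbitrary (PrimeSpectrum Γ(B.X.left, ⊤)))⟩
  have := isIntegral_of_isAffine_of_isDomain B.X.left
  exact ⟨haff, e, he (weightSpace μ) (fun i j z a h0 hz hza => HasGmWeight.of_mul h0 hz hza)
    (h.isLift.hasGmWeight_coordFun 0) (h.isLift.hasGmWeight_coordFun 1) hτ⟩

theorem IsHomogeneousWith.gmIsomorphic (h : B.IsHomogeneousWith μ d)
    (h' : B'.IsHomogeneousWith μ' d) : GmIsomorphic μ μ' := by
  obtain ⟨_, e, he⟩ := h.isAffine_and_exists_algEquiv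
  obtain ⟨_, e', he'⟩ := h'.isAffine_and_exists_algEquiv
  obtain ⟨f, hf⟩ := exists_iso_of_algEquiv (e'.symm.trans e)
  refine ⟨f, fun {T} c p => hom_ext_of_isAffine fun a => ?_⟩
  -- Equivariance is checked on the four generators, whose weights on the two sides coincide.
  have key : ((appTopAlgHom (μ.act c p ≫ f.hom)).comp e'.toAlgHom) =
      ((appTopAlgHom (μ'.act c (p ≫ f.hom))).comp e'.toAlgHom) :=
    ThreefoldRing.algHom_ext fun i => by
      have h1 : f.hom.left.appTop (e' (ThreefoldRing.gen 1 (d - 1) i)) =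
          e (ThreefoldRing.gen 1 (d - 1) i) := by
        rw [hf, AlgEquiv.trans_apply, AlgEquiv.symm_apply_apply]
      change (μ.act c p ≫ f.hom).left.appTop (e' _) = (μ'.act c (p ≫ f.hom)).left.appTop (e' _)
      rw [appTop_comp, h1, he, he', appTop_comp, h1]
  obtain ⟨r, rfl⟩ := e'.surjective a
  exact DFunLike.congr_fun key r

theorem IsHomogeneousWith.eq_of_gmIsomorphic (h : B.IsHomogeneousWith μ d)
    (h' : B'.IsHomogeneousWith μ' d') (hiso : GmIsomorphic μ μ') : d = d' := by
  obtain ⟨_, e, he⟩ := h.isAffine_and_exists_algEquiv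
  obtain ⟨_, e', he'⟩ := h'.isAffine_and_exists_algEquiv
  obtain ⟨f, hf⟩ := hiso
  let φ : Γ(B.X.left, ⊤) ≃ₐ[ℂ] Γ(B'.X.left, ⊤) :=
    AlgEquiv.ofAlgHom (appTopAlgHom f.inv) (appTopAlgHom f.hom)
      (AlgHom.ext fun a => by
        rw [AlgHom.comp_apply, appTopAlgHom_apply, appTopAlgHom_apply, ← appTop_comp, f.inv_hom_id,
          id_appTop]
        rfl)
      (AlgHom.ext fun a => by
        rw [AlgHom.comp_apply, appTopAlgHom_apply, appTopAlgHom_apply, ← appTop_comp, f.hom_inv_id,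
          id_appTop]
        rfl)
  have hscale (c : ℂˣ) (r : ThreefoldRing 1 (d' - 1)) :
      e' (ThreefoldRing.scale (d' - 1) c r) = constAct μ' c (e' r) := by
    have : e'.toAlgHom.comp (ThreefoldRing.scale (d' - 1) c) =
        (constAct μ' c).comp e'.toAlgHom := ThreefoldRing.algHom_ext fun i => by
      change e' (ThreefoldRing.scale (d' - 1) c (ThreefoldRing.gen 1 (d' - 1) i)) =
        constAct μ' c (e' (ThreefoldRing.gen 1 (d' - 1) i))
      rw [(he' i).constAct, ThreefoldRing.scale_gen, map_smul]
    exact DFunLike.congr_fun this r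
  have hact (c : ℂˣ) : μ'.act (constUnit B'.X c) (𝟙 B'.X) ≫ f.inv =
      μ.act (constUnit B'.X c) f.inv := by
    rw [Iso.comp_inv_eq, hf, f.inv_hom_id]
  -- Only constant scalars acting on the identity point are needed here; they give the scaling
  -- automorphisms of the coordinate rings.
  have := ThreefoldRing.eq_of_equivariant (m := d - 1) (n := d' - 1)
    (by have := h.two_le; omega) (by have := h'.two_le; omega) ((e.trans φ).trans e'.symm)
    (fun c i => e'.injective (by
      rw [hscale, map_smul, AlgEquiv.trans_apply, AlgEquiv.apply_symm_apply, AlgEquiv.trans_apply]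
      change (μ'.act (constUnit B'.X c) (𝟙 B'.X)).left.appTop (f.inv.left.appTop _) =
        _ • f.inv.left.appTop _
      rw [← appTop_comp, hact, he, constUnit_zpow, Algebra.smul_def]))
  have := h.two_le
  have := h'.two_le
  omega

end GaBundle

end

end PuncturedPlane

open PuncturedPlane in
theorem theorem2 :
    (∀ (B B' : GaBundle) (μ : GmAction B.X) (μ' : GmAction B'.X) (d d' : ℕ),
      B.IsHomogeneousWith μ d → B'.IsHomogeneousWith μ' d' →
        (GmIsomorphic μ μ' ↔ d = d')) ∧
    (∀ d : ℕ, 2 ≤ d → ∀ B B' : GaBundle, B.IsHomogeneous d → B'.IsHomogeneous d →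
      IsAffine B.X.left ∧ IsAffine B'.X.left ∧ Nonempty (B.X ≅ B'.X)) ∧
    (∀ m n p q : ℕ, 0 < m → 0 < n → 0 < p → 0 < q → m + n = p + q →
      Nonempty (Xmn m n ≅ Xmn p q)) := by
  refine ⟨fun B B' μ μ' d d' h h' => ⟨h.eq_of_gmIsomorphic h', ?_⟩,
    fun d _ B B' ⟨μ, h⟩ ⟨μ', h'⟩ => ⟨h.isAffine_and_exists_algEquiv.1,
      h'.isAffine_and_exists_algEquiv.1, ?_⟩,
    fun m n p q hm hn hp hq h => nonempty_iso_Xmn hm hn hp hq h⟩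
  · rintro rfl
    exact h.gmIsomorphic h'
  · obtain ⟨f, -⟩ := h.gmIsomorphic h'
    exact ⟨f⟩
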